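/- **Theorem (Perfectoid Riemann–Roch).** Let $K$ be a perfectoid field with residue characteristic $p$, with algebraic closure $\bar K$ and absolute value $|\cdot|$ extended to $\bar K$. Let $q\in K^\times$ with $|q|<1$, together with a compatible system of roots $q^{1/p^j}\in K^\times$, $(q^{1/p^{j+1}})^p=q^{1/p^j}$. Fix an integer $i\ge 0$. *Functions.* Let $\mathcal O_i$ be the ring of Laurent series $\sum_{n\in p^{-i}\mathbb Z}a_nX^n$ with $a_n\in K$ that converge for all $0<|X|<\infty$ (i.e. $|a_n|r^n\to0$ for every real $r>0$), and let $\mathcal M_i$ be its ring of fractions, the meromorphic functions in $X^{1/p^i}$. A function $f\in\mathcal M_i$ is $q$-periodic if $f(q^{-1}X)=f(X)$, where the substitution sends $X^{n}$ to $q^{-n}X^{n}$ for $n\in p^{-i}\mathbb Z$. *Orders.* A point is given by the value $y\in\bar K^\times$ of $X^{1/p^i}$ (so $X=y^{p^i}$; if $\operatorname{char}K=p$, then $y$ and $\alpha=y^{p^i}$ determine each other). Let $\varphi_y$ be the irreducible polynomial of $y$ over $K$. For $0\ne g\in\mathcal O_i$ let $\mathrm{ord}_y(g)=p^{-i}\cdot\max\{k\ge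 0:\varphi_y(X^{1/p^i})^k\mid g\}$, and put $\mathrm{ord}_y(g/h)=\mathrm{ord}_y(g)-\mathrm{ord}_y(h)$, $\mathrm{ord}_y(0)=+\infty$. (If $\operatorname{char}K=p$, then $\varphi_y(X^{1/p^i})=\varphi_\alpha(X)^{1/p^i}$, so this is the exponent in $p^{-i}\mathbb Z$ of the highest power of $\varphi_\alpha(X)$ dividing $g$.) *Divisors.* A divisor is a family $d=(m_y)_{y\in\bar K^\times}$, $m_y\in\mathbb Z[1/p]$, such that $m_y=m_z$ if $y,z$ are conjugate over $K$ and such that for all $0<r\le r'$ only finitely many $y$ with $r\le|y|\le r'$ have $m_y\ne0$. It has denominator $1/p^i$ if all $m_y\in p^{-i}\mathbb Z$; it is $q$-periodic if it is invariant under $X\mapsto qX$, i.e. $m_{q^{1/p^i}y}=m_y$ for all $y$. Its degree is $$\deg_q(d)=\sum_{|q|<|y|^{p^i}\le1}e_y\,m_y,$$ where $e_y$ is the degree of inseparability of $y$ over $K$. Let $d$ be a $q$-periodic divisor with denominator $1/p^i$ and $\deg_q(d)>0$. Then $$L_K(q\mid d)=\{f\in\mathcal M_i \text{ $q$-periodic}:\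 \mathrm{ord}_y(f)\ge -m_y\ \text{for all } y\in\bar K^\times\}$$ is a finite-dimensional $K$-subspace of $\mathcal M_i$, and $$\dim_K L_K(q\mid d)=\deg_q(d)\cdot p^i .$$ -/

import Mathlib

open Filter Topology IntermediateField

set_option linter.unusedSectionVars false

noncomputable section

namespace PerfectoidTate

/-- The complete non-archimedean field `K` is a perfectoid field of residue characteristic `p`:
its absolute value is not discrete (in particular not trivial), `|p| < 1`, and the `p`-th power
map is surjective on `K° / p`. -/
structure IsPerfectoidField (p : ℕ) (K : Type*) [NormedField K] [IsUltrametricDist K]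
    [CompleteSpace K] : Prop where
  nondiscrete : ∀ x : K, ‖x‖ < 1 → ∃ y : K, ‖x‖ < ‖y‖ ∧ ‖y‖ < 1
  norm_p_lt_one : ‖(p : K)‖ < 1
  frobenius_surjective : ∀ x : K, ‖x‖ ≤ 1 → ∃ y : K, ‖x - y ^ p‖ ≤ ‖(p : K)‖

section Ring

variable (K : Type*) [NormedField K] [IsUltrametricDist K] [CompleteSpace K]
variable (Γ : AddSubgroup ℚ)

/-- Coefficient families `(a_n)`, `n ∈ Γ`, of the Laurent series `∑ a_n X ^ n` that converge
for all `0 < |X| < ∞`, that is `|a_n| r ^ n → 0` for every radius `r > 0`. -/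
def entireCoeffs : Submodule K (Γ → K) where
  carrier := {a | ∀ r : ℝ, 0 < r →
    Tendsto (fun n : Γ => ‖a n‖ * r ^ (((n : ℚ) : ℝ))) cofinite (𝓝 0)}
  zero_mem' := by
    intro r _
    simpa using tendsto_const_nhds
  add_mem' := by
    intro a b ha hb r hr
    have h := (ha r hr).add (hb r hr)
    rw [add_zero] at h
    refine squeeze_zero (fun n => by positivity) (fun n => ?_) h
    rw [← add_mul]
    exact mul_le_mul_of_nonneg_right (norm_add_le _ _) (Real.rpow_nonneg hr.le _)
  smul_mem' := by
    intro c a ha r hr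
    have h := (ha r hr).const_mul ‖c‖
    rw [mul_zero] at h
    refine h.congr (fun n => ?_)
    simp [mul_assoc]

/-- The ring of Laurent series `∑_{n ∈ Γ} a_n X ^ n` with coefficients in `K` and exponents
in `Γ ⊆ ℚ` that converge for all `0 < |X| < ∞`; the product is the Cauchy product. -/
def LaurentFn : Type _ := ↥(entireCoeffs K Γ)

namespace LaurentFn

instance : AddCommGroup (LaurentFn K Γ) := inferInstanceAs (AddCommGroup ↥(entireCoeffs K Γ))

instance : Module K (LaurentFn K Γ) := inferInstanceAs (Module K ↥(entireCoeffs K Γ))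

variable {K Γ}

/-- The coefficient of `X ^ n`. -/
def coeff (f : LaurentFn K Γ) (n : Γ) : K := f.1 n

@[ext] theorem ext {f g : LaurentFn K Γ} (h : ∀ n, f.coeff n = g.coeff n) : f = g :=
  Subtype.ext (funext h)

@[simp] theorem coeff_add (f g : LaurentFn K Γ) (n : Γ) :
    (f + g).coeff n = f.coeff n + g.coeff n := rfl

@[simp] theorem coeff_smul (c : K) (f : LaurentFn K Γ) (n : Γ) :
    (c • f).coeff n = c * f.coeff n := rfl

@[simp] theorem coeff_zero (n : Γ) : (0 : LaurentFn K Γ).coeff n = 0 := rfl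

theorem tendsto_coeff_mul (f : LaurentFn K Γ) {r : ℝ} (hr : 0 < r) :
    Tendsto (fun n : Γ => ‖f.coeff n‖ * r ^ (((n : ℚ) : ℝ))) cofinite (𝓝 0) := f.2 r hr

theorem tendsto_coeff (f : LaurentFn K Γ) : Tendsto f.coeff cofinite (𝓝 0) := by
  rw [tendsto_zero_iff_norm_tendsto_zero]
  simpa using f.tendsto_coeff_mul one_pos

theorem exists_bound (f : LaurentFn K Γ) {r : ℝ} (hr : 0 < r) :
    ∃ C : ℝ, 0 < C ∧ ∀ n, ‖f.coeff n‖ * r ^ (((n : ℚ) : ℝ)) ≤ C := by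
  have h := (f.tendsto_coeff_mul hr).eventually_lt_const one_pos
  rw [eventually_cofinite] at h
  obtain ⟨B, hB⟩ := (h.image fun n : Γ => ‖f.coeff n‖ * r ^ (((n : ℚ) : ℝ))).bddAbove
  refine ⟨max B 1, by positivity, fun n => ?_⟩
  by_cases hn : ‖f.coeff n‖ * r ^ (((n : ℚ) : ℝ)) < 1
  · exact hn.le.trans (le_max_right _ _)
  · exact (hB ⟨n, hn, rfl⟩).trans (le_max_left _ _)

theorem exists_bound_one (f : LaurentFn K Γ) : ∃ C : ℝ, 0 < C ∧ ∀ n, ‖f.coeff n‖ ≤ C := by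
  simpa using f.exists_bound one_pos

theorem summable_of_bound {ι : Type*} {u v : ι → K} (hu : Tendsto u cofinite (𝓝 0)) {C : ℝ}
    (hv : ∀ k, ‖v k‖ ≤ C) : Summable fun k => u k * v k := by
  apply NonarchimedeanAddGroup.summable_of_tendsto_cofinite_zero
  rw [tendsto_zero_iff_norm_tendsto_zero] at hu ⊢
  have h := hu.mul_const C
  rw [zero_mul] at h
  refine squeeze_zero (fun n => norm_nonneg _) (fun n => ?_) h
  rw [norm_mul]
  exact mul_le_mul_of_nonneg_left (hv n) (norm_nonneg _)

theorem summable_mul (f g : LaurentFn K Γ) (n : Γ) :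
    Summable fun k : Γ => f.coeff k * g.coeff (n - k) := by
  obtain ⟨C, -, hC⟩ := g.exists_bound_one
  exact summable_of_bound f.tendsto_coeff fun k => hC _

theorem mul_mem (f g : LaurentFn K Γ) :
    (fun n : Γ => ∑' k : Γ, f.coeff k * g.coeff (n - k)) ∈ entireCoeffs K Γ := by
  intro r hr
  obtain ⟨A, hA, hfA⟩ := f.exists_bound hr
  obtain ⟨B, hB, hgB⟩ := g.exists_bound hr
  rw [Metric.tendsto_nhds]
  intro ε hε
  have hf := (f.tendsto_coeff_mul hr).eventually_lt_const (show 0 < ε / 2 / B by positivity)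
  have hg := (g.tendsto_coeff_mul hr).eventually_lt_const (show 0 < ε / 2 / A by positivity)
  rw [eventually_cofinite] at hf hg ⊢
  refine (Set.Finite.image2 (· + ·) hf hg).subset ?_
  intro n hn
  by_contra hcon
  apply hn
  have key : ∀ k : Γ, ‖f.coeff k * g.coeff (n - k)‖ ≤ ε / 2 / r ^ (((n : ℚ) : ℝ)) := by
    intro k
    rw [le_div_iff₀ (by positivity)]
    have e : ‖f.coeff k * g.coeff (n - k)‖ * r ^ (((n : ℚ) : ℝ)) =
        (‖f.coeff k‖ * r ^ (((k : ℚ) : ℝ))) *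
          (‖g.coeff (n - k)‖ * r ^ ((((n - k : Γ) : ℚ) : ℝ))) := by
      have : (((n : ℚ) : ℝ)) = ((k : ℚ) : ℝ) + (((n - k : Γ) : ℚ) : ℝ) := by
        push_cast
        ring
      rw [norm_mul, this, Real.rpow_add hr]
      ring
    rw [e]
    by_cases hk : ‖f.coeff k‖ * r ^ (((k : ℚ) : ℝ)) < ε / 2 / B
    · calc _ ≤ ε / 2 / B * B := by
            apply mul_le_mul hk.le (hgB _) (by positivity) (by positivity)
        _ = ε / 2 := by field_simp
    · by_cases hk' : ‖g.coeff (n - k)‖ * r ^ ((((n - k : Γ) : ℚ) : ℝ)) < ε / 2 / A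
      · calc _ ≤ A * (ε / 2 / A) := by
              apply mul_le_mul (hfA _) hk'.le (by positivity) (by positivity)
          _ = ε / 2 := by field_simp
      · exact absurd ⟨k, hk, n - k, hk', add_sub_cancel k n⟩ hcon
  have h2 := IsUltrametricDist.norm_tsum_le_of_forall_le_of_nonneg
    (f := fun k : Γ => f.coeff k * g.coeff (n - k)) (by positivity) key
  have h3 : ‖∑' k : Γ, f.coeff k * g.coeff (n - k)‖ * r ^ (((n : ℚ) : ℝ)) ≤ ε / 2 := by
    rwa [le_div_iff₀ (by positivity)] at h2
  rw [Real.dist_eq, sub_zero, abs_of_nonneg (by positivity)]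
  linarith

instance : Mul (LaurentFn K Γ) :=
  ⟨fun f g => ⟨fun n : Γ => ∑' k : Γ, f.coeff k * g.coeff (n - k), mul_mem f g⟩⟩

theorem coeff_mul (f g : LaurentFn K Γ) (n : Γ) :
    (f * g).coeff n = ∑' k : Γ, f.coeff k * g.coeff (n - k) := rfl

/-- The monomial `X ^ m`. -/
def X (m : Γ) : LaurentFn K Γ :=
  ⟨Pi.single m 1, by
    intro r _
    refine tendsto_nhds_of_eventually_eq ?_
    rw [eventually_cofinite]
    refine (Set.finite_singleton m).subset ?_
    intro n hn
    by_contra h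
    exact hn (by simp [Pi.single_eq_of_ne h])⟩

theorem coeff_X (m n : Γ) : (X m : LaurentFn K Γ).coeff n = if n = m then 1 else 0 := by
  simp [X, coeff, Pi.single_apply]

instance : One (LaurentFn K Γ) := ⟨X 0⟩

theorem one_def : (1 : LaurentFn K Γ) = X 0 := rfl

protected theorem mul_comm (f g : LaurentFn K Γ) : f * g = g * f := by
  ext n
  rw [coeff_mul, coeff_mul, ← (Equiv.subLeft n).tsum_eq]
  refine tsum_congr fun k => ?_
  simp [mul_comm]

protected theorem one_mul (f : LaurentFn K Γ) : 1 * f = f := by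
  ext n
  rw [coeff_mul, tsum_eq_single 0]
  · simp [one_def, coeff_X]
  · intro k hk
    simp [one_def, coeff_X, hk]

protected theorem add_mul (f g h : LaurentFn K Γ) : (f + g) * h = f * h + g * h := by
  ext n
  rw [coeff_add, coeff_mul, coeff_mul, coeff_mul,
    ← (summable_mul f h n).tsum_add (summable_mul g h n)]
  simp [add_mul]

protected theorem smul_mul (c : K) (f g : LaurentFn K Γ) : (c • f) * g = c • (f * g) := by
  ext n
  rw [coeff_smul, coeff_mul, coeff_mul, ← tsum_mul_left]
  simp [mul_assoc]

protected theorem mul_assoc (f g h : LaurentFn K Γ) : f * g * h = f * (g * h) := by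
  ext n
  obtain ⟨C, -, hC⟩ := h.exists_bound_one
  have : NonarchimedeanRing K :=
    { is_nonarchimedean := NonarchimedeanAddGroup.is_nonarchimedean }
  have hs0 : Summable fun x : Γ × Γ => f.coeff x.1 * g.coeff x.2 :=
    (NonarchimedeanAddGroup.summable_of_tendsto_cofinite_zero f.tendsto_coeff).mul_of_nonarchimedean
      (NonarchimedeanAddGroup.summable_of_tendsto_cofinite_zero g.tendsto_coeff)
  have hs1 : Summable fun x : Γ × Γ =>
      f.coeff x.1 * g.coeff x.2 * h.coeff (n - x.1 - x.2) :=
    summable_of_bound hs0.tendsto_cofinite_zero fun x => hC _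
  let e : Γ × Γ ≃ Γ × Γ :=
    { toFun := fun x => (x.2, x.1 - x.2)
      invFun := fun x => (x.1 + x.2, x.1)
      left_inv := fun x => by simp
      right_inv := fun x => by simp }
  have hs2 : Summable fun x : Γ × Γ =>
      f.coeff x.2 * g.coeff (x.1 - x.2) * h.coeff (n - x.1) := by
    refine (e.summable_iff.mpr hs1).congr fun x => ?_
    simp only [e, Function.comp, Equiv.coe_fn_mk]
    congr 2
    abel
  calc (f * g * h).coeff n
      = ∑' k : Γ, ∑' j : Γ, f.coeff j * g.coeff (k - j) * h.coeff (n - k) := by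
        rw [coeff_mul]
        refine tsum_congr fun k => ?_
        rw [coeff_mul, ← tsum_mul_right]
    _ = ∑' j : Γ, ∑' k : Γ, f.coeff j * g.coeff (k - j) * h.coeff (n - k) :=
        (Summable.tsum_comm (f := fun j k : Γ =>
          f.coeff j * g.coeff (k - j) * h.coeff (n - k))
          ((Equiv.prodComm Γ Γ).summable_iff.mpr hs2))
    _ = (f * (g * h)).coeff n := by
        rw [coeff_mul]
        refine tsum_congr fun j => ?_
        rw [coeff_mul, ← tsum_mul_left, ← (Equiv.addRight j).tsum_eq]
        refine tsum_congr fun k => ?_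
        simp only [Equiv.coe_addRight, add_sub_cancel_right, mul_assoc]
        congr 3
        abel

instance : CommRing (LaurentFn K Γ) where
  __ := (inferInstance : AddCommGroup (LaurentFn K Γ))
  mul_assoc := LaurentFn.mul_assoc
  mul_comm := LaurentFn.mul_comm
  one_mul := LaurentFn.one_mul
  mul_one f := by rw [LaurentFn.mul_comm, LaurentFn.one_mul]
  right_distrib := LaurentFn.add_mul
  left_distrib f g h := by
    rw [LaurentFn.mul_comm, LaurentFn.add_mul, LaurentFn.mul_comm g, LaurentFn.mul_comm h]
  zero_mul f := by
    ext n
    simp [coeff_mul]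
  mul_zero f := by
    ext n
    simp [coeff_mul]

instance : Algebra K (LaurentFn K Γ) :=
  Algebra.ofModule LaurentFn.smul_mul fun c f g => by
    rw [mul_comm, LaurentFn.smul_mul, mul_comm]

end LaurentFn

end Ring

section Level

variable (p i : ℕ)

/-- The group of exponents `p⁻ⁱ ℤ`. -/
def expGroup : AddSubgroup ℚ := AddSubgroup.zmultiples (1 / (p : ℚ) ^ i)

/-- The exponent `1 / pⁱ`. -/
def unitExp : expGroup p i := ⟨1 / (p : ℚ) ^ i, AddSubgroup.mem_zmultiples _⟩

variable {p i}

/-- The integer `n pⁱ`, for `n ∈ p⁻ⁱ ℤ`. -/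
def numer (n : expGroup p i) : ℤ := ((n : ℚ) * (p : ℚ) ^ i).num

theorem coe_numer [hp : Fact p.Prime] (n : expGroup p i) :
    ((numer n : ℤ) : ℚ) = (n : ℚ) * (p : ℚ) ^ i := by
  obtain ⟨n, hn⟩ := n
  obtain ⟨k, rfl⟩ := AddSubgroup.mem_zmultiples_iff.mp hn
  have h0 : (p : ℚ) ^ i ≠ 0 := pow_ne_zero _ (Nat.cast_ne_zero.mpr hp.out.ne_zero)
  have : (k • (1 / (p : ℚ) ^ i)) * (p : ℚ) ^ i = (k : ℚ) := by
    rw [zsmul_eq_mul]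
    field_simp
  simp only [numer, this, Rat.num_intCast]

theorem numer_add [Fact p.Prime] (m n : expGroup p i) : numer (m + n) = numer m + numer n := by
  have h : ((numer (m + n) : ℤ) : ℚ) = ((numer m + numer n : ℤ) : ℚ) := by
    push_cast
    rw [coe_numer, coe_numer, coe_numer]
    push_cast
    ring
  exact_mod_cast h

variable {K : Type*} [NormedField K] [IsUltrametricDist K] [CompleteSpace K] [hp : Fact p.Prime]

theorem norm_zpow_numer (u : Kˣ) (n : expGroup p i) :
    ‖((u ^ numer n : Kˣ) : K)‖ = (‖(u : K)‖ ^ p ^ i) ^ (((n : ℚ) : ℝ)) := by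
  have h : ((numer n : ℤ) : ℝ) = (((p ^ i : ℕ) : ℝ)) * ((n : ℚ) : ℝ) := by
    have := congrArg (fun x : ℚ => (x : ℝ)) (coe_numer n)
    push_cast at this ⊢
    rw [this, mul_comm]
  rw [Units.val_zpow_eq_zpow_val, norm_zpow, ← Real.rpow_intCast, h,
    Real.rpow_mul (norm_nonneg _), Real.rpow_natCast]

/-- The ring endomorphism `X ^ n ↦ u ^ (n pⁱ) X ^ n`, that is `X^(1/pⁱ) ↦ u X^(1/pⁱ)`. -/
def scaleHom (u : Kˣ) : LaurentFn K (expGroup p i) →+* LaurentFn K (expGroup p i) where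
  toFun f := ⟨fun n => ((u ^ numer n : Kˣ) : K) * f.coeff n, by
    intro r hr
    have hu : 0 < ‖(u : K)‖ ^ p ^ i := pow_pos (norm_pos_iff.mpr u.ne_zero) _
    refine (f.tendsto_coeff_mul (mul_pos hu hr)).congr fun n => ?_
    rw [norm_mul, norm_zpow_numer, Real.mul_rpow hu.le hr.le]
    ring⟩
  map_one' := by
    refine LaurentFn.ext fun n => ?_
    change ((u ^ numer n : Kˣ) : K) * (1 : LaurentFn K _).coeff n = (1 : LaurentFn K _).coeff n
    rw [LaurentFn.one_def, LaurentFn.coeff_X]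
    split_ifs with h
    · subst h
      simp [numer]
    · simp
  map_zero' := by
    refine LaurentFn.ext fun n => ?_
    exact mul_zero _
  map_add' f g := by
    refine LaurentFn.ext fun n => ?_
    exact mul_add _ _ _
  map_mul' f g := by
    refine LaurentFn.ext fun n => ?_
    change ((u ^ numer n : Kˣ) : K) * (f * g).coeff n = ∑' k, _
    rw [LaurentFn.coeff_mul, ← tsum_mul_left]
    refine tsum_congr fun k => ?_
    change _ = (((u ^ numer k : Kˣ) : K) * f.coeff k) *
      (((u ^ numer (n - k) : Kˣ) : K) * g.coeff (n - k))
    have h : numer n = numer k + numer (n - k) := by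
      rw [← numer_add, add_sub_cancel]
    rw [h, zpow_add, Units.val_mul]
    ring

theorem coeff_scaleHom (u : Kˣ) (f : LaurentFn K (expGroup p i)) (n : expGroup p i) :
    (scaleHom u f).coeff n = ((u ^ numer n : Kˣ) : K) * f.coeff n := rfl

/-- The substitution `X^(1/pⁱ) ↦ u X^(1/pⁱ)` as a ring automorphism. -/
def scale (u : Kˣ) : LaurentFn K (expGroup p i) ≃+* LaurentFn K (expGroup p i) :=
  RingEquiv.ofRingHom (scaleHom u) (scaleHom u⁻¹)
    (RingHom.ext fun f => LaurentFn.ext fun n => by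
      rw [RingHom.comp_apply, coeff_scaleHom, coeff_scaleHom, ← mul_assoc, ← Units.val_mul]
      simp)
    (RingHom.ext fun f => LaurentFn.ext fun n => by
      rw [RingHom.comp_apply, coeff_scaleHom, coeff_scaleHom, ← mul_assoc, ← Units.val_mul]
      simp)

/-- Meromorphic functions on `0 < |X| < ∞` over `K` in the variable `X^(1/pⁱ)`: quotients of
everywhere convergent Laurent series with exponents in `p⁻ⁱ ℤ`. -/
abbrev MeroFn (K : Type*) [NormedField K] [IsUltrametricDist K] [CompleteSpace K] (p i : ℕ)
    [Fact p.Prime] : Type _ :=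
  FractionRing (LaurentFn K (expGroup p i))

/-- Given the roots `q j = q^(1/pʲ)`, the functional equation `f (q⁻¹ X) = f X`, where the
substitution `X ↦ q⁻¹ X` sends `X^(k/pⁱ)` to `q^(-k/pⁱ) X^(k/pⁱ)`. -/
def IsPeriodicFn (q : ℕ → Kˣ) (f : MeroFn K p i) : Prop :=
  (IsFractionRing.ringEquivOfRingEquiv (scale (p := p) (i := i) (q i)⁻¹) :
    MeroFn K p i ≃+* MeroFn K p i) f = f

variable (p i)

/-- `φ(X^(1/pⁱ))`, where `φ` is the irreducible polynomial over `K` of the value `y` of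
`X^(1/pⁱ)` at a point. If `K` has characteristic `p`, this is the `pⁱ`-th root of `φ_α(X)`,
where `φ_α` is the irreducible polynomial of `α = y ^ pⁱ`. -/
def primeAt (y : (AlgebraicClosure K)ˣ) : LaurentFn K (expGroup p i) :=
  Polynomial.aeval (LaurentFn.X (unitExp p i)) (minpoly K (y : AlgebraicClosure K))

variable {p i}

open Classical in
/-- The order of `f` at the point where `X^(1/pⁱ)` takes the value `y`, normalised so that
`primeAt p i y` has order `1 / pⁱ`; the order of `0` is `⊤`. For a nonzero series it is `1 / pⁱ`
times the exponent of the highest power of `primeAt p i y` that divides it, and it is extended to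
quotients by subtraction. -/
def ordAt (y : (AlgebraicClosure K)ˣ) (f : MeroFn K p i) : WithTop ℚ :=
  if f = 0 then ⊤
  else
    let s := IsLocalization.sec (nonZeroDivisors (LaurentFn K (expGroup p i))) f
    ((((multiplicity (primeAt p i y) s.1 : ℚ) -
      (multiplicity (primeAt p i y) (s.2 : LaurentFn K (expGroup p i)) : ℚ)) /
        (p : ℚ) ^ i : ℚ) : WithTop ℚ)

end Level

section Divisors

/-- A divisor: a family of multiplicities `m_y ∈ ℤ[1/p]`, `y` algebraic over `K` and nonzero,
with the finiteness condition on each region `r ≤ |y| ≤ r'` and the rationality condition. -/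
structure PerfDivisor (p : ℕ) (K : Type*) [NormedField K] where
  mult : (AlgebraicClosure K)ˣ → ℚ
  mem_inv_p : ∀ y, ∃ (k : ℤ) (j : ℕ), mult y = k / (p : ℚ) ^ j
  finite : ∀ r r' : ℝ, 0 < r →
    {y : (AlgebraicClosure K)ˣ | r ≤ spectralNorm K (AlgebraicClosure K) y ∧
      spectralNorm K (AlgebraicClosure K) y ≤ r' ∧ mult y ≠ 0}.Finite
  rational : ∀ y z : (AlgebraicClosure K)ˣ,
    IsConjRoot K (y : AlgebraicClosure K) (z : AlgebraicClosure K) → mult y = mult z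

namespace PerfDivisor

variable {p : ℕ} {K : Type*} [NormedField K]

/-- All multiplicities lie in `p⁻ⁱ ℤ`. -/
def HasDenominator (d : PerfDivisor p K) (i : ℕ) : Prop :=
  ∀ y, ∃ k : ℤ, d.mult y = k / (p : ℚ) ^ i

/-- The divisor, on the points given by the value `y` of `X^(1/pⁱ)`, is invariant under
`X ↦ q X`, that is under `y ↦ q^(1/pⁱ) y`. -/
def IsPeriodic (q : ℕ → Kˣ) (i : ℕ) (d : PerfDivisor p K) : Prop :=
  ∀ y, d.mult (Units.map (algebraMap K (AlgebraicClosure K)) (q i) * y) = d.mult y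

/-- `deg_q d = ∑ e_y m_y` over the points with `|q| < |X| ≤ 1`, where `X = y ^ pⁱ` and `e_y` is
the degree of inseparability of `y` over `K`. -/
def deg (q : ℕ → Kˣ) (i : ℕ) (d : PerfDivisor p K) : ℚ :=
  ∑ᶠ y ∈ {y : (AlgebraicClosure K)ˣ |
      ‖((q 0 : Kˣ) : K)‖ < spectralNorm K (AlgebraicClosure K) y ^ p ^ i ∧
        spectralNorm K (AlgebraicClosure K) y ^ p ^ i ≤ 1},
    (Field.finInsepDegree K K⟮(y : AlgebraicClosure K)⟯ : ℚ) * d.mult y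

end PerfDivisor

/-- The set `L_K(q | d)` of `q`-periodic meromorphic functions `f` in `X^(1/pⁱ)` with
`Div f ≥ -d`. -/
def rrSet {p i : ℕ} [Fact p.Prime] {K : Type*} [NormedField K] [IsUltrametricDist K]
    [CompleteSpace K] (q : ℕ → Kˣ) (d : PerfDivisor p K) : Set (MeroFn K p i) :=
  {f | IsPeriodicFn q f ∧ ∀ y, ((-d.mult y : ℚ) : WithTop ℚ) ≤ ordAt y f}

end Divisors

end PerfectoidTate

end

noncomputable section

namespace PerfectoidTate

/-! Put `T = X^(1/pⁱ)` and `Q = q^(1/pⁱ)`. The functions are then quotients of Laurent series in `T`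
that converge everywhere on the punctured line, and periodicity reads `f(Q⁻¹ T) = f(T)`: this is
Riemann–Roch on the Tate curve with parameter `Q`, the factor `pⁱ` coming from the normalisation of
orders.

The proof is the classical one by theta functions. There is a meromorphic `g` with divisor `d` and
`g(Q⁻¹ T) = c T^D g(T)`, where `D = deg_q(d) pⁱ` (`exists_meroTheta_of_divisor`). Multiplication by
`g` identifies the periodic `f` with `Div f ≥ -d` with the series `h` without poles that obey the
same functional equation (`exists_submodule`). On coefficients this equation is `h_(n+D) = c Q^(n+D)
h_n`. As `D > 0`, the coefficients `h_0, …, h_(D-1)` are free, and the others decay fast enough for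
convergence because the exponent of `Q` grows quadratically (`exists_autoSpace_equiv`). So the
dimension is `D`.

Two facts on the ring of series carry this. An irreducible polynomial `P(T)` with `P(0) ≠ 0` stays
prime (`prime_ofPoly`), and divisibility is decided by the multiplicities at these primes
(`dvd_of_multiplicity_le`), so that a quotient with nonnegative orders is a series. Both rest on
Weierstrass division on an annulus (`exists_sub_sum_mem_cl`); the annuli are then glued by
completeness (`dvd_of_forall_mem_cl`). The function `g` is a product of explicit theta functions,
one for each conjugacy class of points in the fundamental annulus (`exists_theta`). Each contributes
`deg P` to `D`, and `deg P` is the sum of the inseparability degrees of the roots of `P`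
(`sum_finInsepDegree`), which is the weighting used in `deg_q`. -/

theorem exists_lt_forall_le_of_tendsto_cofinite {ι : Type*} {x : ι → ℝ}
    (hx : Tendsto x cofinite (𝓝 0)) {C : ℝ} (hC : 0 < C) (h : ∀ k, x k < C) :
    ∃ C', 0 ≤ C' ∧ C' < C ∧ ∀ k, x k ≤ C' := by
  have h1 := hx.eventually_lt_const (half_pos hC)
  rw [eventually_cofinite] at h1
  classical
  set s := insert (C / 2) (h1.toFinset.image x)
  have hs : s.Nonempty := ⟨C / 2, by simp [s]⟩
  refine ⟨s.max' hs, ?_, ?_, fun k => ?_⟩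
  · exact (half_pos hC).le.trans (Finset.le_max' _ _ (by simp [s]))
  · rw [Finset.max'_lt_iff]
    intro y hy
    simp only [s, Finset.mem_insert, Finset.mem_image] at hy
    rcases hy with rfl | ⟨k, -, rfl⟩
    · linarith
    · exact h k
  · by_cases hk : x k < C / 2
    · exact hk.le.trans (Finset.le_max' _ _ (by simp [s]))
    · apply Finset.le_max'
      simp only [s, Finset.mem_insert, Finset.mem_image]
      exact Or.inr ⟨k, by simpa using hk, rfl⟩

/-! ### Laurent series in `T = X^(1/pⁱ)` and their Gauss norms. -/

section Level

variable {p i : ℕ} [hp : Fact p.Prime]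
variable {K : Type*} [NormedField K] [IsUltrametricDist K] [CompleteSpace K]

/-- The ring of everywhere convergent Laurent series in `T = X^(1/pⁱ)`. -/
abbrev LF (K : Type*) [NormedField K] [IsUltrametricDist K] [CompleteSpace K] (p i : ℕ) :
    Type _ := LaurentFn K (expGroup p i)

variable (p i) in
/-- The identification `ℤ ≃ p⁻ⁱ ℤ`. -/
def expEquiv : ℤ ≃+ expGroup p i where
  toFun n := n • unitExp p i
  invFun := numer
  left_inv n := by
    have h0 : (p : ℚ) ^ i ≠ 0 := pow_ne_zero _ (Nat.cast_ne_zero.mpr hp.out.ne_zero)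
    have : ((numer (n • unitExp p i) : ℤ) : ℚ) = n := by
      rw [coe_numer]
      simp [unitExp, h0]
    exact_mod_cast this
  right_inv m := by
    have h0 : (p : ℚ) ^ i ≠ 0 := pow_ne_zero _ (Nat.cast_ne_zero.mpr hp.out.ne_zero)
    apply Subtype.ext
    have := coe_numer m
    simp only [unitExp, AddSubgroup.coe_zsmul, zsmul_eq_mul, this]
    field_simp
  map_add' m n := add_zsmul _ _ _

theorem coe_expEquiv (n : ℤ) : ((expEquiv p i n : expGroup p i) : ℚ) = n / (p : ℚ) ^ i := by
  simp [expEquiv, unitExp, div_eq_mul_inv]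

theorem numer_expEquiv (n : ℤ) : numer (expEquiv p i n) = n := (expEquiv p i).left_inv n

/-- The coefficient of `T ^ n`. -/
def cf (f : LF K p i) (n : ℤ) : K := f.coeff (expEquiv p i n)

theorem cf_ext {f g : LF K p i} (h : ∀ n, cf f n = cf g n) : f = g :=
  LaurentFn.ext fun n => by
    obtain ⟨m, rfl⟩ := (expEquiv p i).surjective n
    exact h m

@[simp] theorem cf_add (f g : LF K p i) (n : ℤ) : cf (f + g) n = cf f n + cf g n := rfl

@[simp] theorem cf_zero (n : ℤ) : cf (0 : LF K p i) n = 0 := rfl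

@[simp] theorem cf_smul (c : K) (f : LF K p i) (n : ℤ) : cf (c • f) n = c * cf f n := rfl

@[simp] theorem cf_neg (f : LF K p i) (n : ℤ) : cf (-f) n = -cf f n := rfl

@[simp] theorem cf_sub (f g : LF K p i) (n : ℤ) : cf (f - g) n = cf f n - cf g n := rfl

theorem rpow_expEquiv {ρ : ℝ} (hρ : 0 < ρ) (n : ℤ) :
    (ρ ^ p ^ i) ^ (((expEquiv p i n : expGroup p i) : ℚ) : ℝ) = ρ ^ n := by
  have h0 : (p : ℝ) ^ i ≠ 0 := pow_ne_zero _ (Nat.cast_ne_zero.mpr hp.out.ne_zero)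
  rw [coe_expEquiv, ← Real.rpow_natCast, ← Real.rpow_mul hρ.le, ← Real.rpow_intCast]
  congr 1
  push_cast
  field_simp

theorem tendsto_cf (f : LF K p i) {ρ : ℝ} (hρ : 0 < ρ) :
    Tendsto (fun n : ℤ => ‖cf f n‖ * ρ ^ n) cofinite (𝓝 0) := by
  have h := (f.tendsto_coeff_mul (pow_pos hρ (p ^ i))).comp
    (expEquiv p i).injective.tendsto_cofinite
  refine h.congr fun n => ?_
  simp only [Function.comp, rpow_expEquiv hρ]
  rfl

/-- The series with given coefficients. -/
def mkLF (a : ℤ → K) (h : ∀ ρ : ℝ, 0 < ρ → Tendsto (fun n : ℤ => ‖a n‖ * ρ ^ n) cofinite (𝓝 0)) :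
    LF K p i :=
  ⟨fun n => a ((expEquiv p i).symm n), fun r hr => by
    have h0 : p ^ i ≠ 0 := pow_ne_zero _ hp.out.ne_zero
    -- The circle `|X| = r` is the circle `|T| = r^(1/pⁱ)`.
    have hs : 0 < r ^ ((p ^ i : ℕ) : ℝ)⁻¹ := Real.rpow_pos_of_pos hr _
    have h1 := (h _ hs).comp (expEquiv p i).symm.injective.tendsto_cofinite
    refine h1.congr fun n => ?_
    obtain ⟨m, rfl⟩ := (expEquiv p i).surjective n
    simp only [Function.comp, AddEquiv.symm_apply_apply]
    rw [← rpow_expEquiv (p := p) (i := i) hs, Real.rpow_inv_natCast_pow hr.le h0]⟩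

@[simp] theorem cf_mkLF (a : ℤ → K) (h) (n : ℤ) : cf (mkLF a h : LF K p i) n = a n := by
  change a ((expEquiv p i).symm (expEquiv p i n)) = a n
  simp

theorem cf_mul (f g : LF K p i) (n : ℤ) : cf (f * g) n = ∑' k : ℤ, cf f k * cf g (n - k) := by
  unfold cf
  rw [LaurentFn.coeff_mul, ← (expEquiv p i).toEquiv.tsum_eq]
  refine tsum_congr fun k => ?_
  simp

theorem tendsto_cf_mul (f g : LF K p i) (n : ℤ) :
    Tendsto (fun k : ℤ => cf f k * cf g (n - k)) cofinite (𝓝 0) := by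
  have h := (LaurentFn.summable_mul f g (expEquiv p i n)).tendsto_cofinite_zero.comp
    (expEquiv p i).injective.tendsto_cofinite
  refine h.congr fun k => ?_
  simp [cf]

theorem summable_cf_mul (f g : LF K p i) (n : ℤ) :
    Summable (fun k : ℤ => cf f k * cf g (n - k)) :=
  NonarchimedeanAddGroup.summable_of_tendsto_cofinite_zero (tendsto_cf_mul f g n)

theorem cf_scale (u : Kˣ) (f : LF K p i) (n : ℤ) :
    cf (scale u f) n = (u : K) ^ n * cf f n := by
  change (scaleHom u f).coeff _ = _
  rw [coeff_scaleHom, numer_expEquiv, Units.val_zpow_eq_zpow_val]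
  rfl

variable (p i K) in
/-- The monomial `T ^ n`. -/
def mono (n : ℤ) : LF K p i := LaurentFn.X (expEquiv p i n)

theorem cf_mono (m n : ℤ) : cf (mono p i K m) n = if n = m then 1 else 0 := by
  simp [cf, mono, LaurentFn.coeff_X]

theorem cf_one (n : ℤ) : cf (1 : LF K p i) n = if n = 0 then 1 else 0 := by
  have : (1 : LF K p i) = mono p i K 0 := by simp [mono, LaurentFn.one_def]
  rw [this, cf_mono]

theorem cf_mono_mul (m : ℤ) (f : LF K p i) (n : ℤ) : cf (mono p i K m * f) n = cf f (n - m) := by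
  rw [cf_mul, tsum_eq_single m]
  · simp [cf_mono]
  · intro k hk
    simp [cf_mono, hk]

theorem mono_zero : mono p i K 0 = 1 := by simp [mono, LaurentFn.one_def]

theorem mono_add (m n : ℤ) : mono p i K (m + n) = mono p i K m * mono p i K n := by
  refine cf_ext fun k => ?_
  rw [cf_mono_mul, cf_mono, cf_mono]
  simp only [sub_eq_iff_eq_add, add_comm]

theorem isUnit_mono (m : ℤ) : IsUnit (mono p i K m) :=
  IsUnit.of_mul_eq_one (mono p i K (-m)) (by rw [← mono_add, add_neg_cancel, mono_zero])

theorem mono_pow (m : ℤ) (k : ℕ) : mono p i K m ^ k = mono p i K (m * k) := by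
  induction k with
  | zero => simp [mono_zero]
  | succ k ih => rw [pow_succ, ih, ← mono_add]; push_cast; ring_nf

/-- The Gauss norm on the circle `|T| = ρ`. -/
def gn (ρ : ℝ) (f : LF K p i) : ℝ := ⨆ n : ℤ, ‖cf f n‖ * ρ ^ n

theorem bddAbove_gn (f : LF K p i) {ρ : ℝ} (hρ : 0 < ρ) :
    BddAbove (Set.range fun n : ℤ => ‖cf f n‖ * ρ ^ n) :=
  (tendsto_cf f hρ).bddAbove_range_of_cofinite

theorem le_gn (f : LF K p i) {ρ : ℝ} (hρ : 0 < ρ) (n : ℤ) : ‖cf f n‖ * ρ ^ n ≤ gn ρ f :=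
  le_ciSup (bddAbove_gn f hρ) n

theorem gn_le {f : LF K p i} {ρ C : ℝ} (h : ∀ n : ℤ, ‖cf f n‖ * ρ ^ n ≤ C) : gn ρ f ≤ C :=
  ciSup_le h

theorem gn_nonneg (f : LF K p i) {ρ : ℝ} (hρ : 0 < ρ) : 0 ≤ gn ρ f :=
  Real.iSup_nonneg fun n => by positivity

@[simp] theorem gn_zero (ρ : ℝ) : gn ρ (0 : LF K p i) = 0 := by simp [gn]

@[simp] theorem gn_neg (ρ : ℝ) (f : LF K p i) : gn ρ (-f) = gn ρ f := by simp [gn]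

theorem gn_sub_comm (ρ : ℝ) (f g : LF K p i) : gn ρ (f - g) = gn ρ (g - f) := by
  rw [← gn_neg, neg_sub]

theorem gn_add_le (f g : LF K p i) {ρ : ℝ} (hρ : 0 < ρ) :
    gn ρ (f + g) ≤ max (gn ρ f) (gn ρ g) := by
  refine gn_le fun n => ?_
  have h1 : ‖cf (f + g) n‖ ≤ max ‖cf f n‖ ‖cf g n‖ := IsUltrametricDist.norm_add_le_max _ _
  calc _ ≤ max ‖cf f n‖ ‖cf g n‖ * ρ ^ n := by gcongr
    _ = max (‖cf f n‖ * ρ ^ n) (‖cf g n‖ * ρ ^ n) := max_mul_of_nonneg _ _ (by positivity)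
    _ ≤ _ := max_le_max (le_gn f hρ n) (le_gn g hρ n)

theorem gn_sub_le (f g : LF K p i) {ρ : ℝ} (hρ : 0 < ρ) :
    gn ρ (f - g) ≤ max (gn ρ f) (gn ρ g) := by
  rw [sub_eq_add_neg, ← gn_neg ρ g]
  exact gn_add_le _ _ hρ

theorem gn_sub_le_sub (f g h : LF K p i) {ρ : ℝ} (hρ : 0 < ρ) :
    gn ρ (f - h) ≤ max (gn ρ (f - g)) (gn ρ (g - h)) := by
  simpa using gn_add_le (f - g) (g - h) hρ

/-- `n` is the largest index of a term of maximal size on the circle `|T| = ρ`. -/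
structure IsTop (ρ : ℝ) (f : LF K p i) (n : ℤ) : Prop where
  ne_zero : cf f n ≠ 0
  le : ∀ m, ‖cf f m‖ * ρ ^ m ≤ ‖cf f n‖ * ρ ^ n
  lt : ∀ m, n < m → ‖cf f m‖ * ρ ^ m < ‖cf f n‖ * ρ ^ n

theorem IsTop.gn_eq {ρ : ℝ} {f : LF K p i} {n : ℤ} (h : IsTop ρ f n) (hρ : 0 < ρ) :
    gn ρ f = ‖cf f n‖ * ρ ^ n :=
  le_antisymm (gn_le h.le) (le_gn f hρ n)

theorem IsTop.unique {ρ : ℝ} {f : LF K p i} {m n : ℤ} (h : IsTop ρ f m) (h' : IsTop ρ f n) :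
    m = n := by
  rcases lt_trichotomy m n with hl | rfl | hl
  · exact absurd (h.lt n hl) (not_lt.mpr (h'.le m))
  · rfl
  · exact absurd (h'.lt m hl) (not_lt.mpr (h.le n))

theorem cf_ne_zero {f : LF K p i} (hf : f ≠ 0) : ∃ n, cf f n ≠ 0 := by
  by_contra! h
  exact hf (cf_ext h)

theorem exists_isTop {ρ : ℝ} (hρ : 0 < ρ) {f : LF K p i} (hf : f ≠ 0) : ∃ n, IsTop ρ f n := by
  obtain ⟨n₀, hn₀⟩ := cf_ne_zero hf
  have hpos : 0 < ‖cf f n₀‖ * ρ ^ n₀ := by positivity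
  have hfin := (tendsto_cf f hρ).eventually_lt_const hpos
  rw [eventually_cofinite] at hfin
  obtain ⟨n₁, hn₁, hmax⟩ := hfin.exists_maximalFor (fun n => ‖cf f n‖ * ρ ^ n) _ ⟨n₀, by simp⟩
  have hle : ∀ m, ‖cf f m‖ * ρ ^ m ≤ ‖cf f n₁‖ * ρ ^ n₁ := fun m => by
    by_cases hm : ‖cf f m‖ * ρ ^ m < ‖cf f n₀‖ * ρ ^ n₀
    · exact hm.le.trans (not_lt.mp hn₁)
    · rcases le_total (‖cf f m‖ * ρ ^ m) (‖cf f n₁‖ * ρ ^ n₁) with h | h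
      · exact h
      · exact hmax hm h
  have hfin2 : {m | ‖cf f m‖ * ρ ^ m = ‖cf f n₁‖ * ρ ^ n₁}.Finite :=
    hfin.subset fun m (hm : _ = _) => by
      change ¬ _
      rw [hm]
      exact hn₁
  obtain ⟨n, hn, hmax2⟩ := hfin2.exists_maximalFor id _ ⟨n₁, rfl⟩
  have hn' : ‖cf f n‖ * ρ ^ n = ‖cf f n₁‖ * ρ ^ n₁ := hn
  refine ⟨n, ?_, fun m => ?_, fun m hm => ?_⟩
  · intro h0
    rw [h0, norm_zero, zero_mul] at hn'
    have := not_lt.mp hn₁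
    linarith
  · rw [hn']; exact hle m
  · rw [hn']
    refine lt_of_le_of_ne (hle m) fun he => ?_
    have : m ≤ n := hmax2 he hm.le
    omega

/-- In the sum for the coefficient of index `m + n`, every `k ≠ m` has `k > m` or `m + n - k > n`,
hence a factor past a top index; the term `k = m` strictly dominates. Thus the Gauss norm is
multiplicative and the top index is additive, as a degree is. -/
theorem IsTop.mul {ρ : ℝ} (hρ : 0 < ρ) {f g : LF K p i} {m n : ℤ} (hf : IsTop ρ f m)
    (hg : IsTop ρ g n) : IsTop ρ (f * g) (m + n) ∧ ‖cf (f * g) (m + n)‖ = ‖cf f m‖ * ‖cf g n‖ := by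
  have hF : 0 < ‖cf f m‖ * ρ ^ m := mul_pos (norm_pos_iff.mpr hf.ne_zero) (by positivity)
  have hG : 0 < ‖cf g n‖ * ρ ^ n := mul_pos (norm_pos_iff.mpr hg.ne_zero) (by positivity)
  have split : ∀ N k : ℤ, ‖cf f k * cf g (N - k)‖ * ρ ^ N =
      (‖cf f k‖ * ρ ^ k) * (‖cf g (N - k)‖ * ρ ^ (N - k)) := fun N k => by
    rw [norm_mul]
    have : ρ ^ N = ρ ^ k * ρ ^ (N - k) := by rw [← zpow_add₀ hρ.ne', add_sub_cancel]
    rw [this]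
    ring
  have hle : ∀ N, ‖cf (f * g) N‖ * ρ ^ N ≤ ‖cf f m‖ * ρ ^ m * (‖cf g n‖ * ρ ^ n) := fun N => by
    rw [← le_div_iff₀ (by positivity), cf_mul]
    refine IsUltrametricDist.norm_tsum_le_of_forall_le_of_nonneg (by positivity) fun k => ?_
    rw [le_div_iff₀ (by positivity), split]
    exact mul_le_mul (hf.le k) (hg.le _) (by positivity) hF.le
  have strict : ∀ N k, (m < k ∨ n < N - k) →
      ‖cf f k * cf g (N - k)‖ * ρ ^ N < ‖cf f m‖ * ρ ^ m * (‖cf g n‖ * ρ ^ n) := fun N k hk => by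
    rw [split]
    rcases hk with hk | hk
    · exact mul_lt_mul_of_lt_of_le_of_nonneg_of_pos (hf.lt k hk) (hg.le _) (by positivity) hG
    · exact mul_lt_mul_of_le_of_lt_of_nonneg_of_pos (hf.le k) (hg.lt _ hk) (by positivity) hF
  -- The ultrametric bound for an infinite sum only gives `≤`. Since the terms tend to zero, their
  -- strict bounds are first replaced by one uniform smaller bound.
  have sumlt : ∀ (N : ℤ) (u : ℤ → K), Tendsto u cofinite (𝓝 0) →
      (∀ k, ‖u k‖ * ρ ^ N < ‖cf f m‖ * ρ ^ m * (‖cf g n‖ * ρ ^ n)) →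
      ‖∑' k, u k‖ * ρ ^ N < ‖cf f m‖ * ρ ^ m * (‖cf g n‖ * ρ ^ n) := fun N u hu h => by
    obtain ⟨C, hC0, hC, hle⟩ := exists_lt_forall_le_of_tendsto_cofinite
      (tendsto_zero_iff_norm_tendsto_zero.mp hu)
      (C := ‖cf f m‖ * ρ ^ m * (‖cf g n‖ * ρ ^ n) / ρ ^ N) (by positivity)
      (fun k => by rw [lt_div_iff₀ (by positivity)]; exact h k)
    rw [← lt_div_iff₀ (by positivity)]
    exact (IsUltrametricDist.norm_tsum_le_of_forall_le_of_nonneg hC0 hle).trans_lt hC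
  have hmain : ‖cf (f * g) (m + n)‖ = ‖cf f m‖ * ‖cf g n‖ := by
    rw [cf_mul, (summable_cf_mul f g (m + n)).tsum_eq_add_tsum_ite m]
    have h1 : ‖∑' k, (if k = m then 0 else cf f k * cf g (m + n - k))‖ <
        ‖cf f m * cf g (m + n - m)‖ := by
      have h2 := sumlt (m + n) (fun k => if k = m then 0 else cf f k * cf g (m + n - k)) ?_ ?_
      · rw [add_sub_cancel_left, norm_mul]
        rw [mul_mul_mul_comm, ← zpow_add₀ hρ.ne'] at h2
        exact lt_of_mul_lt_mul_right h2 (by positivity)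
      · have := tendsto_cf_mul f g (m + n)
        rw [tendsto_zero_iff_norm_tendsto_zero] at this ⊢
        refine squeeze_zero (fun _ => norm_nonneg _) (fun k => ?_) this
        split_ifs <;> simp
        positivity
      · intro k
        split_ifs with hk
        · simpa using mul_pos hF hG
        · apply strict
          omega
    rw [IsUltrametricDist.norm_add_eq_max_of_norm_ne_norm h1.ne', max_eq_left h1.le, norm_mul,
      add_sub_cancel_left]
  have hmain' : ‖cf (f * g) (m + n)‖ * ρ ^ (m + n) = ‖cf f m‖ * ρ ^ m * (‖cf g n‖ * ρ ^ n) := by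
    rw [hmain, zpow_add₀ hρ.ne']; ring
  refine ⟨⟨?_, fun N => ?_, fun N hN => ?_⟩, hmain⟩
  · rw [← norm_pos_iff, hmain]
    exact mul_pos (norm_pos_iff.mpr hf.ne_zero) (norm_pos_iff.mpr hg.ne_zero)
  · rw [hmain']; exact hle N
  · rw [hmain', cf_mul]
    exact sumlt N _ (tendsto_cf_mul f g N) fun k => strict N k (by omega)

instance : Nontrivial (LF K p i) :=
  ⟨1, 0, fun h => by simpa [cf_one] using congrArg (fun f => cf f 0) h⟩

instance : IsDomain (LF K p i) :=
  have : NoZeroDivisors (LF K p i) := ⟨fun {f g} h => by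
    by_contra! hc
    obtain ⟨m, hm⟩ := exists_isTop one_pos hc.1
    obtain ⟨n, hn⟩ := exists_isTop one_pos hc.2
    exact (hm.mul one_pos hn).1.ne_zero (by simp [h])⟩
  NoZeroDivisors.to_isDomain _

theorem gn_mul (f g : LF K p i) {ρ : ℝ} (hρ : 0 < ρ) : gn ρ (f * g) = gn ρ f * gn ρ g := by
  by_cases hf : f = 0
  · simp [hf]
  by_cases hg : g = 0
  · simp [hg]
  obtain ⟨m, hm⟩ := exists_isTop hρ hf
  obtain ⟨n, hn⟩ := exists_isTop hρ hg
  obtain ⟨h1, h2⟩ := hm.mul hρ hn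
  rw [h1.gn_eq hρ, hm.gn_eq hρ, hn.gn_eq hρ, h2, zpow_add₀ hρ.ne']
  ring

theorem gn_pos {f : LF K p i} (hf : f ≠ 0) {ρ : ℝ} (hρ : 0 < ρ) : 0 < gn ρ f := by
  obtain ⟨m, hm⟩ := exists_isTop hρ hf
  rw [hm.gn_eq hρ]
  exact mul_pos (norm_pos_iff.mpr hm.ne_zero) (by positivity)

theorem gn_one {ρ : ℝ} (hρ : 0 < ρ) : gn ρ (1 : LF K p i) = 1 := by
  have h := gn_mul (1 : LF K p i) 1 hρ
  rw [mul_one] at h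
  have := gn_pos (one_ne_zero : (1 : LF K p i) ≠ 0) hρ
  nlinarith

/-- A larger radius favours higher exponents. The growth of the top index between two radii plays
the role of the number of zeros between them, and is used below to rule out divisibilities. -/
theorem IsTop.index_le {ρ σ : ℝ} (hρ : 0 < ρ) (hσ : ρ ≤ σ) {f : LF K p i} {m n : ℤ}
    (hm : IsTop ρ f m) (hn : IsTop σ f n) : m ≤ n := by
  by_contra! h
  have hσ0 := hρ.trans_le hσ
  have h1 := hm.le n
  have h2 := hn.lt m h
  have h3 : ‖cf f n‖ ≤ ‖cf f m‖ * ρ ^ (m - n) := by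
    rw [zpow_sub₀ hρ.ne', ← mul_div_assoc, le_div_iff₀ (by positivity)]
    exact h1
  have h4 : ‖cf f m‖ * σ ^ (m - n) < ‖cf f n‖ := by
    rw [zpow_sub₀ hσ0.ne', ← mul_div_assoc, div_lt_iff₀ (by positivity)]
    exact h2
  have h5 : ρ ^ (m - n) ≤ σ ^ (m - n) :=
    zpow_le_zpow_left₀ (by omega) hρ.le hσ
  have := mul_le_mul_of_nonneg_left h5 (norm_nonneg (cf f m))
  linarith

/-- By the ultrametric inequality a perturbation smaller than `gn ρ f` keeps the norm of the top
coefficient and cannot raise a smaller term to the maximum. -/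
theorem IsTop.of_gn_sub_lt {ρ : ℝ} (hρ : 0 < ρ) {f g : LF K p i} {n : ℤ} (hf : IsTop ρ f n)
    (h : gn ρ (f - g) < gn ρ f) : IsTop ρ g n := by
  rw [hf.gn_eq hρ] at h
  have hlt : ∀ m, ‖cf f m - cf g m‖ * ρ ^ m < ‖cf f n‖ * ρ ^ n := fun m =>
    (le_gn (f - g) hρ m).trans_lt h
  have heq : ‖cf g n‖ = ‖cf f n‖ := by
    have h1 := lt_of_mul_lt_mul_right (hlt n) (by positivity)
    have h2 : ‖cf g n - cf f n‖ < ‖cf f n‖ := by rwa [norm_sub_rev]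
    have := IsUltrametricDist.norm_add_eq_max_of_norm_ne_norm h2.ne
    rwa [sub_add_cancel, max_eq_right h2.le] at this
  have hbd : ∀ m, ‖cf g m‖ * ρ ^ m ≤ max (‖cf f m‖ * ρ ^ m) (‖cf f m - cf g m‖ * ρ ^ m) :=
      fun m => by
    rw [← max_mul_of_nonneg _ _ (by positivity)]
    gcongr
    have := IsUltrametricDist.norm_add_le_max (cf f m) (-(cf f m - cf g m))
    rwa [norm_neg, neg_sub, add_sub_cancel] at this
  refine ⟨?_, fun m => ?_, fun m hm => ?_⟩
  · rw [← norm_pos_iff, heq]; exact norm_pos_iff.mpr hf.ne_zero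
  · rw [heq]; exact (hbd m).trans (max_le (hf.le m) (hlt m).le)
  · rw [heq]; exact (hbd m).trans_lt (max_lt (hf.lt m hm) (hlt m))

/-- Each term is monotone in the radius, increasing for `n ≥ 0` and decreasing for `n ≤ 0`. So two
circles control the annulus between them. -/
theorem gn_le_max {r ρ s : ℝ} (hr : 0 < r) (h1 : r ≤ ρ) (h2 : ρ ≤ s) (f : LF K p i) :
    gn ρ f ≤ max (gn r f) (gn s f) := by
  refine gn_le fun n => ?_
  have hρ := hr.trans_le h1
  rcases le_total 0 n with hn | hn
  · refine le_max_of_le_right (le_trans ?_ (le_gn f (hρ.trans_le h2) n))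
    gcongr
    exact zpow_le_zpow_left₀ hn hρ.le h2
  · refine le_max_of_le_left (le_trans ?_ (le_gn f hr n))
    gcongr
    have := zpow_le_zpow_left₀ (n := -n) (by omega) hr.le h1
    rw [zpow_neg, zpow_neg] at this
    exact (inv_le_inv₀ (by positivity) (by positivity)).mp this

end Level

/-! ### Completeness, closed ideals on annuli, and dominant terms. -/

section Level

variable {p i : ℕ} [hp : Fact p.Prime]
variable {K : Type*} [NormedField K] [IsUltrametricDist K] [CompleteSpace K]

/-- Convergence with respect to all Gauss norms. -/
def Conv (f : ℕ → LF K p i) (F : LF K p i) : Prop :=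
  ∀ ρ : ℝ, 0 < ρ → Tendsto (fun k => gn ρ (f k - F)) atTop (𝓝 0)

/-- Consecutive differences tending to zero suffice because the norms are ultrametric. The limit is
taken coefficientwise; the estimates are uniform in the index, so the limit again converges on every
circle. -/
theorem exists_conv {f : ℕ → LF K p i}
    (h : ∀ ρ : ℝ, 0 < ρ → Tendsto (fun k => gn ρ (f (k + 1) - f k)) atTop (𝓝 0)) :
    ∃ F, Conv f F := by
  have key : ∀ ρ : ℝ, 0 < ρ → ∀ ε : ℝ, 0 < ε →
      ∃ N, ∀ k, N ≤ k → ∀ l, N ≤ l → gn ρ (f k - f l) ≤ ε := by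
    intro ρ hρ ε hε
    obtain ⟨N, hN⟩ := eventually_atTop.mp ((h ρ hρ).eventually_lt_const hε)
    have h1 : ∀ k, N ≤ k → gn ρ (f k - f N) ≤ ε := by
      intro k hk
      induction k, hk using Nat.le_induction with
      | base => simpa using hε.le
      | succ k hk ih =>
        exact (gn_sub_le_sub (f (k + 1)) (f k) (f N) hρ).trans (max_le (hN k hk).le ih)
    refine ⟨N, fun k hk l hl => (gn_sub_le_sub _ (f N) _ hρ).trans (max_le (h1 k hk) ?_)⟩
    rw [gn_sub_comm]
    exact h1 l hl
  have hc : ∀ n : ℤ, ∃ x, Tendsto (fun k => cf (f k) n) atTop (𝓝 x) := by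
    intro n
    apply cauchySeq_tendsto_of_complete
    rw [Metric.cauchySeq_iff']
    intro ε hε
    obtain ⟨N, hN⟩ := key 1 one_pos (ε / 2) (half_pos hε)
    refine ⟨N, fun k hk => ?_⟩
    have := (le_gn (f k - f N) one_pos n).trans (hN k hk N le_rfl)
    rw [one_zpow, mul_one, cf_sub] at this
    rw [dist_eq_norm]
    linarith
  choose a ha using hc
  have hlim : ∀ ρ : ℝ, 0 < ρ → ∀ ε : ℝ, 0 < ε →
      ∃ N, ∀ k, N ≤ k → ∀ n, ‖cf (f k) n - a n‖ * ρ ^ n ≤ ε := by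
    intro ρ hρ ε hε
    obtain ⟨N, hN⟩ := key ρ hρ ε hε
    refine ⟨N, fun k hk n => ?_⟩
    refine le_of_tendsto (((tendsto_const_nhds.sub (ha n)).norm).mul_const _) ?_
    filter_upwards [eventually_ge_atTop N] with l hl
    exact (le_gn (f k - f l) hρ n).trans (hN k hk l hl)
  refine ⟨mkLF a fun ρ hρ => ?_, fun ρ hρ => ?_⟩
  · rw [Metric.tendsto_nhds]
    intro ε hε
    obtain ⟨N, hN⟩ := hlim ρ hρ (ε / 2) (half_pos hε)
    filter_upwards [(tendsto_cf (f N) hρ).eventually_lt_const (half_pos hε)] with n hn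
    rw [Real.dist_eq, sub_zero, abs_of_nonneg (by positivity)]
    have h1 : ‖a n‖ ≤ max ‖cf (f N) n‖ ‖cf (f N) n - a n‖ := by
      have := IsUltrametricDist.norm_add_le_max (cf (f N) n) (-(cf (f N) n - a n))
      rwa [norm_neg, neg_sub, add_sub_cancel] at this
    calc _ ≤ max ‖cf (f N) n‖ ‖cf (f N) n - a n‖ * ρ ^ n := by gcongr
      _ = max (‖cf (f N) n‖ * ρ ^ n) (‖cf (f N) n - a n‖ * ρ ^ n) :=
        max_mul_of_nonneg _ _ (by positivity)
      _ ≤ ε / 2 := max_le hn.le (hN N le_rfl n)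
      _ < ε := half_lt_self hε
  · rw [Metric.tendsto_nhds]
    intro ε hε
    obtain ⟨N, hN⟩ := hlim ρ hρ (ε / 2) (half_pos hε)
    filter_upwards [eventually_ge_atTop N] with k hk
    rw [Real.dist_eq, sub_zero, abs_of_nonneg (gn_nonneg _ hρ)]
    refine lt_of_le_of_lt (gn_le fun n => ?_) (half_lt_self hε)
    rw [cf_sub, cf_mkLF]
    exact hN k hk n

theorem Conv.unique {f : ℕ → LF K p i} {F G : LF K p i} (hF : Conv f F) (hG : Conv f G) :
    F = G := by
  by_contra hne
  have h := (hF 1 one_pos).max (hG 1 one_pos)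
  rw [max_self] at h
  have hpos := gn_pos (sub_ne_zero.mpr hne) one_pos
  obtain ⟨k, hk⟩ := (h.eventually_lt_const hpos).exists
  have := gn_sub_le_sub F (f k) G one_pos
  rw [gn_sub_comm 1 F (f k)] at this
  exact lt_irrefl _ (this.trans_lt hk)

theorem Conv.gn_le {f : ℕ → LF K p i} {F G : LF K p i} (hF : Conv f F) {ρ C : ℝ} (hρ : 0 < ρ)
    (hC : 0 < C) (h : ∀ᶠ k in atTop, gn ρ (f k - G) ≤ C) : gn ρ (F - G) ≤ C := by
  obtain ⟨k, h1, h2⟩ := (((hF ρ hρ).eventually_lt_const hC).and h).exists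
  refine (gn_sub_le_sub F (f k) G hρ).trans (max_le ?_ h2)
  rw [gn_sub_comm]
  exact h1.le

theorem Conv.mul {f g : ℕ → LF K p i} {F G : LF K p i} (hF : Conv f F) (hG : Conv g G) :
    Conv (fun k => f k * g k) (F * G) := by
  intro ρ hρ
  have h1 : ∀ k, gn ρ (f k * g k - F * G) ≤
      max (max (gn ρ (f k - F) * gn ρ (g k - G)) (gn ρ (f k - F) * gn ρ G))
        (gn ρ F * gn ρ (g k - G)) := by
    intro k
    have : f k * g k - F * G = (f k - F) * (g k - G) + (f k - F) * G + F * (g k - G) := by ring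
    rw [this, ← gn_mul _ _ hρ, ← gn_mul _ _ hρ, ← gn_mul _ _ hρ]
    exact (gn_add_le _ _ hρ).trans (max_le_max (gn_add_le _ _ hρ) le_rfl)
  refine squeeze_zero (fun k => gn_nonneg _ hρ) h1 ?_
  have hf := hF ρ hρ
  have hg := hG ρ hρ
  simpa using ((hf.mul hg).max (hf.mul_const (gn ρ G))).max (hg.const_mul (gn ρ F))

theorem Conv.const (F : LF K p i) : Conv (fun _ => F) F := fun ρ _ => by simp

/-- The closure of the ideal generated by `b` for the Gauss norms on `|T| = r` and `|T| = s`. -/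
def cl {r s : ℝ} (hr : 0 < r) (hs : 0 < s) (b : LF K p i) : Ideal (LF K p i) where
  carrier := {a | ∀ ε : ℝ, 0 < ε → ∃ h, gn r (a - h * b) < ε ∧ gn s (a - h * b) < ε}
  zero_mem' := fun ε hε => ⟨0, by simpa using hε, by simpa using hε⟩
  add_mem' := by
    intro a a' ha ha' ε hε
    obtain ⟨h, h1, h2⟩ := ha ε hε
    obtain ⟨h', h1', h2'⟩ := ha' ε hε
    have e : a + a' - (h + h') * b = (a - h * b) + (a' - h' * b) := by ring
    exact ⟨h + h', by rw [e]; exact (gn_add_le _ _ hr).trans_lt (max_lt h1 h1'),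
      by rw [e]; exact (gn_add_le _ _ hs).trans_lt (max_lt h2 h2')⟩
  smul_mem' := by
    intro c a ha ε hε
    have hC : 0 < max (gn r c) (gn s c) + 1 := by
      have := (gn_nonneg c hr).trans (le_max_left _ (gn s c))
      linarith
    obtain ⟨h, h1, h2⟩ := ha (ε / (max (gn r c) (gn s c) + 1)) (by positivity)
    have e : c • a - c * h * b = c * (a - h * b) := by rw [smul_eq_mul]; ring
    refine ⟨c * h, ?_, ?_⟩
    · rw [e, gn_mul _ _ hr]
      rw [lt_div_iff₀ hC] at h1
      refine lt_of_le_of_lt ?_ h1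
      rw [mul_comm]
      gcongr
      · exact gn_nonneg _ hr
      · linarith [le_max_left (gn r c) (gn s c)]
    · rw [e, gn_mul _ _ hs]
      rw [lt_div_iff₀ hC] at h2
      refine lt_of_le_of_lt ?_ h2
      rw [mul_comm]
      gcongr
      · exact gn_nonneg _ hs
      · linarith [le_max_right (gn r c) (gn s c)]

theorem mem_cl {r s : ℝ} {hr : 0 < r} {hs : 0 < s} {a b : LF K p i} :
    a ∈ cl hr hs b ↔ ∀ ε : ℝ, 0 < ε → ∃ h, gn r (a - h * b) < ε ∧ gn s (a - h * b) < ε :=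
  Iff.rfl

theorem self_mem_cl {r s : ℝ} (hr : 0 < r) (hs : 0 < s) (b : LF K p i) : b ∈ cl hr hs b :=
  fun ε hε => ⟨1, by simpa using hε, by simpa using hε⟩

theorem mul_mem_cl_mul_iff {r s : ℝ} {hr : 0 < r} {hs : 0 < s} {a b c : LF K p i} (hc : c ≠ 0) :
    c * a ∈ cl hr hs (c * b) ↔ a ∈ cl hr hs b := by
  have h1 := gn_pos hc hr
  have h2 := gn_pos hc hs
  have e : ∀ h, c * a - h * (c * b) = c * (a - h * b) := fun h => by ring
  simp only [mem_cl, e, gn_mul _ _ hr, gn_mul _ _ hs]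
  constructor
  · intro H ε hε
    obtain ⟨h, ha, hb⟩ := H (ε * min (gn r c) (gn s c)) (by positivity)
    refine ⟨h, ?_, ?_⟩
    · refine lt_of_mul_lt_mul_left (ha.trans_le ?_) h1.le
      rw [mul_comm ε]
      exact mul_le_mul_of_nonneg_right (min_le_left _ _) hε.le
    · refine lt_of_mul_lt_mul_left (hb.trans_le ?_) h2.le
      rw [mul_comm ε]
      exact mul_le_mul_of_nonneg_right (min_le_right _ _) hε.le
  · intro H ε hε
    obtain ⟨h, ha, hb⟩ := H (ε / max (gn r c) (gn s c)) (by positivity)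
    rw [lt_div_iff₀ (by positivity)] at ha hb
    refine ⟨h, lt_of_le_of_lt ?_ ha, lt_of_le_of_lt ?_ hb⟩
    · rw [mul_comm]
      exact mul_le_mul_of_nonneg_left (le_max_left _ _) (gn_nonneg _ hr)
    · rw [mul_comm]
      exact mul_le_mul_of_nonneg_left (le_max_right _ _) (gn_nonneg _ hs)

theorem gn_lt_of_mem_Icc {r ρ s C : ℝ} (hr : 0 < r) (h1 : r ≤ ρ) (h2 : ρ ≤ s) {f : LF K p i}
    (hf : gn r f < C) (hf' : gn s f < C) : gn ρ f < C :=
  (gn_le_max hr h1 h2 f).trans_lt (max_lt hf hf')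

theorem cl_mono {r s r' s' : ℝ} (hr : 0 < r) (hs : 0 < s) (hr' : 0 < r') (hs' : 0 < s')
    (hr'r : r' ≤ r) (hrs : r ≤ s) (hss' : s ≤ s') (b : LF K p i) :
    cl hr' hs' b ≤ cl hr hs b := by
  intro a ha ε hε
  obtain ⟨h, h1, h2⟩ := ha ε hε
  exact ⟨h, gn_lt_of_mem_Icc hr' hr'r (hrs.trans hss') h1 h2,
    gn_lt_of_mem_Icc hr' (hr'r.trans hrs) hss' h1 h2⟩

/-- Approximate quotients `h k` on growing annuli form a Cauchy sequence: `b` times a consecutive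
difference is a difference of two errors, and multiplicativity of the Gauss norm allows division by
`gn ρ b`. Their limit is the exact quotient. -/
theorem dvd_of_forall_mem_cl {a b : LF K p i} (hb : b ≠ 0)
    (H : ∀ R : ℝ, 0 < R → ∃ (r s : ℝ) (hr : 0 < r) (hs : 0 < s), r ≤ R⁻¹ ∧ R ≤ s ∧
      a ∈ cl hr hs b) : b ∣ a := by
  have H1 : ∀ k : ℕ, ∃ h, ∀ ρ : ℝ, ((k : ℝ) + 1)⁻¹ ≤ ρ → ρ ≤ k + 1 →
      gn ρ (a - h * b) < 1 / ((k : ℝ) + 1) := by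
    intro k
    obtain ⟨r, s, hr, hs, h1, h2, h3⟩ := H (k + 1) (by positivity)
    obtain ⟨h, h4, h5⟩ := h3 (1 / ((k : ℝ) + 1)) (by positivity)
    exact ⟨h, fun ρ hρ hρ' => gn_lt_of_mem_Icc hr (h1.trans hρ) (hρ'.trans h2) h4 h5⟩
  choose h hh using H1
  have hev : ∀ ρ : ℝ, 0 < ρ → Tendsto (fun k => gn ρ (a - h k * b)) atTop (𝓝 0) := by
    intro ρ hρ
    refine squeeze_zero' (Eventually.of_forall fun k => gn_nonneg _ hρ) ?_
      tendsto_one_div_add_atTop_nhds_zero_nat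
    obtain ⟨N, hN⟩ := exists_nat_ge (max ρ ρ⁻¹)
    filter_upwards [eventually_ge_atTop N] with k hk
    have hk' : (N : ℝ) ≤ k := by exact_mod_cast hk
    have h1 := (le_max_left _ _).trans hN
    have h2 := (le_max_right _ _).trans hN
    refine (hh k ρ ?_ (by linarith)).le
    rw [inv_le_comm₀ (by positivity) hρ]
    linarith
  obtain ⟨F, hF⟩ := exists_conv (f := h) fun ρ hρ => by
    have hbρ := gn_pos hb hρ
    have h0 := hev ρ hρ
    have h1 := (h0.max (h0.comp (tendsto_add_atTop_nat 1))).div_const (gn ρ b)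
    rw [max_self, zero_div] at h1
    refine squeeze_zero (fun k => gn_nonneg _ hρ) (fun k => ?_) h1
    rw [le_div_iff₀ hbρ, ← gn_mul _ _ hρ]
    have : (h (k + 1) - h k) * b = (a - h k * b) - (a - h (k + 1) * b) := by ring
    rw [this]
    exact gn_sub_le _ _ hρ
  refine ⟨F, ?_⟩
  have h1 := hF.mul (Conv.const b)
  rw [mul_comm b F]
  refine Conv.unique (f := fun k => h k * b) (fun ρ hρ => ?_) h1
  refine (hev ρ hρ).congr fun k => gn_sub_comm _ _ _

/-- The term of index `n` is strictly dominant on the circle `|T| = ρ`. -/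
def Dom (ρ : ℝ) (f : LF K p i) (n : ℤ) : Prop :=
  cf f n ≠ 0 ∧ ∀ m, m ≠ n → ‖cf f m‖ * ρ ^ m < ‖cf f n‖ * ρ ^ n

theorem Dom.isTop {ρ : ℝ} {f : LF K p i} {n : ℤ} (h : Dom ρ f n) : IsTop ρ f n :=
  ⟨h.1, fun m => by
    by_cases hm : m = n
    · rw [hm]
    · exact (h.2 m hm).le, fun m hm => h.2 m hm.ne'⟩

/-- Two terms of different index, one of them nonzero, have equal size for at most one radius. So
ties occur for countably many radii only, and every interval contains a radius without ties. -/
theorem exists_dom {x y : ℝ} (hx : 0 < x) (hxy : x < y) {f : LF K p i} (hf : f ≠ 0) :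
    ∃ ρ n, x < ρ ∧ ρ < y ∧ Dom ρ f n := by
  have hS : ∀ mn : ℤ × ℤ, {ρ : ℝ | 0 < ρ ∧ mn.1 ≠ mn.2 ∧ cf f mn.1 ≠ 0 ∧
      ‖cf f mn.2‖ * ρ ^ mn.2 = ‖cf f mn.1‖ * ρ ^ mn.1}.Subsingleton := by
    rintro ⟨m, n⟩ ρ ⟨hρ, hne, h0, h1⟩ σ ⟨hσ, -, -, h2⟩
    dsimp only at *
    have e : ∀ τ : ℝ, 0 < τ → ‖cf f n‖ * τ ^ n = ‖cf f m‖ * τ ^ m →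
        τ ^ (m - n) = ‖cf f n‖ / ‖cf f m‖ := fun τ hτ h => by
      rw [zpow_sub₀ hτ.ne', eq_div_iff (norm_ne_zero_iff.mpr h0), div_mul_eq_mul_div,
        div_eq_iff (by positivity), h, mul_comm]
    have h3 := (e ρ hρ h1).trans (e σ hσ h2).symm
    exact (zpow_left_inj₀ hρ.le hσ.le (sub_ne_zero.mpr hne)).mp h3
  have hcount := Set.countable_iUnion fun mn => (hS mn).countable
  obtain ⟨ρ, hρ, hρ'⟩ : ∃ ρ ∈ Set.Ioo x y, ρ ∉ ⋃ mn : ℤ × ℤ, {ρ : ℝ | 0 < ρ ∧ mn.1 ≠ mn.2 ∧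
      cf f mn.1 ≠ 0 ∧ ‖cf f mn.2‖ * ρ ^ mn.2 = ‖cf f mn.1‖ * ρ ^ mn.1} := by
    by_contra! hcon
    exact (Cardinal.Real.Ioo_countable_iff.not.mpr (not_le.mpr hxy)) (hcount.mono hcon)
  have hρ0 := hx.trans hρ.1
  obtain ⟨n, hn⟩ := exists_isTop hρ0 hf
  refine ⟨ρ, n, hρ.1, hρ.2, hn.ne_zero, fun m hm => lt_of_le_of_ne (hn.le m) fun he => hρ' ?_⟩
  exact Set.mem_iUnion.mpr ⟨(n, m), hρ0, hm.symm, hn.ne_zero, he⟩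

/-- The remaining terms tend to zero, so strict domination is uniform. The ratio `κ` is the
contraction factor of the division algorithm. -/
theorem Dom.exists_ratio {ρ : ℝ} (hρ : 0 < ρ) {f : LF K p i} {n : ℤ} (h : Dom ρ f n) :
    ∃ κ : ℝ, 0 ≤ κ ∧ κ < 1 ∧ ∀ m, m ≠ n → ‖cf f m‖ * ρ ^ m ≤ κ * (‖cf f n‖ * ρ ^ n) := by
  have hpos : 0 < ‖cf f n‖ * ρ ^ n := mul_pos (norm_pos_iff.mpr h.1) (by positivity)
  obtain ⟨C, hC0, hC, hle⟩ := exists_lt_forall_le_of_tendsto_cofinite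
    (x := fun m => if m = n then 0 else ‖cf f m‖ * ρ ^ m) (C := ‖cf f n‖ * ρ ^ n)
    (squeeze_zero (fun m => by split_ifs <;> positivity)
      (fun m => by split_ifs <;> first | positivity | rfl) (tendsto_cf f hρ)) hpos
    (fun m => by
      split_ifs with hm
      · exact hpos
      · exact h.2 m hm)
  refine ⟨C / (‖cf f n‖ * ρ ^ n), by positivity, (div_lt_one hpos).mpr hC, fun m hm => ?_⟩
  rw [div_mul_cancel₀ _ hpos.ne']
  simpa [hm] using hle m

end Level

/-! ### Weierstrass division on an annulus. -/

section Level

variable {p i : ℕ} [hp : Fact p.Prime]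
variable {K : Type*} [NormedField K] [IsUltrametricDist K] [CompleteSpace K]

theorem norm_cf_mul_sub_le {ρ : ℝ} (hρ : 0 < ρ) {b : LF K p i} {N : ℤ} {κ : ℝ} (hκ : 0 ≤ κ)
    (hb : ∀ m, m ≠ N → ‖cf b m‖ * ρ ^ m ≤ κ * (‖cf b N‖ * ρ ^ N))
    {g : LF K p i} {C : ℝ} (hC : 0 ≤ C) (hg : ∀ n, ‖cf g n‖ * ρ ^ n ≤ C) (n : ℤ) :
    ‖cf (g * b) n - cf g (n - N) * cf b N‖ * ρ ^ n ≤ κ * C * (‖cf b N‖ * ρ ^ N) := by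
  rw [cf_mul, (summable_cf_mul g b n).tsum_eq_add_tsum_ite (n - N), sub_sub_cancel,
    add_sub_cancel_left, ← le_div_iff₀ (by positivity)]
  refine IsUltrametricDist.norm_tsum_le_of_forall_le_of_nonneg (by positivity) fun k => ?_
  rw [le_div_iff₀ (by positivity)]
  split_ifs with hk
  · rw [norm_zero, zero_mul]
    positivity
  · have h1 := mul_le_mul (hg k) (hb (n - k) (by omega)) (by positivity) hC
    rw [mul_mul_mul_comm, ← zpow_add₀ hρ.ne', add_sub_cancel] at h1
    rw [norm_mul]
    linarith

/-- Only the dominant terms of `b` are used to form `g`: its part of exponent `≥ 0` removes the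
terms of `f` of index `≥ N` through `cf b N`, its part of exponent `< 0` removes those of index `<
M` through `cf b M`. All other products carry a factor `κ`. As `r ≤ s`, the bound `C` for either
part of `g` on its own circle also holds on the other circle. -/
theorem exists_sub_mul_contraction {r s : ℝ} (hr : 0 < r) (hrs : r ≤ s) {b : LF K p i} {M N : ℤ}
    {κ : ℝ} (hκ : 0 ≤ κ) (hM0 : cf b M ≠ 0) (hN0 : cf b N ≠ 0)
    (hM : ∀ m, m ≠ M → ‖cf b m‖ * r ^ m ≤ κ * (‖cf b M‖ * r ^ M))
    (hN : ∀ m, m ≠ N → ‖cf b m‖ * s ^ m ≤ κ * (‖cf b N‖ * s ^ N))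
    (f : LF K p i) {C : ℝ} (hC : 0 ≤ C)
    (hf : ∀ n, N ≤ n → ‖cf f n‖ * s ^ n ≤ C * (‖cf b N‖ * s ^ N))
    (hf' : ∀ n, n < M → ‖cf f n‖ * r ^ n ≤ C * (‖cf b M‖ * r ^ M)) :
    ∃ g : LF K p i, (∀ n, ‖cf g n‖ * s ^ n ≤ C) ∧
      (∀ n, N ≤ n → ‖cf (f - g * b) n‖ * s ^ n ≤ κ * C * (‖cf b N‖ * s ^ N)) ∧
      (∀ n, n < M → ‖cf (f - g * b) n‖ * r ^ n ≤ κ * C * (‖cf b M‖ * r ^ M)) := by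
  have hs := hr.trans_le hrs
  let g : LF K p i := mkLF
    (fun n => if 0 ≤ n then (cf b N)⁻¹ * cf f (n + N) else (cf b M)⁻¹ * cf f (n + M))
    fun ρ hρ => by
      have h1 := (tendsto_cf ((cf b N)⁻¹ • (mono p i K (-N) * f)) hρ).add
        (tendsto_cf ((cf b M)⁻¹ • (mono p i K (-M) * f)) hρ)
      rw [add_zero] at h1
      refine squeeze_zero (fun n => by positivity) (fun n => ?_) h1
      simp only [cf_smul, cf_mono_mul, sub_neg_eq_add]
      split_ifs
      · exact le_add_of_nonneg_right (by positivity)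
      · exact le_add_of_nonneg_left (by positivity)
  have hg0 : ∀ n, 0 ≤ n → cf g n = (cf b N)⁻¹ * cf f (n + N) := fun n hn => by simp [g, hn]
  have hg1 : ∀ n, n < 0 → cf g n = (cf b M)⁻¹ * cf f (n + M) := fun n hn => by
    simp [g, not_le.mpr hn]
  have hpos : ∀ n, 0 ≤ n → ‖cf g n‖ * s ^ n ≤ C := fun n hn => by
    have h1 := hf (n + N) (by omega)
    rw [zpow_add₀ hs.ne', ← mul_assoc, ← mul_assoc] at h1
    have h2 := le_of_mul_le_mul_right h1 (by positivity)
    rw [hg0 n hn, norm_mul, norm_inv, mul_assoc, inv_mul_le_iff₀ (norm_pos_iff.mpr hN0)]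
    linarith
  have hneg : ∀ n, n < 0 → ‖cf g n‖ * r ^ n ≤ C := fun n hn => by
    have h1 := hf' (n + M) (by omega)
    rw [zpow_add₀ hr.ne', ← mul_assoc, ← mul_assoc] at h1
    have h2 := le_of_mul_le_mul_right h1 (by positivity)
    rw [hg1 n hn, norm_mul, norm_inv, mul_assoc, inv_mul_le_iff₀ (norm_pos_iff.mpr hM0)]
    linarith
  have hgr : ∀ n, ‖cf g n‖ * r ^ n ≤ C := fun n => by
    rcases le_or_gt 0 n with hn | hn
    · refine le_trans ?_ (hpos n hn)
      gcongr
      exact zpow_le_zpow_left₀ hn hr.le hrs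
    · exact hneg n hn
  have hgs : ∀ n, ‖cf g n‖ * s ^ n ≤ C := fun n => by
    rcases le_or_gt 0 n with hn | hn
    · exact hpos n hn
    · refine le_trans ?_ (hneg n hn)
      gcongr
      have := zpow_le_zpow_left₀ (n := -n) (by omega) hr.le hrs
      rw [zpow_neg, zpow_neg] at this
      exact (inv_le_inv₀ (by positivity) (by positivity)).mp this
  refine ⟨g, hgs, fun n hn => ?_, fun n hn => ?_⟩
  · have h1 := norm_cf_mul_sub_le hs hκ hN hC hgs n
    have h2 : cf g (n - N) * cf b N = cf f n := by
      rw [hg0 _ (by omega), sub_add_cancel]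
      field_simp
    rwa [h2, norm_sub_rev] at h1
  · have h1 := norm_cf_mul_sub_le hr hκ hM hC hgr n
    have h2 : cf g (n - M) * cf b M = cf f n := by
      rw [hg1 _ (by omega), sub_add_cancel]
      field_simp
    rwa [h2, norm_sub_rev] at h1

theorem cf_sum (S : Finset ℤ) (f : ℤ → LF K p i) (n : ℤ) :
    cf (∑ k ∈ S, f k) n = ∑ k ∈ S, cf (f k) n :=
  map_sum (⟨⟨fun f => cf f n, rfl⟩, fun _ _ => rfl⟩ : LF K p i →+ K) _ _

/-- Division with remainder on the annulus `r ≤ |T| ≤ s`, up to the closure of the ideal `(b)`. -/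
theorem exists_sub_sum_mem_cl {r s : ℝ} (hr : 0 < r) (hs : 0 < s) (hrs : r ≤ s) {b : LF K p i}
    {M N : ℤ} (hM : Dom r b M) (hN : Dom s b N) (f : LF K p i) :
    ∃ v : ℤ → K, f - ∑ n ∈ Finset.Ico M N, v n • mono p i K n ∈ cl hr hs b := by
  obtain ⟨κ₁, hκ₁0, hκ₁, hM'⟩ := hM.exists_ratio hr
  obtain ⟨κ₂, -, hκ₂, hN'⟩ := hN.exists_ratio hs
  have hBr : 0 < ‖cf b M‖ * r ^ M := mul_pos (norm_pos_iff.mpr hM.1) (by positivity)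
  have hBs : 0 < ‖cf b N‖ * s ^ N := mul_pos (norm_pos_iff.mpr hN.1) (by positivity)
  set κ := max κ₁ κ₂
  have hκ0 : 0 ≤ κ := hκ₁0.trans (le_max_left _ _)
  have hκ : κ < 1 := max_lt hκ₁ hκ₂
  -- The partial quotient is made total, with value `0` where the bounds fail, so that the iteration
  -- `F` can be defined before its invariant `hF` is proved.
  have step : ∀ (f : LF K p i) (C : ℝ), ∃ g : LF K p i, 0 ≤ C →
      (∀ n, N ≤ n → ‖cf f n‖ * s ^ n ≤ C * (‖cf b N‖ * s ^ N)) →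
      (∀ n, n < M → ‖cf f n‖ * r ^ n ≤ C * (‖cf b M‖ * r ^ M)) →
      (∀ n, ‖cf g n‖ * s ^ n ≤ C) ∧
      (∀ n, N ≤ n → ‖cf (f - g * b) n‖ * s ^ n ≤ κ * C * (‖cf b N‖ * s ^ N)) ∧
      (∀ n, n < M → ‖cf (f - g * b) n‖ * r ^ n ≤ κ * C * (‖cf b M‖ * r ^ M)) := by
    intro f C
    by_cases h : 0 ≤ C ∧ (∀ n, N ≤ n → ‖cf f n‖ * s ^ n ≤ C * (‖cf b N‖ * s ^ N)) ∧
      (∀ n, n < M → ‖cf f n‖ * r ^ n ≤ C * (‖cf b M‖ * r ^ M))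
    · obtain ⟨g, hg⟩ := exists_sub_mul_contraction hr hrs hκ0 hM.1 hN.1
        (fun m hm => (hM' m hm).trans (by gcongr; exact le_max_left _ _))
        (fun m hm => (hN' m hm).trans (by gcongr; exact le_max_right _ _)) f h.1 h.2.1 h.2.2
      exact ⟨g, fun _ _ _ => hg⟩
    · exact ⟨0, fun h1 h2 h3 => absurd ⟨h1, h2, h3⟩ h⟩
  choose g hg using step
  -- Chosen so that the invariant `hF` holds at `k = 0`.
  set C := gn s f / (‖cf b N‖ * s ^ N) + gn r f / (‖cf b M‖ * r ^ M)
  have hC1 := gn_nonneg f hr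
  have hC2 := gn_nonneg f hs
  have hC : 0 ≤ C := by positivity
  let F : ℕ → LF K p i := fun k => Nat.rec f (fun k G => G - g G (κ ^ k * C) * b) k
  have hFs : ∀ k, F (k + 1) = F k - g (F k) (κ ^ k * C) * b := fun k => rfl
  have hF : ∀ k, (∀ n, N ≤ n → ‖cf (F k) n‖ * s ^ n ≤ κ ^ k * C * (‖cf b N‖ * s ^ N)) ∧
      (∀ n, n < M → ‖cf (F k) n‖ * r ^ n ≤ κ ^ k * C * (‖cf b M‖ * r ^ M)) := by
    intro k
    induction k with
    | zero =>
      rw [pow_zero, one_mul]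
      refine ⟨fun n _ => (le_gn f hs n).trans ?_, fun n _ => (le_gn f hr n).trans ?_⟩
      · rw [← div_le_iff₀ hBs]
        exact le_add_of_nonneg_right (by positivity)
      · rw [← div_le_iff₀ hBr]
        exact le_add_of_nonneg_left (by positivity)
    | succ k ih =>
      have h := (hg (F k) (κ ^ k * C) (by positivity) ih.1 ih.2).2
      rw [hFs, pow_succ', mul_assoc κ]
      exact h
  have hdvd : ∀ k, ∃ h, f - F k = h * b := by
    intro k
    induction k with
    | zero => exact ⟨0, by simp [F]⟩
    | succ k ih =>
      obtain ⟨h, hh⟩ := ih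
      refine ⟨h + g (F k) (κ ^ k * C), ?_⟩
      rw [hFs, add_mul, ← hh]
      ring
  -- The step from `F k` to `F (k + 1)` has size at most `κ ^ k * C * gn s b` on `|T| = s`, so each
  -- coefficient converges; the limits at the indices in `[M, N)` form the remainder.
  have hlim : ∀ n, ∃ x, Tendsto (fun k => cf (F k) n) atTop (𝓝 x) := by
    intro n
    apply cauchySeq_tendsto_of_complete
    refine cauchySeq_of_le_geometric κ (C * gn s b / s ^ n) hκ fun k => ?_
    have h1 := (hg (F k) (κ ^ k * C) (by positivity) (hF k).1 (hF k).2).1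
    have h2 := le_gn (g (F k) (κ ^ k * C) * b) hs n
    rw [gn_mul _ _ hs, ← le_div_iff₀ (by positivity)] at h2
    rw [dist_eq_norm, hFs, cf_sub, sub_sub_cancel]
    refine h2.trans ?_
    rw [div_mul_eq_mul_div]
    refine div_le_div_of_nonneg_right ?_ (by positivity)
    have := mul_le_mul_of_nonneg_right (gn_le h1) (gn_nonneg b hs)
    linarith
  choose v hv using hlim
  refine ⟨v, fun ε hε => ?_⟩
  set w := ∑ n ∈ Finset.Ico M N, v n • mono p i K n
  have hw : ∀ n, cf w n = if n ∈ Finset.Ico M N then v n else 0 := fun n => by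
    simp only [w, cf_sum, cf_smul, cf_mono, mul_ite, mul_one, mul_zero, Finset.sum_ite_eq]
  -- `A` and `B` serve to carry the estimates of `hF` from the circle on which they are stated to
  -- the other one.
  set A := max (‖cf b N‖ * s ^ N) (‖cf b N‖ * r ^ N)
  set B := max (‖cf b M‖ * r ^ M) (‖cf b M‖ * s ^ M)
  have hout : ∀ k n, N ≤ n → ‖cf (F k) n‖ * s ^ n ≤ κ ^ k * C * A ∧
      ‖cf (F k) n‖ * r ^ n ≤ κ ^ k * C * A := by
    intro k n hn
    have h1 := (hF k).1 n hn
    refine ⟨h1.trans (by gcongr; exact le_max_left _ _), ?_⟩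
    refine le_trans ?_ (mul_le_mul_of_nonneg_left (le_max_right _ _) (by positivity))
    have h2 : ‖cf (F k) n‖ * s ^ (n - N) ≤ κ ^ k * C * ‖cf b N‖ := by
      rw [zpow_sub₀ hs.ne', ← mul_div_assoc, div_le_iff₀ (by positivity)]
      linarith
    have h3 : r ^ n = r ^ (n - N) * r ^ N := by rw [← zpow_add₀ hr.ne', sub_add_cancel]
    rw [h3, ← mul_assoc, ← mul_assoc]
    refine mul_le_mul_of_nonneg_right (le_trans ?_ h2) (by positivity)
    gcongr
    exact zpow_le_zpow_left₀ (by omega) hr.le hrs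
  have hout' : ∀ k n, n < M → ‖cf (F k) n‖ * s ^ n ≤ κ ^ k * C * B ∧
      ‖cf (F k) n‖ * r ^ n ≤ κ ^ k * C * B := by
    intro k n hn
    have h1 := (hF k).2 n hn
    refine ⟨?_, h1.trans (by gcongr; exact le_max_left _ _)⟩
    refine le_trans ?_ (mul_le_mul_of_nonneg_left (le_max_right _ _) (by positivity))
    have h2 : ‖cf (F k) n‖ * r ^ (n - M) ≤ κ ^ k * C * ‖cf b M‖ := by
      rw [zpow_sub₀ hr.ne', ← mul_div_assoc, div_le_iff₀ (by positivity)]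
      linarith
    have h3 : s ^ n = s ^ (n - M) * s ^ M := by rw [← zpow_add₀ hs.ne', sub_add_cancel]
    rw [h3, ← mul_assoc, ← mul_assoc]
    refine mul_le_mul_of_nonneg_right (le_trans ?_ h2) (by positivity)
    gcongr
    have := zpow_le_zpow_left₀ (n := -(n - M)) (by omega) hr.le hrs
    rw [zpow_neg, zpow_neg] at this
    exact (inv_le_inv₀ (by positivity) (by positivity)).mp this
  have hgeom : ∀ D : ℝ, ∀ᶠ k : ℕ in atTop, κ ^ k * C * D < ε / 2 := fun D => by
    have := ((tendsto_pow_atTop_nhds_zero_of_lt_one hκ0 hκ).mul_const C).mul_const D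
    rw [zero_mul, zero_mul] at this
    exact this.eventually_lt_const (half_pos hε)
  have hin : ∀ ρ : ℝ, ∀ᶠ k : ℕ in atTop, ∀ n ∈ Finset.Ico M N,
      ‖cf (F k) n - v n‖ * ρ ^ n < ε / 2 := fun ρ => by
    rw [Filter.eventually_all_finset]
    intro n _
    have := (((hv n).sub_const (v n)).norm).mul_const (ρ ^ n)
    rw [sub_self, norm_zero, zero_mul] at this
    exact this.eventually_lt_const (half_pos hε)
  obtain ⟨k, h1, h2, h3, h4⟩ :=
    ((hgeom A).and ((hgeom B).and ((hin r).and (hin s)))).exists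
  obtain ⟨h, hh⟩ := hdvd k
  have e : f - w - h * b = F k - w := by rw [← hh]; ring
  refine ⟨h, ?_, ?_⟩ <;> rw [e] <;> refine lt_of_le_of_lt (gn_le fun n => ?_) (half_lt_self hε) <;>
    rw [cf_sub, hw]
  · split_ifs with hn
    · exact (h3 n hn).le
    · rw [sub_zero]
      rcases lt_or_ge n M with hnM | hnM
      · exact (hout' k n hnM).2.trans h2.le
      · exact (hout k n (by simp at hn; omega)).2.trans h1.le
  · split_ifs with hn
    · exact (h4 n hn).le
    · rw [sub_zero]
      rcases lt_or_ge n M with hnM | hnM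
      · exact (hout' k n hnM).1.trans h2.le
      · exact (hout k n (by simp at hn; omega)).1.trans h1.le

end Level

/-! ### Irreducible polynomials as primes of the ring of series, and the divisibility criterion. -/

section Level

open Polynomial

variable {p i : ℕ} [hp : Fact p.Prime]
variable {K : Type*} [NormedField K] [IsUltrametricDist K] [CompleteSpace K]

variable (p i K) in
/-- Polynomials in `T = X^(1/pⁱ)` as Laurent series. -/
def ofPoly : K[X] →ₐ[K] LF K p i := aeval (LaurentFn.X (unitExp p i))

theorem mono_one : mono p i K 1 = LaurentFn.X (unitExp p i) := by simp [mono, expEquiv]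

theorem ofPoly_X : ofPoly p i K X = mono p i K 1 := by simp [ofPoly, mono_one]

theorem ofPoly_monomial (k : ℕ) (c : K) : ofPoly p i K (monomial k c) = c • mono p i K k := by
  rw [ofPoly, aeval_monomial, ← mono_one, mono_pow, one_mul, Algebra.smul_def]

theorem cf_ofPoly_natCast (P : K[X]) (k : ℕ) : cf (ofPoly p i K P) k = P.coeff k := by
  induction P using Polynomial.induction_on' with
  | add P Q hP hQ => rw [map_add, cf_add, hP, hQ, coeff_add]
  | monomial n c =>
    rw [ofPoly_monomial, cf_smul, cf_mono, coeff_monomial]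
    simp [eq_comm]

theorem cf_ofPoly_of_neg (P : K[X]) {n : ℤ} (hn : n < 0) : cf (ofPoly p i K P) n = 0 := by
  induction P using Polynomial.induction_on' with
  | add P Q hP hQ => rw [map_add, cf_add, hP, hQ, add_zero]
  | monomial k c =>
    rw [ofPoly_monomial, cf_smul, cf_mono, if_neg (by omega), mul_zero]

theorem ofPoly_injective : Function.Injective (ofPoly p i K) := fun P Q h => by
  ext k
  rw [← cf_ofPoly_natCast (p := p) (i := i), h, cf_ofPoly_natCast]

theorem eventually_lt_mul_pow (c : ℝ) {a : ℝ} (ha : 0 < a) {k : ℕ} (hk : k ≠ 0) :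
    ∀ᶠ s : ℝ in atTop, c < a * s ^ k :=
  ((tendsto_pow_atTop hk).const_mul_atTop ha).eventually_gt_atTop c

/-- Together with `eventually_dom_zero` this says that a large annulus `S⁻¹ ≤ |T| ≤ S` sees all
zeros of `P` when `P(0) ≠ 0`: the top index grows from `0` to the degree. -/
theorem eventually_dom_natDegree {P : K[X]} (hP : P ≠ 0) :
    ∀ᶠ s : ℝ in atTop, Dom s (ofPoly p i K P) P.natDegree := by
  have hlead : 0 < ‖P.coeff P.natDegree‖ := by simpa using hP
  have h : ∀ᶠ s : ℝ in atTop, ∀ k ∈ Finset.range P.natDegree,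
      ‖P.coeff k‖ < ‖P.coeff P.natDegree‖ * s ^ (P.natDegree - k) := by
    rw [Filter.eventually_all_finset]
    intro k hk
    exact eventually_lt_mul_pow _ hlead (Nat.sub_ne_zero_of_lt (Finset.mem_range.mp hk))
  filter_upwards [h, eventually_gt_atTop 0] with s hs hs0
  refine ⟨by rw [cf_ofPoly_natCast, ← norm_pos_iff]; exact hlead, fun m hm => ?_⟩
  rw [cf_ofPoly_natCast]
  have hpos : 0 < ‖P.coeff P.natDegree‖ * s ^ (P.natDegree : ℤ) := by positivity
  rcases lt_or_ge m 0 with hm0 | hm0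
  · rw [cf_ofPoly_of_neg _ hm0]
    simpa using hpos
  · lift m to ℕ using hm0
    rw [cf_ofPoly_natCast]
    rcases lt_or_ge m P.natDegree with hlt | hge
    · have h1 := mul_lt_mul_of_pos_right (hs m (Finset.mem_range.mpr hlt)) (pow_pos hs0 m)
      rw [mul_assoc, ← pow_add, Nat.sub_add_cancel hlt.le] at h1
      exact_mod_cast h1
    · rw [coeff_eq_zero_of_natDegree_lt (by omega)]
      simpa using hpos

theorem eventually_dom_zero {P : K[X]} (hP : P.coeff 0 ≠ 0) :
    ∀ᶠ s : ℝ in atTop, Dom s⁻¹ (ofPoly p i K P) 0 := by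
  have hlead : 0 < ‖P.coeff 0‖ := norm_pos_iff.mpr hP
  have h : ∀ᶠ s : ℝ in atTop, ∀ k ∈ Finset.Icc 1 P.natDegree,
      ‖P.coeff k‖ < ‖P.coeff 0‖ * s ^ k := by
    rw [Filter.eventually_all_finset]
    intro k hk
    exact eventually_lt_mul_pow _ hlead (by simp at hk; omega)
  have h0 : cf (ofPoly p i K P) 0 = P.coeff 0 := by exact_mod_cast cf_ofPoly_natCast P 0
  filter_upwards [h, eventually_gt_atTop 0] with s hs hs0
  refine ⟨by rwa [h0], fun m hm => ?_⟩
  rw [h0, zpow_zero, mul_one]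
  rcases lt_or_ge m 0 with hm0 | hm0
  · rw [cf_ofPoly_of_neg _ hm0]
    simpa using hP
  · lift m to ℕ using hm0
    rw [cf_ofPoly_natCast]
    by_cases hle : m ≤ P.natDegree
    · have h1 := hs m (Finset.mem_Icc.mpr ⟨by omega, hle⟩)
      rw [zpow_natCast, inv_pow, ← div_eq_mul_inv, div_lt_iff₀ (by positivity)]
      exact h1
    · rw [coeff_eq_zero_of_natDegree_lt (by omega)]
      simpa using hP

theorem isTop_one (ρ : ℝ) : IsTop ρ (1 : LF K p i) 0 := by
  refine ⟨by simp [cf_one], fun m => ?_, fun m hm => ?_⟩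
  · by_cases h : m = 0 <;> simp [cf_one, h]
  · simp [cf_one, hm.ne']

theorem IsTop.pow {ρ : ℝ} (hρ : 0 < ρ) {f : LF K p i} {m : ℤ} (hf : IsTop ρ f m) (k : ℕ) :
    IsTop ρ (f ^ k) (k * m) := by
  induction k with
  | zero => simpa using isTop_one ρ
  | succ k ih =>
    have := (ih.mul hρ hf).1
    rw [pow_succ]
    convert this using 1
    push_cast
    ring

/-- If `h * f` were closer than `1` to the constant `1` on both circles, its top index would be `0`
on both. But the top index of `f` grows from `m` to `n`, and that of `h` cannot drop. -/
theorem one_le_gn_one_sub_mul {r s : ℝ} (hr : 0 < r) (hs : 0 < s) (hrs : r ≤ s) {f : LF K p i}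
    {m n : ℤ} (hm : Dom r f m) (hn : Dom s f n) (hmn : m < n) (h : LF K p i)
    (hh : gn r (1 - h * f) < 1) : 1 ≤ gn s (1 - h * f) := by
  by_contra! hh2
  have t1 := (isTop_one r).of_gn_sub_lt hr (by rwa [gn_one hr] : gn r (1 - h * f) < _)
  have t2 := (isTop_one s).of_gn_sub_lt hs (by rwa [gn_one hs] : gn s (1 - h * f) < _)
  have hne : h ≠ 0 := fun h0 => t1.ne_zero (by simp [h0])
  obtain ⟨k, hk⟩ := exists_isTop hr hne
  obtain ⟨l, hl⟩ := exists_isTop hs hne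
  have e1 := t1.unique (hk.mul hr hm.isTop).1
  have e2 := t2.unique (hl.mul hs hn.isTop).1
  have := hk.index_le hr hrs hl
  omega

theorem one_notMem_cl {r s : ℝ} (hr : 0 < r) (hs : 0 < s) (hrs : r ≤ s) {f : LF K p i} {m n : ℤ}
    (hm : Dom r f m) (hn : Dom s f n) (hmn : m < n) : (1 : LF K p i) ∉ cl hr hs f := by
  intro h1
  obtain ⟨h, hh1, hh2⟩ := h1 1 one_pos
  exact absurd hh2 (not_lt.mpr (one_le_gn_one_sub_mul hr hs hrs hm hn hmn h hh1))

theorem eventually_one_notMem_cl {P : K[X]} (hP : Irreducible P) (hP0 : P.coeff 0 ≠ 0) :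
    ∀ᶠ R : ℝ in atTop, ∀ (hr : 0 < R⁻¹) (hs : 0 < R), 1 ∉ cl hr hs (ofPoly p i K P) := by
  filter_upwards [eventually_dom_natDegree (p := p) (i := i) hP.ne_zero,
    eventually_dom_zero (p := p) (i := i) hP0, eventually_ge_atTop 1] with R h1 h2 h3 hr hs
  exact one_notMem_cl hr hs ((inv_le_one_of_one_le₀ h3).trans h3) h2 h1
    (by exact_mod_cast hP.natDegree_pos)

/-- Division with remainder by an irreducible polynomial. -/
theorem exists_ofPoly_dvd_sub {P : K[X]} (hP : Irreducible P) (hP0 : P.coeff 0 ≠ 0)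
    (f : LF K p i) : ∃ V : K[X], ofPoly p i K P ∣ f - ofPoly p i K V := by
  obtain ⟨R₀, hR₀⟩ := eventually_atTop.mp ((eventually_dom_natDegree (p := p) (i := i)
    hP.ne_zero).and ((eventually_dom_zero (p := p) (i := i) hP0).and
    ((eventually_one_notMem_cl (p := p) (i := i) hP hP0).and (eventually_ge_atTop 1))))
  have hpos : ∀ R, R₀ ≤ R → 0 < R := fun R hR => one_pos.trans_le (hR₀ R hR).2.2.2
  have hV : ∀ R (hR : R₀ ≤ R), ∃ V : K[X],
      f - ofPoly p i K V ∈ cl (inv_pos.mpr (hpos R hR)) (hpos R hR) (ofPoly p i K P) := by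
    intro R hR
    obtain ⟨h1, h2, -, h3⟩ := hR₀ R hR
    obtain ⟨v, hv⟩ := exists_sub_sum_mem_cl (inv_pos.mpr (hpos R hR)) (hpos R hR)
      ((inv_le_one_of_one_le₀ h3).trans h3) h2 h1 f
    refine ⟨∑ n ∈ Finset.Ico (0 : ℤ) P.natDegree, monomial n.toNat (v n), ?_⟩
    rw [map_sum]
    convert hv using 2
    refine Finset.sum_congr rfl fun n hn => ?_
    rw [ofPoly_monomial, Int.toNat_of_nonneg (Finset.mem_Ico.mp hn).1]
  choose V hV using hV
  refine ⟨V R₀ le_rfl, dvd_of_forall_mem_cl ?_ fun R hR => ?_⟩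
  · exact (map_ne_zero_iff _ ofPoly_injective).mpr hP.ne_zero
  have hR' : R₀ ≤ max R R₀ := le_max_right _ _
  refine ⟨_, _, inv_pos.mpr (hpos _ hR'), hpos _ hR', ?_, le_max_left _ _, ?_⟩
  · exact (inv_le_inv₀ (hpos _ hR') hR).mpr (le_max_left _ _)
  -- Both remainders represent `f` modulo the closed ideal on the smaller annulus, so their
  -- difference lies in it. If `P` did not divide this difference, a Bézout relation would put `1`
  -- into that ideal. Hence the remainder found for `R₀` serves all larger annuli.
  have hd : P ∣ V _ hR' - V R₀ le_rfl := by
    by_contra hnd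
    obtain ⟨u, w, huw⟩ := (hP.coprime_iff_not_dvd).mpr hnd
    have h1 := (hR₀ R₀ le_rfl).2.2.2
    refine (hR₀ R₀ le_rfl).2.2.1 (inv_pos.mpr (hpos R₀ le_rfl)) (hpos R₀ le_rfl) ?_
    rw [← map_one (ofPoly p i K), ← huw, map_add, map_mul, map_mul, map_sub]
    refine Ideal.add_mem _ (Ideal.mul_mem_left _ _ (self_mem_cl _ _ _)) (Ideal.mul_mem_left _ _ ?_)
    have h2 := cl_mono (inv_pos.mpr (hpos R₀ le_rfl)) (hpos R₀ le_rfl)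
      (inv_pos.mpr (hpos _ hR')) (hpos _ hR')
      ((inv_le_inv₀ (hpos _ hR') (hpos R₀ le_rfl)).mpr hR')
      ((inv_le_one_of_one_le₀ h1).trans h1) hR' _ (hV _ hR')
    have h3 := Ideal.sub_mem _ (hV R₀ le_rfl) h2
    rwa [sub_sub_sub_cancel_left] at h3
  have h4 := Ideal.mem_of_dvd _ (map_dvd (ofPoly p i K) hd) (self_mem_cl
    (inv_pos.mpr (hpos _ hR')) (hpos _ hR') (ofPoly p i K P))
  have h5 := Ideal.add_mem _ (hV _ hR') h4
  rwa [map_sub, sub_add_sub_cancel] at h5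

theorem not_isUnit_ofPoly {P : K[X]} (hP : Irreducible P) (hP0 : P.coeff 0 ≠ 0) :
    ¬ IsUnit (ofPoly p i K P) := by
  intro hu
  obtain ⟨R, h1, h2⟩ := ((eventually_one_notMem_cl (p := p) (i := i) hP hP0).and
    (eventually_gt_atTop 0)).exists
  exact h1 (inv_pos.mpr h2) h2 (Ideal.mem_of_dvd _ hu.dvd (self_mem_cl _ _ _))

theorem ofPoly_dvd_ofPoly {P V : K[X]} (hP : Irreducible P) (hP0 : P.coeff 0 ≠ 0) :
    ofPoly p i K P ∣ ofPoly p i K V ↔ P ∣ V := by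
  refine ⟨fun h => ?_, map_dvd _⟩
  by_contra hnd
  obtain ⟨u, w, huw⟩ := (hP.coprime_iff_not_dvd).mpr hnd
  refine not_isUnit_ofPoly (p := p) (i := i) hP hP0 (isUnit_of_dvd_one ?_)
  rw [← map_one (ofPoly p i K), ← huw, map_add, map_mul, map_mul]
  exact dvd_add (dvd_mul_left _ _) (dvd_mul_of_dvd_right h _)

/-- Modulo `P` every series is a polynomial, so the Bézout relation comes from `K[X]`. -/
theorem isCoprime_ofPoly {P : K[X]} (hP : Irreducible P) (hP0 : P.coeff 0 ≠ 0) {f : LF K p i}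
    (hf : ¬ ofPoly p i K P ∣ f) : IsCoprime (ofPoly p i K P) f := by
  obtain ⟨V, hV⟩ := exists_ofPoly_dvd_sub hP hP0 f
  have hnd : ¬ P ∣ V := fun h => hf (by
    simpa using dvd_add hV (map_dvd (ofPoly p i K) h))
  obtain ⟨h, hh⟩ := hV
  have := ((hP.coprime_iff_not_dvd).mpr hnd).map (ofPoly p i K).toRingHom
  rw [sub_eq_iff_eq_add.mp hh, add_comm]
  exact this.add_mul_left_right h

theorem prime_ofPoly {P : K[X]} (hP : Irreducible P) (hP0 : P.coeff 0 ≠ 0) :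
    Prime (ofPoly p i K P) := by
  refine ⟨(map_ne_zero_iff _ ofPoly_injective).mpr hP.ne_zero, not_isUnit_ofPoly hP hP0,
    fun a b hab => ?_⟩
  by_cases h : ofPoly p i K P ∣ a
  · exact Or.inl h
  · exact Or.inr ((isCoprime_ofPoly hP hP0 h).dvd_of_dvd_mul_left hab)

/-- The top index of `f` grows by a finite amount from the radius `R⁻¹` to `R`, and each factor `P`
uses up the degree of `P` of this growth. -/
theorem finiteMultiplicity_ofPoly {P : K[X]} (hP : Irreducible P) (hP0 : P.coeff 0 ≠ 0)
    {f : LF K p i} (hf : f ≠ 0) : FiniteMultiplicity (ofPoly p i K P) f := by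
  obtain ⟨R, h1, h2, h3⟩ := ((eventually_dom_natDegree (p := p) (i := i) hP.ne_zero).and
    ((eventually_dom_zero (p := p) (i := i) hP0).and (eventually_ge_atTop 1))).exists
  have hR := one_pos.trans_le h3
  have hr := inv_pos.mpr hR
  obtain ⟨k, hk⟩ := exists_isTop hr hf
  obtain ⟨l, hl⟩ := exists_isTop hR hf
  refine ⟨(l - k).toNat, fun ⟨h, hh⟩ => ?_⟩
  have hne : h ≠ 0 := fun h0 => hf (by simp [hh, h0])
  obtain ⟨m, hm⟩ := exists_isTop hr hne
  obtain ⟨n, hn⟩ := exists_isTop hR hne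
  rw [hh] at hk hl
  have e1 := hk.unique ((h2.isTop.pow hr _).mul hr hm).1
  have e2 := hl.unique ((h1.isTop.pow hR _).mul hR hn).1
  have h4 := hm.index_le hr ((inv_le_one_of_one_le₀ h3).trans h3) hn
  have h5 : (1 : ℤ) ≤ P.natDegree := by exact_mod_cast hP.natDegree_pos
  push_cast at e1 e2
  nlinarith [Int.self_le_toNat (l - k)]

/-- On an annulus, a nonzero function divides a polynomial up to approximation. -/
theorem exists_monic_ofPoly_mem_cl {r s : ℝ} (hr : 0 < r) (hs : 0 < s) (hrs : r ≤ s)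
    {b : LF K p i} {M N : ℤ} (hM : Dom r b M) (hN : Dom s b N) :
    ∃ P : K[X], P.Monic ∧ ofPoly p i K P ∈ cl hr hs b := by
  classical
  set W := cl hr hs b
  -- Division with remainder shows that finitely many monomials span the quotient; the class of `T`
  -- is therefore integral over `K`.
  have hfin : Module.Finite K (LF K p i ⧸ W) := by
    refine ⟨⟨(Finset.Ico M N).image fun n => Ideal.Quotient.mkₐ K W (mono p i K n), ?_⟩⟩
    rw [eq_top_iff]
    rintro x -
    obtain ⟨f, rfl⟩ := Ideal.Quotient.mkₐ_surjective K W x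
    obtain ⟨v, hv⟩ := exists_sub_sum_mem_cl hr hs hrs hM hN f
    have : Ideal.Quotient.mkₐ K W f =
        ∑ n ∈ Finset.Ico M N, v n • Ideal.Quotient.mkₐ K W (mono p i K n) := by
      simp only [← map_smul, ← map_sum]
      exact Ideal.Quotient.eq.mpr hv
    rw [this]
    refine Submodule.sum_mem _ fun n hn => Submodule.smul_mem _ _ (Submodule.subset_span ?_)
    simp only [Finset.coe_image, Set.mem_image, Finset.mem_coe]
    exact ⟨n, hn, rfl⟩
  obtain ⟨P, hP, hP'⟩ := IsIntegral.of_finite K (Ideal.Quotient.mkₐ K W (mono p i K 1))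
  refine ⟨P, hP, ?_⟩
  rw [← aeval_def, aeval_algHom_apply, mono_one] at hP'
  exact Ideal.Quotient.eq_zero_iff_mem.mp hP'

/-- Divisibility of everywhere convergent Laurent series can be tested on the multiplicities at
all irreducible polynomials. -/
theorem dvd_of_multiplicity_le {a b : LF K p i} (hb : b ≠ 0)
    (H : ∀ P : K[X], Irreducible P → P.coeff 0 ≠ 0 →
      multiplicity (ofPoly p i K P) b ≤ multiplicity (ofPoly p i K P) a) : b ∣ a := by
  refine dvd_of_forall_mem_cl hb fun R hR => ?_
  have hR1 : 0 < max R 1 := hR.trans_le (le_max_left _ _)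
  obtain ⟨r, M, hr, hr', hM⟩ := exists_dom (half_pos (inv_pos.mpr hR1))
    (half_lt_self (inv_pos.mpr hR1)) hb
  obtain ⟨s, N, hs, hs', hN⟩ := exists_dom hR1 (lt_add_one _) hb
  have hr0 : 0 < r := (half_pos (inv_pos.mpr hR1)).trans hr
  have hs0 : 0 < s := hR1.trans hs
  have hinv : (max R 1)⁻¹ ≤ 1 := inv_le_one_of_one_le₀ (le_max_right _ _)
  have hinv' : (max R 1)⁻¹ ≤ R⁻¹ := (inv_le_inv₀ hR1 hR).mpr (le_max_left _ _)
  have hrs : r ≤ s := by linarith [le_max_right R 1]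
  refine ⟨r, s, hr0, hs0, by linarith, (le_max_left _ _).trans hs.le, ?_⟩
  obtain ⟨c, hc, hcmem⟩ := exists_monic_ofPoly_mem_cl hr0 hs0 hrs hM hN
  -- The product `c * a` lies in the closed ideal because `c` does. The irreducible factors of `c`
  -- are now removed one at a time, by induction on the degree.
  have key : ∀ n : ℕ, ∀ c : K[X], c.natDegree ≤ n → c ≠ 0 →
      ofPoly p i K c * a ∈ cl hr0 hs0 b → a ∈ cl hr0 hs0 b := by
    intro n
    induction n with
    | zero =>
      intro c hn hc hmem
      obtain ⟨k, rfl⟩ := natDegree_eq_zero.mp (Nat.le_zero.mp hn)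
      have hk : IsUnit (ofPoly p i K (C k)) :=
        (isUnit_C.mpr (isUnit_iff_ne_zero.mpr (by simpa using hc))).map _
      exact (Ideal.unit_mul_mem_iff_mem _ hk).mp hmem
    | succ n ih =>
      intro c hn hc hmem
      by_cases hu : IsUnit c
      · exact (Ideal.unit_mul_mem_iff_mem _ (hu.map (ofPoly p i K))).mp hmem
      obtain ⟨P, hP, c', rfl⟩ := WfDvdMonoid.exists_irreducible_factor hu hc
      have hc' : c' ≠ 0 := right_ne_zero_of_mul hc
      have hdeg : c'.natDegree ≤ n := by
        rw [natDegree_mul hP.ne_zero hc'] at hn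
        have := hP.natDegree_pos
        omega
      refine ih c' hdeg hc' ?_
      rw [map_mul, mul_assoc] at hmem
      -- Here `P` is associated to `X`, and `T` is a unit.
      by_cases hP0 : P.coeff 0 = 0
      · have hXP : Associated X P := irreducible_X.associated_of_dvd hP (X_dvd_iff.mpr hP0)
        have hunit : IsUnit (ofPoly p i K P) := by
          refine (hXP.map (ofPoly p i K)).isUnit ?_
          rw [ofPoly_X]
          exact isUnit_mono 1
        exact (Ideal.unit_mul_mem_iff_mem _ hunit).mp hmem
      -- The hypothesis on multiplicities allows the full power of `P` in `b` to be cancelled from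
      -- `a` and `b` at once. What is left of `b` is coprime to `P`, so `P` is invertible modulo it
      -- and may be dropped.
      · have hfb := finiteMultiplicity_ofPoly (p := p) (i := i) hP hP0 hb
        obtain ⟨b', hb', hnd⟩ := hfb.exists_eq_pow_mul_and_not_dvd
        obtain ⟨a', ha'⟩ := (pow_dvd_pow _ (H P hP hP0)).trans (pow_multiplicity_dvd
          (ofPoly p i K P) a)
        set e := multiplicity (ofPoly p i K P) b
        have hpe : ofPoly p i K P ^ e ≠ 0 := pow_ne_zero _ (prime_ofPoly hP hP0).ne_zero
        have e1 : ofPoly p i K P * (ofPoly p i K c' * a) =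
            ofPoly p i K P ^ e * (ofPoly p i K P * (ofPoly p i K c' * a')) := by
          rw [ha']; ring
        have e2 : ofPoly p i K c' * a = ofPoly p i K P ^ e * (ofPoly p i K c' * a') := by
          rw [ha']; ring
        rw [e1, hb', mul_mem_cl_mul_iff hpe] at hmem
        rw [e2, hb', mul_mem_cl_mul_iff hpe]
        obtain ⟨w, u, hwu⟩ := isCoprime_ofPoly hP hP0 hnd
        have e3 : ofPoly p i K c' * a' = w * (ofPoly p i K P * (ofPoly p i K c' * a')) +
            u * (ofPoly p i K c' * a') * b' := by
          linear_combination -(ofPoly p i K c' * a') * hwu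
        rw [e3]
        exact Ideal.add_mem _ (Ideal.mul_mem_left _ _ hmem)
          (Ideal.mul_mem_left _ _ (self_mem_cl _ _ _))
  exact key _ c le_rfl hc.ne_zero (Ideal.mul_mem_right _ _ hcmem)

end Level

/-! ### Theta functions as infinite products. -/

section Level

open Polynomial

variable {p i : ℕ} [hp : Fact p.Prime]
variable {K : Type*} [NormedField K] [IsUltrametricDist K] [CompleteSpace K]

theorem gn_scale (ρ : ℝ) (u : Kˣ) (f : LF K p i) : gn ρ (scale u f) = gn (‖(u : K)‖ * ρ) f := by
  simp only [gn, cf_scale, norm_mul, norm_zpow, mul_zpow]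
  congr 1
  funext n
  ring

theorem norm_unit_pos (u : Kˣ) : 0 < ‖(u : K)‖ := norm_pos_iff.mpr u.ne_zero

theorem Conv.scale {f : ℕ → LF K p i} {F : LF K p i} (hF : Conv f F) (u : Kˣ) :
    Conv (fun k => scale u (f k)) (PerfectoidTate.scale u F) := by
  intro ρ hρ
  refine (hF (‖(u : K)‖ * ρ) (mul_pos (norm_unit_pos u) hρ)).congr fun k => ?_
  rw [← map_sub, gn_scale]

theorem scale_scale (u v : Kˣ) (f : LF K p i) : scale u (scale v f) = scale (u * v) f :=
  cf_ext fun n => by simp only [cf_scale, Units.val_mul, mul_zpow, mul_assoc]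

theorem scale_smul (u : Kˣ) (c : K) (f : LF K p i) : scale u (c • f) = c • scale u f :=
  cf_ext fun n => by simp only [cf_scale, cf_smul]; ring

theorem scale_mono (u : Kˣ) (m : ℤ) :
    scale u (mono p i K m) = ((u : K) ^ m) • mono p i K m :=
  cf_ext fun n => by
    rw [cf_scale, cf_smul, cf_mono]
    split_ifs with h <;> simp [h]

/-- Only exponents `≥ 1` occur, so scaling gains at least one factor `‖u‖`. This bound and
`gn_scale_le_of_neg` give geometric convergence of the two halves of the theta product. -/
theorem gn_scale_le_of_pos {f : LF K p i} (hf : ∀ n ≤ 0, cf f n = 0) {ρ : ℝ} (hρ : 0 < ρ) {u : Kˣ}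
    (hu : ‖(u : K)‖ ≤ 1) : gn ρ (scale u f) ≤ ‖(u : K)‖ * gn ρ f := by
  refine gn_le fun n => ?_
  rw [cf_scale]
  rcases le_or_gt n 0 with hn | hn
  · rw [hf n hn, mul_zero, norm_zero, zero_mul]
    exact mul_nonneg (norm_nonneg _) (gn_nonneg _ hρ)
  · rw [norm_mul, norm_zpow, mul_assoc]
    refine mul_le_mul ?_ (le_gn f hρ n) (by positivity) (norm_nonneg _)
    have := zpow_le_zpow_right_of_le_one₀ (norm_unit_pos u) hu (show 1 ≤ n by omega)
    rwa [zpow_one] at this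

theorem gn_scale_le_of_neg {f : LF K p i} (hf : ∀ n, 0 ≤ n → cf f n = 0) {ρ : ℝ} (hρ : 0 < ρ)
    {u : Kˣ} (hu : ‖(u : K)‖ ≤ 1) : gn ρ (scale u⁻¹ f) ≤ ‖(u : K)‖ * gn ρ f := by
  refine gn_le fun n => ?_
  rw [cf_scale]
  rcases le_or_gt 0 n with hn | hn
  · rw [hf n hn, mul_zero, norm_zero, zero_mul]
    exact mul_nonneg (norm_nonneg _) (gn_nonneg _ hρ)
  · rw [norm_mul, norm_zpow, mul_assoc]
    refine mul_le_mul ?_ (le_gn f hρ n) (by positivity) (norm_nonneg _)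
    have := zpow_le_zpow_right_of_le_one₀ (norm_unit_pos u) hu (show 1 ≤ -n by omega)
    rwa [zpow_one, zpow_neg, ← inv_zpow, ← norm_inv, ← Units.val_inv_eq_inv_val] at this

/-- The polynomial `P(u T)`. -/
def twist (u : Kˣ) (P : K[X]) : K[X] := P.comp (C (u : K) * X)

theorem coeff_twist (u : Kˣ) (P : K[X]) (n : ℕ) : (twist u P).coeff n = P.coeff n * (u : K) ^ n :=
  comp_C_mul_X_coeff

theorem coeff_zero_twist (u : Kˣ) (P : K[X]) : (twist u P).coeff 0 = P.coeff 0 := by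
  simp [coeff_twist]

theorem twist_twist (u v : Kˣ) (P : K[X]) : twist u (twist v P) = twist (u * v) P := by
  ext n
  simp only [coeff_twist, Units.val_mul, mul_pow]
  ring

theorem twist_one (P : K[X]) : twist 1 P = P := by
  ext n
  simp [coeff_twist]

theorem twist_mul (u : Kˣ) (P R : K[X]) : twist u (P * R) = twist u P * twist u R :=
  mul_comp _ _ _

theorem isUnit_twist {u : Kˣ} {P : K[X]} (h : IsUnit P) : IsUnit (twist u P) :=
  h.map (compRingHom (C (u : K) * X))

theorem irreducible_twist {u : Kˣ} {P : K[X]} (h : Irreducible P) : Irreducible (twist u P) := by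
  have inv : ∀ R : K[X], twist u⁻¹ (twist u R) = R := fun R => by simp [twist_twist, twist_one]
  have inv' : ∀ R : K[X], twist u (twist u⁻¹ R) = R := fun R => by simp [twist_twist, twist_one]
  refine ⟨fun hu => h.not_isUnit ?_, fun {a b} hab => ?_⟩
  · rw [← inv P]
    exact isUnit_twist hu
  · have h1 : P = twist u⁻¹ a * twist u⁻¹ b := by rw [← twist_mul, ← hab, inv]
    rcases h.isUnit_or_isUnit h1 with h2 | h2
    · left
      rw [← inv' a]
      exact isUnit_twist h2
    · right
      rw [← inv' b]
      exact isUnit_twist h2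

theorem scale_ofPoly (u : Kˣ) (P : K[X]) :
    scale u (ofPoly p i K P) = ofPoly p i K (twist u P) :=
  cf_ext fun n => by
    rw [cf_scale]
    rcases lt_or_ge n 0 with hn | hn
    · simp [cf_ofPoly_of_neg _ hn]
    · lift n to ℕ using hn
      rw [cf_ofPoly_natCast, cf_ofPoly_natCast, coeff_twist, zpow_natCast, mul_comm]

/-- Twisting keeps the constant term, so the unit relating the two polynomials is `1`; comparing
leading coefficients then gives `|Q|^k = |Q|^l`. -/
theorem eq_of_associated_twist {Q : Kˣ} (hQ : ‖(Q : K)‖ < 1) {P : K[X]} (hP : Irreducible P)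
    (hP0 : P.coeff 0 ≠ 0) {k l : ℤ} (h : Associated (twist (Q ^ k) P) (twist (Q ^ l) P)) :
    k = l := by
  obtain ⟨w, hw⟩ := h
  obtain ⟨c, hc, hcw⟩ := Polynomial.isUnit_iff.mp w.isUnit
  rw [← hcw] at hw
  have h0 := congrArg (fun R => R.coeff 0) hw
  simp only [coeff_mul_C, coeff_zero_twist] at h0
  have hc1 : c = 1 := mul_left_cancel₀ hP0 (h0.trans (mul_one _).symm)
  rw [hc1, C_1, mul_one] at hw
  have h1 := congrArg (fun R => R.coeff P.natDegree) hw
  simp only [coeff_twist, coeff_natDegree] at h1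
  have h2 := mul_left_cancel₀ (leadingCoeff_ne_zero.mpr hP.ne_zero) h1
  have h3 := congrArg norm h2
  simp only [Units.val_zpow_eq_zpow_val, norm_pow, norm_zpow] at h3
  have h4 := (pow_left_inj₀ (by positivity) (by positivity) hP.natDegree_pos.ne').mp h3
  exact zpow_right_injective₀ (norm_unit_pos Q) hQ.ne h4

theorem gn_prod_sub_one_le {ρ ε : ℝ} (hρ : 0 < ρ) (hε : 0 ≤ ε) (hε1 : ε ≤ 1) {E : ℕ → LF K p i}
    (h : ∀ k, gn ρ (E k - 1) ≤ ε) (n : ℕ) : gn ρ (∏ k ∈ Finset.range n, E k - 1) ≤ ε := by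
  induction n with
  | zero => simpa using hε
  | succ n ih =>
    rw [Finset.prod_range_succ]
    set G := ∏ k ∈ Finset.range n, E k
    have e : G * E n - 1 = (G - 1) * (E n - 1) + (G - 1) + (E n - 1) := by ring
    rw [e]
    refine (gn_add_le _ _ hρ).trans (max_le ((gn_add_le _ _ hρ).trans (max_le ?_ ih)) (h n))
    rw [gn_mul _ _ hρ]
    calc _ ≤ ε * 1 := mul_le_mul ih ((h n).trans hε1) (gn_nonneg _ hρ) hε
      _ = ε := mul_one _

theorem exists_conv_prod {E : ℕ → LF K p i}
    (hE : ∀ ρ : ℝ, 0 < ρ → Tendsto (fun k => gn ρ (E k - 1)) atTop (𝓝 0)) :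
    ∃ F, Conv (fun n => ∏ k ∈ Finset.range n, E k) F := by
  refine exists_conv fun ρ hρ => ?_
  obtain ⟨N, hN⟩ := eventually_atTop.mp ((hE ρ hρ).eventually_lt_const one_pos)
  set G := fun n => ∏ k ∈ Finset.range n, E k
  have hb : ∀ n, N ≤ n → gn ρ (G n) ≤ gn ρ (G N) := by
    intro n hn
    induction n, hn using Nat.le_induction with
    | base => exact le_rfl
    | succ n hn ih =>
      have h1 : gn ρ (E n) ≤ 1 := by
        have := gn_add_le (E n - 1) 1 hρ
        rw [sub_add_cancel, gn_one hρ] at this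
        exact this.trans (max_le (hN n hn).le le_rfl)
      have : G (n + 1) = G n * E n := Finset.prod_range_succ _ _
      rw [this, gn_mul _ _ hρ]
      calc _ ≤ gn ρ (G N) * 1 := mul_le_mul ih h1 (gn_nonneg _ hρ) (gn_nonneg _ hρ)
        _ = _ := mul_one _
  have h2 := (hE ρ hρ).const_mul (gn ρ (G N))
  rw [mul_zero] at h2
  refine squeeze_zero' (Eventually.of_forall fun k => gn_nonneg _ hρ) ?_ h2
  filter_upwards [eventually_ge_atTop N] with n hn
  have : G (n + 1) - G n = G n * (E n - 1) := by
    have : G (n + 1) = G n * E n := Finset.prod_range_succ _ _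
    rw [this]; ring
  rw [this, gn_mul _ _ hρ]
  exact mul_le_mul_of_nonneg_right (hb n hn) (gn_nonneg _ hρ)

open Classical in
theorem multiplicity_ofPoly_ofPoly {P V : K[X]} (hP : Irreducible P) (hP0 : P.coeff 0 ≠ 0)
    (hV : Irreducible V) : multiplicity (ofPoly p i K P) (ofPoly p i K V) =
      if Associated P V then 1 else 0 := by
  split_ifs with h
  · have h1 := h.map (ofPoly p i K)
    rw [← multiplicity_eq_of_associated_right h1]
    exact multiplicity_self
  · rw [multiplicity_eq_zero, ofPoly_dvd_ofPoly hP hP0]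
    exact fun hd => h (hP.associated_of_dvd hV hd)

theorem multiplicity_ofPoly_mul {P : K[X]} (hP : Irreducible P) (hP0 : P.coeff 0 ≠ 0)
    {f g : LF K p i} (hf : f ≠ 0) (hg : g ≠ 0) : multiplicity (ofPoly p i K P) (f * g) =
      multiplicity (ofPoly p i K P) f + multiplicity (ofPoly p i K P) g :=
  multiplicity_mul (prime_ofPoly hP hP0) (finiteMultiplicity_ofPoly hP hP0 (mul_ne_zero hf hg))

theorem multiplicity_ofPoly_prod {P : K[X]} (hP : Irreducible P) (hP0 : P.coeff 0 ≠ 0)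
    {E : ℕ → LF K p i} (hE : ∀ k, E k ≠ 0) (n : ℕ) :
    multiplicity (ofPoly p i K P) (∏ k ∈ Finset.range n, E k) =
      ∑ k ∈ Finset.range n, multiplicity (ofPoly p i K P) (E k) := by
  induction n with
  | zero =>
    simp only [Finset.range_zero, Finset.prod_empty, Finset.sum_empty]
    rw [multiplicity_eq_zero]
    exact fun h => not_isUnit_ofPoly hP hP0 (isUnit_of_dvd_one h)
  | succ n ih =>
    rw [Finset.prod_range_succ, Finset.sum_range_succ, multiplicity_ofPoly_mul hP hP0 _ (hE n), ih]
    exact Finset.prod_ne_zero_iff.mpr fun k _ => hE k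

/-- The indices `k` and `-(k + 1)` with `0 ≤ k < N` run exactly once through `-N, …, N - 1`; the
factors of the theta product are indexed in this way. -/
theorem sum_range_ite_eq (k₀ : ℤ) {N : ℕ} (h1 : -N ≤ k₀) (h2 : k₀ < N) :
    ∑ k ∈ Finset.range N, ((if (k : ℤ) = k₀ then 1 else 0) +
      (if -((k : ℤ) + 1) = k₀ then 1 else 0)) = 1 := by
  rcases lt_or_ge k₀ 0 with h | h
  · rw [Finset.sum_eq_single (-k₀ - 1).toNat]
    · rw [if_neg (by omega), if_pos (by omega)]
    · intro k _ hk
      rw [if_neg (by omega), if_neg (by omega), add_zero]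
    · intro hk
      simp at hk
      omega
  · rw [Finset.sum_eq_single k₀.toNat]
    · rw [if_pos (by omega), if_neg (by omega)]
    · intro k _ hk
      rw [if_neg (by omega), if_neg (by omega), add_zero]
    · intro hk
      simp at hk
      omega

open Classical in
/-- The theta function with simple zeros at the translates of the zeros of `P`. -/
theorem exists_theta {Q : Kˣ} (hQ : ‖(Q : K)‖ < 1) {P : K[X]} (hP : Irreducible P)
    (hP0 : P.coeff 0 ≠ 0) : ∃ θ : LF K p i, θ ≠ 0 ∧
      (∃ c : K, c ≠ 0 ∧ scale Q⁻¹ θ = c • (mono p i K P.natDegree * θ)) ∧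
      ∀ R : K[X], Irreducible R → R.coeff 0 ≠ 0 → multiplicity (ofPoly p i K R) θ =
        if ∃ k : ℤ, Associated R (twist (Q ^ k) P) then 1 else 0 := by
  set a₀ := P.coeff 0
  set m := P.natDegree
  set aₘ := P.coeff m
  have haₘ : aₘ ≠ 0 := by simpa [aₘ, m] using hP.ne_zero
  -- `A₁` is `1` plus positive powers of `T`, and `B₁` is `1` plus negative powers. The theta
  -- function is the product over `n ≥ 0` of `A₁(Q^n T) B₁(Q^(-(n+1)) T)`, in which each translate
  -- of `P` occurs once.
  set A₁ : LF K p i := a₀⁻¹ • ofPoly p i K P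
  set B₁ : LF K p i := aₘ⁻¹ • (mono p i K (-m) * ofPoly p i K P)
  have hA : ∀ n ≤ 0, cf (A₁ - 1) n = 0 := by
    intro n hn
    rcases hn.lt_or_eq with hn | rfl
    · simp [A₁, cf_ofPoly_of_neg _ hn, cf_one, hn.ne]
    · have := cf_ofPoly_natCast (p := p) (i := i) P 0
      rw [Nat.cast_zero] at this
      simp [A₁, this, cf_one, a₀, hP0]
  have hB : ∀ n, 0 ≤ n → cf (B₁ - 1) n = 0 := by
    intro n hn
    lift n to ℕ using hn
    have := cf_ofPoly_natCast (p := p) (i := i) P (n + m)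
    push_cast at this
    rw [cf_sub, cf_smul, cf_mono_mul, sub_neg_eq_add, this, cf_one]
    by_cases hn : n = 0
    · subst hn
      rw [zero_add]
      simp [haₘ, aₘ]
    · rw [coeff_eq_zero_of_natDegree_lt (by omega)]
      simp [hn]
  have hAB : A₁ = (a₀⁻¹ * aₘ) • (mono p i K m * B₁) := by
    rw [mul_smul_comm, ← mul_assoc, ← mono_add, add_neg_cancel, mono_zero, one_mul, smul_smul,
      mul_assoc, mul_inv_cancel₀ haₘ, mul_one]
  set α : ℤ → LF K p i := fun k => scale (Q ^ k) A₁
  set β : ℤ → LF K p i := fun k => scale (Q ^ (-k)) B₁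
  have hpow : ∀ n : ℕ, ‖((Q ^ (n : ℤ) : Kˣ) : K)‖ = ‖(Q : K)‖ ^ n := fun n => by simp
  have hα : ∀ ρ : ℝ, 0 < ρ → Tendsto (fun n : ℕ => gn ρ (α n - 1)) atTop (𝓝 0) := by
    intro ρ hρ
    have h1 := (tendsto_pow_atTop_nhds_zero_of_lt_one (norm_nonneg _) hQ).mul_const
      (gn ρ (A₁ - 1))
    rw [zero_mul] at h1
    refine squeeze_zero (fun n => gn_nonneg _ hρ) (fun n => ?_) h1
    have h2 := gn_scale_le_of_pos hA hρ (u := Q ^ (n : ℤ))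
      (by rw [hpow]; exact pow_le_one₀ (norm_nonneg _) hQ.le)
    rwa [map_sub, map_one, hpow] at h2
  have hβ : ∀ ρ : ℝ, 0 < ρ → Tendsto (fun n : ℕ => gn ρ (β n - 1)) atTop (𝓝 0) := by
    intro ρ hρ
    have h1 := (tendsto_pow_atTop_nhds_zero_of_lt_one (norm_nonneg _) hQ).mul_const
      (gn ρ (B₁ - 1))
    rw [zero_mul] at h1
    refine squeeze_zero (fun n => gn_nonneg _ hρ) (fun n => ?_) h1
    have h2 := gn_scale_le_of_neg hB hρ (u := Q ^ (n : ℤ))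
      (by rw [hpow]; exact pow_le_one₀ (norm_nonneg _) hQ.le)
    rwa [map_sub, map_one, hpow, ← zpow_neg] at h2
  have hαc : Conv (fun n : ℕ => α n) 1 := hα
  have hβs : Conv (fun n : ℕ => β (n + 1)) 1 := fun ρ hρ => by
    have := (hβ ρ hρ).comp (tendsto_add_atTop_nat 1)
    refine this.congr fun n => ?_
    simp
  set E : ℕ → LF K p i := fun n => α n * β (n + 1)
  have hE : ∀ ρ : ℝ, 0 < ρ → Tendsto (fun n => gn ρ (E n - 1)) atTop (𝓝 0) := by
    have := hαc.mul hβs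
    rwa [mul_one] at this
  have hαa : ∀ k, Associated (α k) (ofPoly p i K (twist (Q ^ k) P)) := fun k => by
    have : α k = algebraMap K _ a₀⁻¹ * ofPoly p i K (twist (Q ^ k) P) := by
      simp only [α, A₁]
      rw [scale_smul, scale_ofPoly, Algebra.smul_def]
    rw [this]
    exact associated_unit_mul_left _ _ ((isUnit_iff_ne_zero.mpr (inv_ne_zero hP0)).map _)
  have hβa : ∀ k, Associated (β k) (ofPoly p i K (twist (Q ^ (-k)) P)) := fun k => by
    have : β k = (algebraMap K _ (aₘ⁻¹ * ((Q ^ (-k) : Kˣ) : K) ^ (-m : ℤ)) * mono p i K (-m)) *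
        ofPoly p i K (twist (Q ^ (-k)) P) := by
      simp only [β, B₁]
      rw [scale_smul, map_mul, scale_ofPoly, scale_mono, smul_mul_assoc, smul_smul,
        Algebra.smul_def, mul_assoc]
    rw [this]
    exact associated_unit_mul_left _ _ (((isUnit_iff_ne_zero.mpr (mul_ne_zero (inv_ne_zero haₘ)
      (zpow_ne_zero _ (Units.ne_zero _)))).map _).mul (isUnit_mono _))
  have hne : ∀ u : Kˣ, ofPoly p i K (twist u P) ≠ 0 := fun u =>
    (map_ne_zero_iff _ ofPoly_injective).mpr (irreducible_twist hP).ne_zero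
  have hα0 : ∀ k, α k ≠ 0 := fun k => (hαa k).ne_zero_iff.mpr (hne _)
  have hβ0 : ∀ k, β k ≠ 0 := fun k => (hβa k).ne_zero_iff.mpr (hne _)
  have hE0 : ∀ k, E k ≠ 0 := fun k => mul_ne_zero (hα0 _) (hβ0 _)
  obtain ⟨θ, hθ⟩ := exists_conv_prod hE
  -- The cofactor of a partial product is close to `1` on every circle on which all the later
  -- factors are.
  have tail : ∀ N : ℕ, ∃ G, θ = (∏ k ∈ Finset.range N, E k) * G ∧
      ∀ ρ : ℝ, 0 < ρ → (∀ k, N ≤ k → gn ρ (E k - 1) ≤ 1 / 2) → gn ρ (1 - G) < 1 := by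
    intro N
    obtain ⟨G, hG⟩ := exists_conv_prod (E := fun k => E (N + k)) fun ρ hρ => by
      refine ((hE ρ hρ).comp (tendsto_add_atTop_nat N)).congr fun n => ?_
      simp [add_comm]
    refine ⟨G, ?_, fun ρ hρ hk => ?_⟩
    · refine Conv.unique (f := fun n => ∏ k ∈ Finset.range (N + n), E k) (fun ρ hρ => ?_) ?_
      · refine ((hθ ρ hρ).comp (tendsto_add_atTop_nat N)).congr fun n => ?_
        simp [add_comm]
      · simp only [Finset.prod_range_add]
        exact (Conv.const _).mul hG
    · rw [gn_sub_comm]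
      refine (hG.gn_le hρ (by norm_num : (0 : ℝ) < 1 / 2) (Eventually.of_forall fun n => ?_)).trans_lt
        (by norm_num)
      exact gn_prod_sub_one_le hρ (by norm_num) (by norm_num) (fun k => hk _ (by omega)) n
  have hθ0 : θ ≠ 0 := by
    obtain ⟨N, hN⟩ := eventually_atTop.mp ((hE 1 one_pos).eventually_le_const
      (by norm_num : (0 : ℝ) < 1 / 2))
    obtain ⟨G, hG, hG1⟩ := tail N
    rw [hG]
    refine mul_ne_zero (Finset.prod_ne_zero_iff.mpr fun k _ => hE0 k) fun h0 => ?_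
    have := hG1 1 one_pos hN
    rw [h0, sub_zero, gn_one one_pos] at this
    exact lt_irrefl _ this
  refine ⟨θ, hθ0, ⟨a₀⁻¹ * aₘ * ((Q⁻¹ : Kˣ) : K) ^ (m : ℤ), ?_, ?_⟩, fun R hR hR0 => ?_⟩
  · exact mul_ne_zero (mul_ne_zero (inv_ne_zero hP0) haₘ) (zpow_ne_zero _ (Units.ne_zero _))
  · have hsα : ∀ k, scale Q⁻¹ (α k) = α (k - 1) := fun k => by
      simp only [α, scale_scale]
      rw [zpow_sub_one, mul_comm]
    have hsβ : ∀ k, scale Q⁻¹ (β k) = β (k + 1) := fun k => by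
      simp only [β, scale_scale]
      rw [neg_add, ← sub_eq_add_neg, zpow_sub_one, mul_comm]
    -- The substitution shifts the index of `α` down and that of `β` up, so the partial products
    -- telescope; the relation is cross-multiplied to avoid quotients.
    have hfin : ∀ n : ℕ, scale Q⁻¹ (∏ k ∈ Finset.range n, E k) * (α (n - 1) * β 1) =
        (∏ k ∈ Finset.range n, E k) * (α (-1) * β (n + 1)) := by
      intro n
      induction n with
      | zero => simp
      | succ n ih =>
        rw [Finset.prod_range_succ, map_mul]
        have e1 : scale Q⁻¹ (E n) = α (n - 1) * β (n + 1 + 1) := by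
          simp only [E, map_mul, hsα, hsβ]
        rw [e1]
        push_cast
        rw [add_sub_cancel_right]
        have e2 : E n = α n * β (n + 1) := rfl
        rw [e2]
        linear_combination α n * β (n + 1 + 1) * ih
    have hα' : Conv (fun n : ℕ => α (n - 1)) 1 := fun ρ hρ => by
      rw [← tendsto_add_atTop_iff_nat 1]
      refine (hα ρ hρ).congr fun n => ?_
      simp
    have h1 := (hθ.scale Q⁻¹).mul (hα'.mul (Conv.const (β 1)))
    have h2 := hθ.mul ((Conv.const (α (-1))).mul hβs)
    simp only [hfin] at h1
    have h3 := h1.unique h2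
    rw [one_mul, mul_one] at h3
    -- Both `α (-1)` and `β 1` are normalisations of the same translate of `P`; they differ by a
    -- constant times `T^m`, which is the automorphy factor.
    have h4 : α (-1) = (a₀⁻¹ * aₘ * ((Q⁻¹ : Kˣ) : K) ^ (m : ℤ)) • (mono p i K m * β 1) := by
      simp only [α, β]
      conv_lhs => rw [hAB]
      rw [scale_smul, map_mul, scale_mono, zpow_neg_one, smul_mul_assoc, smul_smul]
    refine mul_right_cancel₀ (hβ0 1) ?_
    rw [h3, h4]
    simp only [mul_smul_comm, smul_mul_assoc]
    congr 1
    ring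
  · obtain ⟨S, hS1, hS2, hS3⟩ := ((eventually_dom_natDegree (p := p) (i := i) hR.ne_zero).and
      ((eventually_dom_zero (p := p) (i := i) hR0).and (eventually_ge_atTop 1))).exists
    have hS := one_pos.trans_le hS3
    have hr := inv_pos.mpr hS
    obtain ⟨N₀, hN₀⟩ := eventually_atTop.mp (((hE S hS).eventually_le_const
      (by norm_num : (0 : ℝ) < 1 / 2)).and ((hE S⁻¹ hr).eventually_le_const
      (by norm_num : (0 : ℝ) < 1 / 2)))
    have hmul : ∀ N, N₀ ≤ N → multiplicity (ofPoly p i K R) θ = ∑ k ∈ Finset.range N,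
        ((if Associated R (twist (Q ^ (k : ℤ)) P) then 1 else 0) +
          (if Associated R (twist (Q ^ (-((k : ℤ) + 1))) P) then 1 else 0)) := by
      intro N hN
      obtain ⟨G, hG, hG1⟩ := tail N
      have hG0 : G ≠ 0 := fun h => hθ0 (by rw [hG, h, mul_zero])
      -- By `one_le_gn_one_sub_mul` no multiple of `R` is closer than `1` to the constant `1` on
      -- both circles `|T| = S` and `|T| = S⁻¹`, whereas `G` is.
      have hGm : multiplicity (ofPoly p i K R) G = 0 := by
        rw [multiplicity_eq_zero]
        rintro ⟨h, hh⟩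
        rw [mul_comm] at hh
        have h1 := hG1 S hS fun k hk => (hN₀ k (hN.trans hk)).1
        have h2 := hG1 S⁻¹ hr fun k hk => (hN₀ k (hN.trans hk)).2
        rw [hh] at h1 h2
        exact absurd h1 (not_lt.mpr (one_le_gn_one_sub_mul hr hS
          ((inv_le_one_of_one_le₀ hS3).trans hS3) hS2 hS1
          (by exact_mod_cast hR.natDegree_pos) h h2))
      rw [hG, multiplicity_ofPoly_mul hR hR0 (Finset.prod_ne_zero_iff.mpr fun k _ => hE0 k) hG0,
        hGm, add_zero, multiplicity_ofPoly_prod hR hR0 hE0]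
      refine Finset.sum_congr rfl fun k _ => ?_
      rw [multiplicity_ofPoly_mul hR hR0 (hα0 _) (hβ0 _),
        multiplicity_eq_of_associated_right (hαa _), multiplicity_eq_of_associated_right (hβa _),
        multiplicity_ofPoly_ofPoly hR hR0 (irreducible_twist hP),
        multiplicity_ofPoly_ofPoly hR hR0 (irreducible_twist hP)]
    split_ifs with hk
    · obtain ⟨k₀, hk₀⟩ := hk
      have hiff : ∀ k, Associated R (twist (Q ^ k) P) ↔ k = k₀ := fun k =>
        ⟨fun h => eq_of_associated_twist hQ hP hP0 (h.symm.trans hk₀), fun h => h ▸ hk₀⟩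
      rw [hmul (max N₀ (k₀.natAbs + 1)) (le_max_left _ _)]
      simp only [hiff]
      have := le_max_right N₀ (k₀.natAbs + 1)
      exact sum_range_ite_eq k₀ (by omega) (by omega)
    · push Not at hk
      rw [hmul N₀ le_rfl]
      refine Finset.sum_eq_zero fun k _ => ?_
      rw [if_neg (hk _), if_neg (hk _), add_zero]

end Level

/-! ### The space of series with a given automorphy factor. -/

theorem tendsto_zero_of_le_half {u : ℕ → ℝ} (h0 : ∀ n, 0 ≤ u n) {D : ℕ} (hD : 0 < D)
    (h : ∀ᶠ n in atTop, u (n + D) ≤ u n / 2) : Tendsto u atTop (𝓝 0) := by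
  obtain ⟨N, hN⟩ := eventually_atTop.mp h
  obtain ⟨M, hM⟩ := ((Finset.range D).image fun j => u (N + j)).bddAbove
  have hM' : ∀ j < D, u (N + j) ≤ M := fun j hj => hM (by
    simp only [Finset.coe_image, Set.mem_image, Finset.mem_coe, Finset.mem_range]
    exact ⟨j, hj, rfl⟩)
  have key : ∀ k j, j < D → u (N + j + D * k) ≤ M * (1 / 2) ^ k := by
    intro k j hj
    induction k with
    | zero => simpa using hM' j hj
    | succ k ih =>
      have h1 := hN (N + j + D * k) (by omega)
      have e : N + j + D * (k + 1) = N + j + D * k + D := by ring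
      rw [e, pow_succ]
      linarith
  rw [← tendsto_add_atTop_iff_nat N]
  have h1 : Tendsto (fun n : ℕ => M * (1 / 2 : ℝ) ^ (n / D)) atTop (𝓝 0) := by
    have := ((tendsto_pow_atTop_nhds_zero_of_lt_one (by norm_num : (0 : ℝ) ≤ 1 / 2)
      (by norm_num)).comp (Nat.tendsto_div_const_atTop hD.ne')).const_mul M
    rwa [mul_zero] at this
  refine squeeze_zero (fun n => h0 _) (fun n => ?_) h1
  have := key (n / D) (n % D) (Nat.mod_lt _ hD)
  rwa [add_assoc, Nat.mod_add_div, add_comm] at this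

section Level

variable {p i : ℕ} [hp : Fact p.Prime]
variable {K : Type*} [NormedField K] [IsUltrametricDist K] [CompleteSpace K]

/-- The solution of `W n = c Q ^ n W (n - D)` with `W n = 1` for `0 ≤ n < D`. -/
def weight (c Q : K) (D n : ℤ) : K :=
  -- With `n = D k + j` and `0 ≤ j < D`, the recursion multiplies the factors `c Q^(j + D l)` for `l
  -- = 1, …, k`. The division by `2` is exact for every integer `k`.
  c ^ (n / D) * Q ^ (n / D * (n % D) + D * (n / D * (n / D + 1) / 2))

theorem weight_ne_zero {c Q : K} (hc : c ≠ 0) (hQ : Q ≠ 0) (D n : ℤ) : weight c Q D n ≠ 0 :=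
  mul_ne_zero (zpow_ne_zero _ hc) (zpow_ne_zero _ hQ)

theorem weight_of_lt {c Q : K} {D n : ℤ} (h0 : 0 ≤ n) (h1 : n < D) : weight c Q D n = 1 := by
  simp [weight, Int.ediv_eq_zero_of_lt h0 h1]

theorem weight_add {c Q : K} (hc : c ≠ 0) (hQ : Q ≠ 0) {D : ℤ} (hD : 0 < D) (n : ℤ) :
    weight c Q D (n + D) = c * Q ^ (n + D) * weight c Q D n := by
  have h1 : (n + D) / D = n / D + 1 := by rw [Int.add_ediv_of_dvd_right (dvd_refl D),
    Int.ediv_self hD.ne']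
  have h2 : (n + D) % D = n % D := Int.add_emod_right n D
  have h3 := Int.emod_add_mul_ediv n D
  have h4 : (n / D + 1) * (n / D + 1 + 1) / 2 = n / D * (n / D + 1) / 2 + (n / D + 1) := by
    have : (n / D + 1) * (n / D + 1 + 1) = n / D * (n / D + 1) + (n / D + 1) * 2 := by ring
    rw [this, Int.add_mul_ediv_right _ _ (by norm_num)]
  unfold weight
  rw [h1, h2, h4, zpow_add_one₀ hc]
  have h5 : (n / D + 1) * (n % D) + D * (n / D * (n / D + 1) / 2 + (n / D + 1)) =
      (n + D) + (n / D * (n % D) + D * (n / D * (n / D + 1) / 2)) := by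
    linear_combination h3
  rw [h5, zpow_add₀ hQ]
  ring

/-- A step of length `D` away from `0` multiplies the term by a constant times a growing power of
`|Q|`, in either direction. Eventually it is at least halved. -/
theorem tendsto_weight {c Q : K} (hc : c ≠ 0) (hQ : Q ≠ 0) (hQ1 : ‖Q‖ < 1) {D : ℕ} (hD : 0 < D)
    {ρ : ℝ} (hρ : 0 < ρ) :
    Tendsto (fun n : ℤ => ‖weight c Q D n‖ * ρ ^ n) cofinite (𝓝 0) := by
  have hDz : (0 : ℤ) < D := by exact_mod_cast hD
  have hpow := tendsto_pow_atTop_nhds_zero_of_lt_one (norm_nonneg Q) hQ1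
  rw [Int.cofinite_eq, tendsto_sup]
  constructor
  · rw [← tendsto_comp_neg_atTop_iff, ← Nat.map_cast_int_atTop, tendsto_map'_iff]
    refine tendsto_zero_of_le_half (fun n => by simp only [Function.comp]; positivity) hD ?_
    have h1 := hpow.mul_const (‖c‖⁻¹ * ρ ^ (-(D : ℤ)))
    rw [zero_mul] at h1
    filter_upwards [h1.eventually_lt_const (show (0 : ℝ) < 1 / 2 by norm_num)] with n hn
    simp only [Function.comp]
    have h2 := weight_add hc hQ hDz (-((n + D : ℕ) : ℤ))
    have h3 : -((n + D : ℕ) : ℤ) + D = -(n : ℤ) := by push_cast; ring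
    rw [h3] at h2
    have h4 : ‖weight c Q D (-((n + D : ℕ) : ℤ))‖ = ‖Q‖ ^ n * ‖c‖⁻¹ * ‖weight c Q D (-(n : ℤ))‖ := by
      rw [h2, norm_mul, norm_mul, norm_zpow, zpow_neg, zpow_natCast]
      have := norm_pos_iff.mpr hc
      have := norm_pos_iff.mpr hQ
      field_simp
    have h5 : ρ ^ (-((n + D : ℕ) : ℤ)) = ρ ^ (-(D : ℤ)) * ρ ^ (-(n : ℤ)) := by
      rw [← zpow_add₀ hρ.ne']
      congr 1
      push_cast
      ring
    rw [h4, h5]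
    have h6 : 0 ≤ ‖weight c Q D (-(n : ℤ))‖ * ρ ^ (-(n : ℤ)) := by positivity
    nlinarith
  · rw [← Nat.map_cast_int_atTop, tendsto_map'_iff]
    refine tendsto_zero_of_le_half (fun n => by simp only [Function.comp]; positivity) hD ?_
    have h1 := hpow.mul_const (‖c‖ * ‖Q‖ ^ D * ρ ^ D)
    rw [zero_mul] at h1
    filter_upwards [h1.eventually_lt_const (show (0 : ℝ) < 1 / 2 by norm_num)] with n hn
    simp only [Function.comp]
    push_cast
    rw [weight_add hc hQ hDz, norm_mul, norm_mul, norm_zpow, zpow_add₀ (norm_pos_iff.mpr hQ).ne',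
      zpow_add₀ hρ.ne', zpow_natCast, zpow_natCast, zpow_natCast, zpow_natCast]
    have h6 : 0 ≤ ‖weight c Q D n‖ * ρ ^ n := by positivity
    nlinarith

variable (p i) in
/-- The space of everywhere convergent series with `h(Q⁻¹ T) = c T ^ D h(T)`. -/
def autoSpace (c : K) (Q : Kˣ) (D : ℕ) : Submodule K (LF K p i) where
  carrier := {h | scale Q⁻¹ h = c • (mono p i K D * h)}
  zero_mem' := by simp
  add_mem' {a b} ha hb := by
    simp only [Set.mem_ofPred_eq] at *
    rw [map_add, ha, hb, mul_add, smul_add]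
  smul_mem' r a ha := by
    simp only [Set.mem_ofPred_eq] at *
    rw [scale_smul, ha, mul_smul_comm, smul_comm]

theorem mem_autoSpace {c : K} {Q : Kˣ} {D : ℕ} {h : LF K p i} :
    h ∈ autoSpace p i c Q D ↔ scale Q⁻¹ h = c • (mono p i K D * h) := Iff.rfl

theorem mem_autoSpace_iff_cf {c : K} {Q : Kˣ} {D : ℕ} {h : LF K p i} :
    h ∈ autoSpace p i c Q D ↔ ∀ n, cf h (n + D) = c * (Q : K) ^ (n + D) * cf h n := by
  rw [mem_autoSpace]
  have e : ∀ n, cf (scale Q⁻¹ h) (n + D) = cf (c • (mono p i K D * h)) (n + D) ↔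
      cf h (n + D) = c * (Q : K) ^ (n + D) * cf h n := fun n => by
    rw [cf_scale, cf_smul, cf_mono_mul, add_sub_cancel_right, Units.val_inv_eq_inv_val, inv_zpow,
      inv_mul_eq_iff_eq_mul₀ (zpow_ne_zero _ Q.ne_zero)]
    constructor <;> intro h <;> rw [h] <;> ring
  constructor
  · intro h1 n
    rw [← e, h1]
  · intro h1
    refine cf_ext fun n => ?_
    have := (e (n - D)).mpr (h1 _)
    rwa [sub_add_cancel] at this

/-- The coefficients and the weights satisfy the same recursion, so their quotient is `D`-periodic.
-/
theorem cf_eq_weight_mul {c : K} (hc : c ≠ 0) {Q : Kˣ} {D : ℕ} (hD : 0 < D) {h : LF K p i}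
    (hh : h ∈ autoSpace p i c Q D) (n : ℤ) : cf h n = weight c (Q : K) D n * cf h (n % D) := by
  have hDz : (0 : ℤ) < D := by exact_mod_cast hD
  have hper : Function.Periodic (fun n => cf h n / weight c (Q : K) D n) (D : ℤ) := fun n => by
    dsimp only
    rw [mem_autoSpace_iff_cf.mp hh, weight_add hc Q.ne_zero hDz,
      mul_div_mul_left _ _ (mul_ne_zero hc (zpow_ne_zero _ Q.ne_zero))]
  have h1 := hper.int_mul (n / D) (n % D)
  rw [Int.cast_id, mul_comm, Int.emod_add_mul_ediv, weight_of_lt (Int.emod_nonneg _ hDz.ne')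
    (Int.emod_lt_of_pos _ hDz), div_one, div_eq_iff (weight_ne_zero hc Q.ne_zero _ _)] at h1
  rw [h1, mul_comm]

/-- The coefficients of index `0, …, D - 1` determine the series by the recursion, and the decay of
the weights makes every choice of them converge. The dimension in the theorem comes from here. -/
theorem exists_autoSpace_equiv {c : K} (hc : c ≠ 0) {Q : Kˣ} (hQ : ‖(Q : K)‖ < 1) {D : ℕ}
    (hD : 0 < D) : Nonempty (autoSpace p i c Q D ≃ₗ[K] (Fin D → K)) := by
  have hDz : (0 : ℤ) < D := by exact_mod_cast hD
  let Φ : autoSpace p i c Q D →ₗ[K] (Fin D → K) :=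
    { toFun := fun h j => cf h.1 (j : ℕ)
      map_add' := fun _ _ => rfl
      map_smul' := fun _ _ => rfl }
  refine ⟨LinearEquiv.ofBijective Φ ⟨?_, ?_⟩⟩
  · rw [← LinearMap.ker_eq_bot, LinearMap.ker_eq_bot']
    rintro ⟨h, hh⟩ h0
    refine Subtype.ext (cf_ext fun n => ?_)
    have h1 := Int.emod_nonneg n hDz.ne'
    have h2 := Int.emod_lt_of_pos n hDz
    have h3 : cf h (((n % D).toNat : ℕ) : ℤ) = 0 :=
      congrFun h0 ⟨(n % D).toNat, by omega⟩
    rw [Int.toNat_of_nonneg h1] at h3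
    change cf h n = 0
    rw [cf_eq_weight_mul hc hD hh, h3, mul_zero]
  · intro x
    have hlt : ∀ n : ℤ, (n % D).toNat < D := fun n => by
      have h1 := Int.emod_nonneg n hDz.ne'
      have h2 := Int.emod_lt_of_pos n hDz
      omega
    obtain ⟨C, hC⟩ := (Set.finite_range fun j => ‖x j‖).bddAbove
    let h : LF K p i := mkLF (fun n => weight c (Q : K) D n * x ⟨(n % D).toNat, hlt n⟩)
      fun ρ hρ => by
        have h1 := (tendsto_weight hc Q.ne_zero hQ hD hρ).mul_const C
        rw [zero_mul] at h1
        refine squeeze_zero (fun n => by positivity) (fun n => ?_) h1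
        rw [norm_mul, mul_right_comm]
        exact mul_le_mul_of_nonneg_left (hC ⟨_, rfl⟩) (by positivity)
    refine ⟨⟨h, mem_autoSpace_iff_cf.mpr fun n => ?_⟩, ?_⟩
    · simp only [h, cf_mkLF, weight_add hc Q.ne_zero hDz, Int.add_emod_right]
      ring
    · funext j
      change cf h (j : ℕ) = x j
      have h1 : ((j : ℕ) : ℤ) % D = (j : ℕ) :=
        Int.emod_eq_of_lt (by omega) (by exact_mod_cast j.2)
      simp only [h, cf_mkLF, h1, weight_of_lt (show (0 : ℤ) ≤ (j : ℕ) by omega)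
        (by exact_mod_cast j.2 : ((j : ℕ) : ℤ) < D), one_mul]
      congr 1

end Level

/-! ### Meromorphic functions, their orders, and division by a theta function. -/

section Level

open Polynomial

variable {p i : ℕ} [hp : Fact p.Prime]
variable {K : Type*} [NormedField K] [IsUltrametricDist K] [CompleteSpace K]

variable (p i K) in
/-- The embedding of everywhere convergent series into meromorphic functions. -/
abbrev toMero : LF K p i →+* MeroFn K p i := algebraMap (LF K p i) (MeroFn K p i)

theorem toMero_ne_zero {f : LF K p i} (hf : f ≠ 0) : toMero p i K f ≠ 0 :=
  IsFractionRing.to_map_ne_zero_of_mem_nonZeroDivisors (mem_nonZeroDivisors_of_ne_zero hf)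

theorem toMero_injective : Function.Injective (toMero p i K) := IsFractionRing.injective _ _

theorem exists_eq_div (f : MeroFn K p i) :
    ∃ a b : LF K p i, b ≠ 0 ∧ f = toMero p i K a / toMero p i K b := by
  obtain ⟨a, b, hb, h⟩ := IsFractionRing.div_surjective (LF K p i) f
  exact ⟨a, b, nonZeroDivisors.ne_zero hb, h.symm⟩

/-- The order along the prime `P(T)`. -/
def val (P : K[X]) (f : MeroFn K p i) : ℤ :=
  multiplicity (ofPoly p i K P) (IsLocalization.sec (nonZeroDivisors (LF K p i)) f).1 -
    multiplicity (ofPoly p i K P)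
      ((IsLocalization.sec (nonZeroDivisors (LF K p i)) f).2 : LF K p i)

/-- Cross-multiplication with the chosen fraction shows that the order does not depend on the
representative, by additivity of multiplicities at a prime. -/
theorem val_div {P : K[X]} (hP : Irreducible P) (hP0 : P.coeff 0 ≠ 0) {a b : LF K p i}
    (ha : a ≠ 0) (hb : b ≠ 0) : val P (toMero p i K a / toMero p i K b) =
      multiplicity (ofPoly p i K P) a - multiplicity (ofPoly p i K P) b := by
  set f := toMero p i K a / toMero p i K b
  have hs := IsLocalization.sec_spec (nonZeroDivisors (LF K p i)) f
  unfold val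
  set s := IsLocalization.sec (nonZeroDivisors (LF K p i)) f
  have hs2 : (s.2 : LF K p i) ≠ 0 := nonZeroDivisors.ne_zero s.2.2
  have h1 : a * s.2 = s.1 * b := by
    apply toMero_injective (p := p) (i := i)
    rw [map_mul, map_mul, ← hs, mul_right_comm, div_mul_cancel₀ _ (toMero_ne_zero hb)]
  have hs1 : s.1 ≠ 0 := fun h => by
    rw [h, zero_mul] at h1
    exact mul_ne_zero ha hs2 h1
  have h2 := congrArg (multiplicity (ofPoly p i K P)) h1
  rw [multiplicity_ofPoly_mul hP hP0 ha hs2, multiplicity_ofPoly_mul hP hP0 hs1 hb] at h2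
  omega

theorem val_toMero {P : K[X]} (hP : Irreducible P) (hP0 : P.coeff 0 ≠ 0) {a : LF K p i}
    (ha : a ≠ 0) : val P (toMero p i K a) = multiplicity (ofPoly p i K P) a := by
  have h := val_div hP hP0 ha (one_ne_zero (α := LF K p i))
  have h1 : multiplicity (ofPoly p i K P) 1 = 0 := by
    rw [multiplicity_eq_zero]
    exact fun h => not_isUnit_ofPoly hP hP0 (isUnit_of_dvd_one h)
  rwa [map_one, div_one, h1, Nat.cast_zero, sub_zero] at h

theorem val_mul {P : K[X]} (hP : Irreducible P) (hP0 : P.coeff 0 ≠ 0) {f g : MeroFn K p i}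
    (hf : f ≠ 0) (hg : g ≠ 0) : val P (f * g) = val P f + val P g := by
  obtain ⟨a, b, hb, rfl⟩ := exists_eq_div f
  obtain ⟨a', b', hb', rfl⟩ := exists_eq_div g
  have ha : a ≠ 0 := fun h => hf (by simp [h])
  have ha' : a' ≠ 0 := fun h => hg (by simp [h])
  rw [div_mul_div_comm, ← map_mul, ← map_mul,
    val_div hP hP0 (mul_ne_zero ha ha') (mul_ne_zero hb hb'), val_div hP hP0 ha hb,
    val_div hP hP0 ha' hb', multiplicity_ofPoly_mul hP hP0 ha ha',
    multiplicity_ofPoly_mul hP hP0 hb hb']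
  push_cast
  ring

theorem val_one {P : K[X]} (hP : Irreducible P) (hP0 : P.coeff 0 ≠ 0) :
    val P (1 : MeroFn K p i) = 0 := by
  have h := val_mul hP hP0 (one_ne_zero (α := MeroFn K p i)) one_ne_zero
  rw [mul_one] at h
  omega

theorem val_inv {P : K[X]} (hP : Irreducible P) (hP0 : P.coeff 0 ≠ 0) {f : MeroFn K p i}
    (hf : f ≠ 0) : val P f⁻¹ = -val P f := by
  have h := val_mul hP hP0 hf (inv_ne_zero hf)
  rw [mul_inv_cancel₀ hf, val_one hP hP0] at h
  omega

theorem val_pow {P : K[X]} (hP : Irreducible P) (hP0 : P.coeff 0 ≠ 0) {f : MeroFn K p i}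
    (hf : f ≠ 0) (n : ℕ) : val P (f ^ n) = n * val P f := by
  induction n with
  | zero => simp [val_one hP hP0]
  | succ n ih =>
    rw [pow_succ, val_mul hP hP0 (pow_ne_zero _ hf) hf, ih]
    push_cast
    ring

theorem val_zpow {P : K[X]} (hP : Irreducible P) (hP0 : P.coeff 0 ≠ 0) {f : MeroFn K p i}
    (hf : f ≠ 0) (n : ℤ) : val P (f ^ n) = n * val P f := by
  obtain ⟨n, rfl | rfl⟩ := n.eq_nat_or_neg
  · rw [zpow_natCast, val_pow hP hP0 hf]
  · rw [zpow_neg, zpow_natCast, val_inv hP hP0 (pow_ne_zero _ hf), val_pow hP hP0 hf, neg_mul]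

/-- A meromorphic function without poles is everywhere convergent. -/
theorem exists_toMero_eq {f : MeroFn K p i}
    (h : ∀ P : K[X], Irreducible P → P.coeff 0 ≠ 0 → f ≠ 0 → 0 ≤ val P f) :
    ∃ a, toMero p i K a = f := by
  obtain ⟨a, b, hb, rfl⟩ := exists_eq_div f
  by_cases ha : a = 0
  · exact ⟨0, by simp [ha]⟩
  obtain ⟨c, rfl⟩ := dvd_of_multiplicity_le (a := a) hb fun P hP hP0 => by
    have := h P hP hP0 (div_ne_zero (toMero_ne_zero ha) (toMero_ne_zero hb))
    rw [val_div hP hP0 ha hb] at this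
    omega
  exact ⟨c, by rw [map_mul, mul_div_cancel_left₀ _ (toMero_ne_zero hb)]⟩

variable (p i) in
/-- The substitution `T ↦ u T` on meromorphic functions. -/
def meroScale (u : Kˣ) : MeroFn K p i ≃+* MeroFn K p i :=
  IsFractionRing.ringEquivOfRingEquiv (scale (p := p) (i := i) u)

theorem meroScale_toMero (u : Kˣ) (f : LF K p i) :
    meroScale p i u (toMero p i K f) = toMero p i K (scale u f) :=
  IsFractionRing.ringEquivOfRingEquiv_algebraMap _ _

theorem toMero_smul (c : K) (f : LF K p i) : toMero p i K (c • f) = c • toMero p i K f := by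
  rw [Algebra.smul_def, Algebra.smul_def, map_mul,
    IsScalarTower.algebraMap_apply K (LF K p i) (MeroFn K p i)]

theorem toMero_mono_zpow (m n : ℤ) :
    toMero p i K (mono p i K m) ^ n = toMero p i K (mono p i K (m * n)) := by
  have hinv : ∀ k, (toMero p i K (mono p i K k))⁻¹ = toMero p i K (mono p i K (-k)) := fun k => by
    refine inv_eq_of_mul_eq_one_right ?_
    rw [← map_mul, ← mono_add, add_neg_cancel, mono_zero, map_one]
  obtain ⟨n, rfl | rfl⟩ := n.eq_nat_or_neg
  · rw [zpow_natCast, ← map_pow, mono_pow]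
  · rw [zpow_neg, zpow_natCast, ← map_pow, mono_pow, hinv, mul_neg]

open Classical in
/-- A meromorphic theta function with prescribed divisor. -/
theorem exists_meroTheta {Q : Kˣ} (hQ : ‖(Q : K)‖ < 1) (S : Finset K[X])
    (hS : ∀ P ∈ S, Irreducible P ∧ P.coeff 0 ≠ 0) (n : K[X] → ℤ) :
    ∃ g : MeroFn K p i, g ≠ 0 ∧
      (∃ c : K, c ≠ 0 ∧ meroScale p i Q⁻¹ g =
        c • (toMero p i K (mono p i K (∑ P ∈ S, n P * P.natDegree)) * g)) ∧
      ∀ R : K[X], Irreducible R → R.coeff 0 ≠ 0 → val R g =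
        ∑ P ∈ S, if ∃ k : ℤ, Associated R (twist (Q ^ k) P) then n P else 0 := by
  induction S using Finset.induction_on with
  | empty =>
    refine ⟨1, one_ne_zero, ⟨1, one_ne_zero, ?_⟩, fun R hR hR0 => ?_⟩
    · simp [mono_zero]
    · simp [val_one hR hR0]
  | insert P S hPS ih =>
    obtain ⟨g, hg, ⟨c, hc, hcg⟩, hv⟩ := ih fun R hR => hS R (Finset.mem_insert_of_mem hR)
    obtain ⟨hP, hP0⟩ := hS P (Finset.mem_insert_self _ _)
    obtain ⟨θ, hθ, ⟨e, he, heθ⟩, hvθ⟩ := exists_theta (p := p) (i := i) hQ hP hP0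
    have hθ' := toMero_ne_zero hθ
    refine ⟨toMero p i K θ ^ n P * g, mul_ne_zero (zpow_ne_zero _ hθ') hg,
      ⟨e ^ n P * c, mul_ne_zero (zpow_ne_zero _ he) hc, ?_⟩, fun R hR hR0 => ?_⟩
    · rw [map_mul, map_zpow₀, meroScale_toMero, heθ, toMero_smul, map_mul, hcg,
        Finset.sum_insert hPS, mono_add, map_mul, mul_comm (n P), ← toMero_mono_zpow,
        Algebra.smul_def, Algebra.smul_def, Algebra.smul_def, mul_zpow, mul_zpow, map_mul, map_zpow₀]
      ring
    · rw [val_mul hR hR0 (zpow_ne_zero _ hθ') hg, val_zpow hR hR0 hθ', val_toMero hR hR0 hθ,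
        hvθ R hR hR0, hv R hR hR0, Finset.sum_insert hPS]
      split_ifs <;> simp

/-- Division by a theta function identifies automorphic series with periodic functions. -/
theorem exists_submodule {Q : Kˣ} (hQ : ‖(Q : K)‖ < 1) {D : ℕ} (hD : 0 < D) {g : MeroFn K p i}
    (hg : g ≠ 0) {c : K} (hc : c ≠ 0)
    (hcg : meroScale p i Q⁻¹ g = c • (toMero p i K (mono p i K D) * g)) :
    ∃ L : Submodule K (MeroFn K p i),
      (∀ f, f ∈ L ↔ meroScale p i Q⁻¹ f = f ∧
        ∀ P : K[X], Irreducible P → P.coeff 0 ≠ 0 → f ≠ 0 → -val P g ≤ val P f) ∧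
      Module.Finite K L ∧ Module.finrank K L = D := by
  -- Inverse to `f ↦ f g`: the automorphy factors of `h` and `g` cancel in `g⁻¹ h`, and conversely
  -- `f g` has nonnegative orders, hence is a series.
  let φ : LF K p i →ₗ[K] MeroFn K p i :=
    { toFun := fun h => g⁻¹ * toMero p i K h
      map_add' := fun a b => by rw [map_add, mul_add]
      map_smul' := fun r a => by rw [toMero_smul, mul_smul_comm, RingHom.id_apply] }
  have hφ : Function.Injective φ := fun a b hab =>
    toMero_injective (mul_left_cancel₀ (inv_ne_zero hg) hab)
  obtain ⟨e⟩ := exists_autoSpace_equiv (p := p) (i := i) hc hQ hD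
  have e' := (Submodule.equivMapOfInjective φ hφ (autoSpace p i c Q D)).symm.trans e
  refine ⟨(autoSpace p i c Q D).map φ, fun f => ⟨?_, ?_⟩, Module.Finite.equiv e'.symm, ?_⟩
  · rintro ⟨h, hh, rfl⟩
    have hh' := mem_autoSpace.mp hh
    refine ⟨?_, fun P hP hP0 hne => ?_⟩
    · change meroScale p i Q⁻¹ (g⁻¹ * toMero p i K h) = g⁻¹ * toMero p i K h
      rw [map_mul, map_inv₀, meroScale_toMero, hh', hcg, toMero_smul, map_mul, Algebra.smul_def,
        Algebra.smul_def]
      have h1 : algebraMap K (MeroFn K p i) c ≠ 0 := (_root_.map_ne_zero _).mpr hc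
      have h2 := toMero_ne_zero (isUnit_mono (p := p) (i := i) (K := K) D).ne_zero
      field_simp
    · have hne' : h ≠ 0 := fun h0 => hne (by rw [h0, map_zero])
      change -val P g ≤ val P (g⁻¹ * toMero p i K h)
      rw [val_mul hP hP0 (inv_ne_zero hg) (toMero_ne_zero hne'), val_inv hP hP0 hg,
        val_toMero hP hP0 hne']
      omega
  · rintro ⟨h1, h2⟩
    obtain ⟨h, hh⟩ := exists_toMero_eq (f := f * g) fun P hP hP0 hne => by
      have hf := left_ne_zero_of_mul hne
      have := h2 P hP hP0 hf
      rw [val_mul hP hP0 hf hg]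
      omega
    refine ⟨h, mem_autoSpace.mpr (toMero_injective ?_), ?_⟩
    · rw [← meroScale_toMero, hh, map_mul, h1, hcg, toMero_smul, map_mul, hh, mul_smul_comm]
      congr 1
      ring
    · change g⁻¹ * toMero p i K h = f
      rw [hh, mul_comm, mul_assoc, mul_inv_cancel₀ hg, mul_one]
  · rw [e'.finrank_eq, Module.finrank_fin_fun]

end Level

/-! ### Points, minimal polynomials and inseparability degrees. -/

section Divisors

open Polynomial

variable {K : Type*} [NormedField K] [IsUltrametricDist K] [CompleteSpace K]

theorem isIntegral_closure (y : AlgebraicClosure K) : IsIntegral K y :=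
  Algebra.IsIntegral.isIntegral y

theorem irreducible_minpoly (y : (AlgebraicClosure K)ˣ) :
    Irreducible (minpoly K (y : AlgebraicClosure K)) := minpoly.irreducible (isIntegral_closure _)

theorem minpoly_coeff_zero (y : (AlgebraicClosure K)ˣ) :
    (minpoly K (y : AlgebraicClosure K)).coeff 0 ≠ 0 :=
  minpoly.coeff_zero_ne_zero (isIntegral_closure _) y.ne_zero

theorem associated_minpoly {R : K[X]} (hR : Irreducible R) {y : AlgebraicClosure K}
    (hy : aeval y R = 0) : Associated R (minpoly K y) := by
  rw [← minpoly.eq_of_irreducible hR hy]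
  exact associated_mul_unit_right _ _ (isUnit_C.mpr (isUnit_iff_ne_zero.mpr
    (inv_ne_zero (leadingCoeff_ne_zero.mpr hR.ne_zero))))

/-- Conditions at all irreducible `P` with `P(0) ≠ 0` and conditions at all points `y` are thereby
the same. -/
theorem exists_associated_minpoly {R : K[X]} (hR : Irreducible R) (hR0 : R.coeff 0 ≠ 0) :
    ∃ y : (AlgebraicClosure K)ˣ, Associated R (minpoly K (y : AlgebraicClosure K)) := by
  obtain ⟨y, hy⟩ := IsAlgClosed.exists_aeval_eq_zero (AlgebraicClosure K) R
    (degree_pos_of_irreducible hR).ne'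
  have hy0 : y ≠ 0 := by
    rintro rfl
    rw [aeval_def, eval₂_at_zero] at hy
    exact hR0 (by simpa using hy)
  exact ⟨Units.mk0 y hy0, associated_minpoly hR hy⟩

/-- The embedding `Kˣ → K̄ˣ`. -/
abbrev toBar : Kˣ →* (AlgebraicClosure K)ˣ :=
  Units.map (algebraMap K (AlgebraicClosure K) : K →* AlgebraicClosure K)

/-- If `P` vanishes at `z`, then `P(u T)` vanishes at `u⁻¹ z`. -/
theorem associated_twist_minpoly (u : Kˣ) (z : (AlgebraicClosure K)ˣ) :
    Associated (twist u (minpoly K (z : AlgebraicClosure K)))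
      (minpoly K ((toBar u⁻¹ * z : (AlgebraicClosure K)ˣ) : AlgebraicClosure K)) := by
  refine associated_minpoly (irreducible_twist (irreducible_minpoly z)) ?_
  have h : algebraMap K (AlgebraicClosure K) u *
      ((toBar u⁻¹ * z : (AlgebraicClosure K)ˣ) : AlgebraicClosure K) = z := by simp
  rw [twist, aeval_comp, map_mul, aeval_C, aeval_X, h, minpoly.aeval]

theorem spectralNorm_toBar_mul (u : Kˣ) (y : (AlgebraicClosure K)ˣ) :
    spectralNorm K (AlgebraicClosure K) ((toBar u * y : (AlgebraicClosure K)ˣ)) =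
      ‖(u : K)‖ * spectralNorm K (AlgebraicClosure K) y := by
  have := spectralNorm_smul (u : K) (isIntegral_closure (y : AlgebraicClosure K)).isAlgebraic
  rw [Algebra.smul_def] at this
  exact this

theorem spectralNorm_unit_pos (y : (AlgebraicClosure K)ˣ) :
    0 < spectralNorm K (AlgebraicClosure K) y :=
  spectralNorm_zero_lt y.ne_zero (isIntegral_closure (y : AlgebraicClosure K)).isAlgebraic

/-- With `eq_of_zpow_mul_mem`: the half-open interval `(a, 1]` is a fundamental domain for
multiplication by powers of `a`. -/
theorem exists_zpow_mul_mem {a t : ℝ} (ha : 0 < a) (ha1 : a < 1) (ht : 0 < t) :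
    ∃ k : ℤ, a < a ^ k * t ∧ a ^ k * t ≤ 1 := by
  obtain ⟨n, h1, h2⟩ := exists_mem_Ioc_zpow ht (one_lt_inv₀ ha |>.mpr ha1)
  rw [inv_zpow, ← zpow_neg] at h1 h2
  refine ⟨n + 1, ?_, ?_⟩
  · have := mul_lt_mul_of_pos_left h1 (zpow_pos ha (n + 1))
    rw [← zpow_add₀ ha.ne'] at this
    simpa using this
  · have := mul_le_mul_of_nonneg_left h2 (zpow_pos ha (n + 1)).le
    rw [← zpow_add₀ ha.ne'] at this
    simpa using this

theorem eq_of_zpow_mul_mem {a t : ℝ} (ha : 0 < a) (ha1 : a < 1) (ht : 0 < t) {k l : ℤ}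
    (hk : a < a ^ k * t) (hk' : a ^ k * t ≤ 1) (hl : a < a ^ l * t) (hl' : a ^ l * t ≤ 1) :
    k = l := by
  have key : ∀ k l : ℤ, a ^ k * t ≤ 1 → a < a ^ l * t → l ≤ k := by
    intro k l h1 h2
    by_contra! hlt
    have h3 : a ^ l ≤ a ^ (k + 1) := zpow_le_zpow_right_of_le_one₀ ha ha1.le (by omega)
    rw [zpow_add_one₀ ha.ne'] at h3
    have h4 := mul_le_mul_of_nonneg_right h3 ht.le
    nlinarith
  exact le_antisymm (key l k hl' hk) (key k l hk' hl)

open Classical in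
/-- The weighted number of conjugates of `z` is the degree of `z`. -/
theorem sum_finInsepDegree {z : (AlgebraicClosure K)ˣ} {Y : Finset (AlgebraicClosure K)ˣ}
    (hY : ∀ y, y ∈ Y ↔ minpoly K (y : AlgebraicClosure K) = minpoly K (z : AlgebraicClosure K)) :
    ∑ y ∈ Y, Field.finInsepDegree K K⟮(y : AlgebraicClosure K)⟯ =
      (minpoly K (z : AlgebraicClosure K)).natDegree := by
  set P := minpoly K (z : AlgebraicClosure K)
  have hP : P ≠ 0 := (irreducible_minpoly z).ne_zero
  -- The number of distinct roots is the separable degree, and each root has the inseparable degree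
  -- as its weight; the product is the degree.
  have hcard : Y.card = P.natSepDegree := by
    rw [natSepDegree_eq_of_isAlgClosed (AlgebraicClosure K),
      ← Finset.card_image_of_injective Y Units.val_injective]
    congr 1
    ext x
    rw [Finset.mem_image, Multiset.mem_toFinset, mem_aroots]
    constructor
    · rintro ⟨y, hy, rfl⟩
      refine ⟨hP, ?_⟩
      rw [← (hY y).mp hy, minpoly.aeval]
    · rintro ⟨-, hx⟩
      have hx0 : x ≠ 0 := by
        rintro rfl
        rw [aeval_def, eval₂_at_zero] at hx
        exact minpoly_coeff_zero z (by simpa using hx)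
      refine ⟨Units.mk0 x hx0, (hY _).mpr ?_, rfl⟩
      exact (eq_of_monic_of_associated (minpoly.monic (isIntegral_closure _))
        (minpoly.monic (isIntegral_closure _)) (associated_minpoly (irreducible_minpoly z) hx)).symm
  have hpos : 0 < P.natSepDegree := Nat.pos_of_ne_zero
    (natSepDegree_ne_zero _ (irreducible_minpoly z).natDegree_pos.ne')
  have he : ∀ y ∈ Y, P.natSepDegree * Field.finInsepDegree K K⟮(y : AlgebraicClosure K)⟯ =
      P.natDegree := fun y hy => by
    have h1 := Field.finSepDegree_mul_finInsepDegree K K⟮(y : AlgebraicClosure K)⟯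
    rwa [IntermediateField.finSepDegree_adjoin_simple_eq_natSepDegree K _
      (isIntegral_closure _).isAlgebraic, IntermediateField.adjoin.finrank (isIntegral_closure _),
      (hY y).mp hy] at h1
  have h2 := Finset.sum_congr rfl he
  rw [← Finset.mul_sum, Finset.sum_const, hcard, smul_eq_mul] at h2
  exact Nat.eq_of_mul_eq_mul_left hpos h2

theorem ordAt_of_ne_zero {p i : ℕ} [Fact p.Prime] (y : (AlgebraicClosure K)ˣ) {f : MeroFn K p i}
    (hf : f ≠ 0) : ordAt y f =
      (((val (minpoly K (y : AlgebraicClosure K)) f : ℚ) / (p : ℚ) ^ i : ℚ) : WithTop ℚ) := by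
  unfold ordAt val
  rw [if_neg hf]
  push_cast
  rfl

end Divisors

/-! ### The theta function of a periodic divisor. -/

section Divisors

open Polynomial

variable {p i : ℕ} [hp : Fact p.Prime]
variable {K : Type*} [NormedField K] [IsUltrametricDist K] [CompleteSpace K]

theorem pow_root_eq {q : ℕ → Kˣ} (hq : ∀ j, q (j + 1) ^ p = q j) (i : ℕ) : q i ^ p ^ i = q 0 := by
  induction i with
  | zero => simp
  | succ i ih => rw [pow_succ', pow_mul, hq, ih]

/-- The points of the fundamental annulus `|q| < |X| ≤ 1` in terms of `y = X^(1/pⁱ)`. -/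
theorem mem_annulus_iff {q : ℕ → Kˣ} (hq : ∀ j, q (j + 1) ^ p = q j) (i : ℕ) {t : ℝ}
    (ht : 0 < t) : (‖((q 0 : Kˣ) : K)‖ < t ^ p ^ i ∧ t ^ p ^ i ≤ 1) ↔
      ‖((q i : Kˣ) : K)‖ < t ∧ t ≤ 1 := by
  have h0 : p ^ i ≠ 0 := pow_ne_zero _ hp.out.ne_zero
  rw [← pow_root_eq hq i, Units.val_pow_eq_pow_val, norm_pow,
    pow_lt_pow_iff_left₀ (norm_nonneg _) ht.le h0, pow_le_one_iff_of_nonneg ht.le h0]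

theorem norm_root_lt_one {q : ℕ → Kˣ} (hq : ∀ j, q (j + 1) ^ p = q j)
    (hq_lt : ‖((q 0 : Kˣ) : K)‖ < 1) (i : ℕ) : ‖((q i : Kˣ) : K)‖ < 1 := by
  rw [← pow_root_eq hq i, Units.val_pow_eq_pow_val, norm_pow] at hq_lt
  exact lt_of_pow_lt_pow_left₀ (p ^ i) zero_le_one (by simpa using hq_lt)

namespace PerfDivisor

theorem IsPeriodic.zpow {q : ℕ → Kˣ} {d : PerfDivisor p K} (h : d.IsPeriodic q i) (k : ℤ)
    (y : (AlgebraicClosure K)ˣ) : d.mult (toBar (q i ^ k) * y) = d.mult y := by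
  have h1 : ∀ (k : ℕ) (y : (AlgebraicClosure K)ˣ), d.mult (toBar (q i ^ k) * y) = d.mult y := by
    intro k
    induction k with
    | zero => simp
    | succ k ih =>
      intro y
      rw [pow_succ, map_mul, mul_assoc, ih]
      exact h y
  obtain ⟨k, rfl | rfl⟩ := k.eq_nat_or_neg
  · rw [zpow_natCast, h1]
  · rw [zpow_neg, zpow_natCast, ← h1 k (toBar _ * y), ← mul_assoc, ← map_mul, mul_inv_cancel,
      map_one, one_mul]

end PerfDivisor

open Classical in
/-- A meromorphic theta function with a given periodic divisor. -/
theorem exists_meroTheta_of_divisor {q : ℕ → Kˣ} (hq : ∀ j, q (j + 1) ^ p = q j)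
    (hq_lt : ‖((q 0 : Kˣ) : K)‖ < 1) {d : PerfDivisor p K} (hd : d.HasDenominator i)
    (hper : d.IsPeriodic q i) :
    ∃ (g : MeroFn K p i) (c : K) (D : ℤ), g ≠ 0 ∧ c ≠ 0 ∧
      meroScale p i (q i)⁻¹ g = c • (toMero p i K (mono p i K D) * g) ∧
      (D : ℚ) = d.deg q i * (p : ℚ) ^ i ∧
      ∀ y : (AlgebraicClosure K)ˣ,
        (val (minpoly K (y : AlgebraicClosure K)) g : ℚ) = d.mult y * (p : ℚ) ^ i := by
  have hp0 : (p : ℚ) ^ i ≠ 0 := pow_ne_zero _ (Nat.cast_ne_zero.mpr hp.out.ne_zero)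
  set Q := q i
  have hQ := norm_root_lt_one hq hq_lt i
  have hQ0 := norm_unit_pos Q
  let mp : (AlgebraicClosure K)ˣ → K[X] := fun y => minpoly K (y : AlgebraicClosure K)
  let sn : (AlgebraicClosure K)ˣ → ℝ := fun y => spectralNorm K (AlgebraicClosure K) y
  have hsn : ∀ y, 0 < sn y := spectralNorm_unit_pos
  have hsn_mul : ∀ (u : Kˣ) y, sn (toBar u * y) = ‖(u : K)‖ * sn y := spectralNorm_toBar_mul
  -- The spectral norm is read off the minimal polynomial.
  have hsn_mp : ∀ y z, mp y = mp z → sn y = sn z := fun y z h => congrArg spectralValue h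
  have hmult_mp : ∀ y z, mp y = mp z → d.mult y = d.mult z := fun y z h =>
    d.rational y z (isConjRoot_def.mpr h)
  choose ν hν using hd
  have hν' : ∀ y, (ν y : ℚ) = d.mult y * (p : ℚ) ^ i := fun y => by
    rw [hν y, div_mul_cancel₀ _ hp0]
  have hν_mp : ∀ y z, mp y = mp z → ν y = ν z := fun y z h => by
    have : (ν y : ℚ) = ν z := by rw [hν', hν', hmult_mp y z h]
    exact_mod_cast this
  -- The multiplicity as a function of the minimal polynomial. By `hν_mp` the choice of root is
  -- harmless, and the default `0` is never used, since only minimal polynomials are inserted.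
  let n : K[X] → ℤ := fun P => if h : ∃ z, mp z = P then ν h.choose else 0
  have hn : ∀ z, n (mp z) = ν z := fun z => by
    have h : ∃ z', mp z' = mp z := ⟨z, rfl⟩
    simp only [n, dif_pos h]
    exact hν_mp _ _ h.choose_spec
  have hfin := (d.finite ‖(Q : K)‖ 1 hQ0).subset
    (show {y | (‖(Q : K)‖ < sn y ∧ sn y ≤ 1) ∧ d.mult y ≠ 0} ⊆ _ from
      fun y hy => ⟨hy.1.1.le, hy.1.2, hy.2⟩)
  set Y := hfin.toFinset
  have hY : ∀ y, y ∈ Y ↔ (‖(Q : K)‖ < sn y ∧ sn y ≤ 1) ∧ d.mult y ≠ 0 := fun y => by simp [Y]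
  obtain ⟨g, hg, ⟨c, hc, hcg⟩, hval⟩ := exists_meroTheta (p := p) (i := i) hQ (Y.image mp)
    (fun P hP => by
      obtain ⟨z, -, rfl⟩ := Finset.mem_image.mp hP
      exact ⟨irreducible_minpoly z, minpoly_coeff_zero z⟩) n
  refine ⟨g, c, _, hg, hc, hcg, ?_, fun y => ?_⟩
  · have h1 : d.deg q i =
        ∑ y ∈ Y, (Field.finInsepDegree K K⟮(y : AlgebraicClosure K)⟯ : ℚ) * d.mult y := by
      unfold PerfDivisor.deg
      refine finsum_mem_eq_sum_of_inter_support_eq _ ?_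
      ext y
      have h2 := mem_annulus_iff hq i (hsn y)
      simp only [Set.mem_inter_iff, Set.mem_ofPred_eq, Function.mem_support, Finset.mem_coe, hY]
      constructor
      · rintro ⟨h3, h4⟩
        exact ⟨⟨h2.mp h3, right_ne_zero_of_mul h4⟩, h4⟩
      · rintro ⟨h3, h4⟩
        exact ⟨h2.mpr h3.1, h4⟩
    -- A conjugacy class lies in the annulus as a whole, so the degree can be summed class by class,
    -- each giving its multiplicity times the degree of its polynomial.
    have h2 : ∀ P ∈ Y.image mp, ((n P * P.natDegree : ℤ) : ℚ) =
        ∑ y ∈ Y with mp y = P,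
          (Field.finInsepDegree K K⟮(y : AlgebraicClosure K)⟯ : ℚ) * (ν y : ℚ) := by
      intro P hP
      obtain ⟨z, hz, rfl⟩ := Finset.mem_image.mp hP
      have h3 := sum_finInsepDegree (z := z) (Y := Y.filter fun y => mp y = mp z) fun y => by
        rw [Finset.mem_filter]
        refine ⟨fun h => h.2, fun h => ⟨?_, h⟩⟩
        rw [hY, hsn_mp y z h, hmult_mp y z h, ← hY]
        exact hz
      have h4 : ((mp z).natDegree : ℚ) = ∑ y ∈ Y with mp y = mp z,
          (Field.finInsepDegree K K⟮(y : AlgebraicClosure K)⟯ : ℚ) := by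
        rw [← Nat.cast_sum, h3]
      push_cast
      rw [hn, h4, Finset.mul_sum]
      refine Finset.sum_congr rfl fun y hy => ?_
      rw [hν_mp y z (Finset.mem_filter.mp hy).2, mul_comm]
    rw [Int.cast_sum, Finset.sum_congr rfl h2,
      Finset.sum_fiberwise_of_maps_to fun y hy => Finset.mem_image_of_mem mp hy, h1,
      Finset.sum_mul]
    refine Finset.sum_congr rfl fun y _ => ?_
    rw [hν', mul_assoc]
  · obtain ⟨k₀, hk₀, hk₀'⟩ := exists_zpow_mul_mem hQ0 hQ (hsn y)
    have hnorm : ∀ k : ℤ, sn (toBar (Q ^ k) * y) = ‖(Q : K)‖ ^ k * sn y := fun k => by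
      rw [hsn_mul, Units.val_zpow_eq_zpow_val, norm_zpow]
    -- `P(Q^k T)` is the polynomial of `y` exactly when `P` is that of `Q^k y`.
    have htw : ∀ (k : ℤ) (P : K[X]), Associated (mp y) (twist (Q ^ k) P) ↔
        Associated (mp (toBar (Q ^ k) * y)) P := by
      have haux : ∀ {A B : K[X]} (u : Kˣ), Associated A B →
          Associated (twist u A) (twist u B) := fun u h =>
        h.map (compRingHom (C (u : K) * X))
      intro k P
      have h1 := associated_twist_minpoly (Q ^ (-k)) y
      rw [← zpow_neg, neg_neg] at h1
      have e1 : twist (Q ^ k) (twist (Q ^ (-k)) (mp y)) = mp y := by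
        rw [twist_twist, ← zpow_add, add_neg_cancel, zpow_zero, twist_one]
      have e2 : twist (Q ^ (-k)) (twist (Q ^ k) P) = P := by
        rw [twist_twist, ← zpow_add, neg_add_cancel, zpow_zero, twist_one]
      constructor
      · intro h
        have := haux (Q ^ (-k)) h
        rw [e2] at this
        exact h1.symm.trans this
      · intro h
        have := haux (Q ^ k) (h1.trans h)
        rwa [e1] at this
    set z₀ := toBar (Q ^ k₀) * y
    have hz₀ : d.mult z₀ = d.mult y := hper.zpow k₀ y
    -- Only one translate of `y` by a power of `Q` lies in the fundamental annulus, so at most one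
    -- factor of `g` contributes to the order at `y`.
    have hind : ∀ P ∈ Y.image mp, (∃ k : ℤ, Associated (mp y) (twist (Q ^ k) P)) ↔ P = mp z₀ := by
      intro P hP
      obtain ⟨z, hz, rfl⟩ := Finset.mem_image.mp hP
      constructor
      · rintro ⟨k, hk⟩
        have h1 : mp (toBar (Q ^ k) * y) = mp z :=
          eq_of_monic_of_associated (minpoly.monic (isIntegral_closure _))
            (minpoly.monic (isIntegral_closure _)) ((htw _ _).mp hk)
        have h2 := ((hY z).mp hz).1
        rw [← hsn_mp _ _ h1, hnorm] at h2
        rw [← h1, eq_of_zpow_mul_mem hQ0 hQ (hsn y) h2.1 h2.2 hk₀ hk₀']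
      · intro h
        exact ⟨k₀, (htw _ _).mpr (h ▸ Associated.refl _)⟩
    have hsum : val (mp y) g = if mp z₀ ∈ Y.image mp then n (mp z₀) else 0 := by
      rw [hval _ (irreducible_minpoly y) (minpoly_coeff_zero y), ← Finset.sum_ite_eq']
      exact Finset.sum_congr rfl fun P hP => if_congr (hind P hP) rfl rfl
    change ((val (mp y) g : ℤ) : ℚ) = _
    rw [hsum]
    split_ifs with h
    · rw [hn, hν', hz₀]
    · have h0 : d.mult z₀ = 0 := by
        by_contra hne
        refine h (Finset.mem_image_of_mem mp ((hY z₀).mpr ⟨?_, hne⟩))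
        rw [hnorm]
        exact ⟨hk₀, hk₀'⟩
      rw [← hz₀, h0, zero_mul, Int.cast_zero]

theorem val_eq_of_associated {P R : K[X]} (h : Associated P R) (f : MeroFn K p i) :
    val P f = val R f := by
  unfold val
  rw [multiplicity_eq_of_associated_left (h.map (ofPoly p i K)),
    multiplicity_eq_of_associated_left (h.map (ofPoly p i K))]

end Divisors

end PerfectoidTate

end

/-! ### The Riemann–Roch theorem. -/

theorem mainTheorem2 {K : Type*} [NormedField K] [IsUltrametricDist K] [CompleteSpace K]
    (p : ℕ) [Fact p.Prime] (hK : PerfectoidTate.IsPerfectoidField p K)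
    (q : ℕ → Kˣ) (hq : ∀ j, q (j + 1) ^ p = q j) (hq_lt : ‖((q 0 : Kˣ) : K)‖ < 1)
    (i : ℕ) (d : PerfectoidTate.PerfDivisor p K) (hd : d.HasDenominator i)
    (hper : d.IsPeriodic q i) (hdeg : 0 < d.deg q i) :
    ∃ L : Submodule K (PerfectoidTate.MeroFn K p i),
      (L : Set (PerfectoidTate.MeroFn K p i)) = PerfectoidTate.rrSet q d ∧
        Module.Finite K L ∧ (Module.finrank K L : ℚ) = d.deg q i * (p : ℚ) ^ i := by
  have hp0 : (0 : ℚ) < (p : ℚ) ^ i := pow_pos (Nat.cast_pos.mpr (Fact.out : p.Prime).pos) _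
  obtain ⟨g, c, D, hg, hc, hcg, hD, hval⟩ :=
    PerfectoidTate.exists_meroTheta_of_divisor hq hq_lt hd hper
  have hDpos : 0 < D := by
    have : (0 : ℚ) < D := by
      rw [hD]
      exact mul_pos hdeg hp0
    exact_mod_cast this
  lift D to ℕ using hDpos.le
  obtain ⟨L, hL, hfin, hrank⟩ := PerfectoidTate.exists_submodule
    (PerfectoidTate.norm_root_lt_one hq hq_lt i) (by exact_mod_cast hDpos) hg hc hcg
  refine ⟨L, ?_, hfin, by rw [hrank, ← hD, Int.cast_natCast]⟩
  ext f
  rw [SetLike.mem_coe, hL]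
  refine and_congr Iff.rfl ?_
  -- Both the order of `f` and `m_y` are `p⁻ⁱ` times an integer order, of `f` and of `g`
  -- respectively; clearing this denominator compares the two.
  have key : ∀ y : (AlgebraicClosure K)ˣ, f ≠ 0 →
      (((-d.mult y : ℚ) : WithTop ℚ) ≤ PerfectoidTate.ordAt y f ↔
        -PerfectoidTate.val (minpoly K (y : AlgebraicClosure K)) g ≤
          PerfectoidTate.val (minpoly K (y : AlgebraicClosure K)) f) := by
    intro y hf
    rw [PerfectoidTate.ordAt_of_ne_zero y hf, WithTop.coe_le_coe, le_div_iff₀ hp0, neg_mul,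
      ← hval y]
    norm_cast
  constructor
  · intro h y
    by_cases hf : f = 0
    · simp [PerfectoidTate.ordAt, hf]
    · exact (key y hf).mpr (h _ (PerfectoidTate.irreducible_minpoly y)
        (PerfectoidTate.minpoly_coeff_zero y) hf)
  · intro h P hP hP0 hf
    obtain ⟨y, hy⟩ := PerfectoidTate.exists_associated_minpoly hP hP0
    rw [PerfectoidTate.val_eq_of_associated hy, PerfectoidTate.val_eq_of_associated hy]
    exact (key y hf).mp (h y)
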